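/- Let $\mathbb F$ be an infinite field. For $n\ge 1$ let $T(\mathbb F^n)$ be the Tits building (the nerve of the poset of proper non-zero subspaces of $\mathbb F^n$), let $\mathrm{St}(\mathbb F^n)=\tilde H_{n-2}(T(\mathbb F^n);\mathbb Z)$ be the Steinberg module, viewed as the group of top-dimensional cycles in the free abelian group on complete flags of $\mathbb F^n$, and put $\mathrm{St}^2(\mathbb F^n)=\mathrm{St}(\mathbb F^n)\otimes_{\mathbb Z}\mathrm{St}(\mathbb F^n)$ with the diagonal $\mathrm{GL}_n(\mathbb F)$-action. Let $\langle-,-\rangle$ be the restriction to $\mathrm{St}(\mathbb F^n)$ of the bilinear form for which complete flags are orthonormal. For flags $A=(0=A_0<\dots<A_m=\mathbb F^m)$ and $B=(0=B_0<\dots<B_n=\mathbb F^n)$ let $A\cdot B=\sum_{(\mu,\nu)}\mathrm{sign}(\mu,\nu)\,\bigl(A_{i(k)}\oplus B_{j(k)}\bigr)_{0\le k\le m+n}$, the sum being over all $(m,n)$-shuffles $(\mu,\nu)$ of $\{0,\dots,m+n-1\}$, where $i(k)$, $j(k)$ are the numbers of elements less than $k$ of $\mu$ and of $\nu$; this induces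 a product $\mathrm{St}(\mathbb F^m)\otimes\mathrm{St}(\mathbb F^n)\to\mathrm{St}(\mathbb F^{m+n})$. Its tensor square, with the Koszul sign, $(a\otimes b)\cdot(a'\otimes b')=(-1)^{mn}(a\cdot a')\otimes(b\cdot b')$ for $a,b\in\mathrm{St}(\mathbb F^m)$ and $a',b'\in\mathrm{St}(\mathbb F^n)$, induces bilinear products on coinvariants $$\mathrm{St}^2(\mathbb F^m)_{\mathrm{GL}_m(\mathbb F)}\otimes\mathrm{St}^2(\mathbb F^n)_{\mathrm{GL}_n(\mathbb F)}\to\mathrm{St}^2(\mathbb F^{m+n})_{\mathrm{GL}_{m+n}(\mathbb F)},$$ and hence a product on $R=\mathbb Z1\oplus\bigoplus_{n\ge1}\mathrm{St}^2(\mathbb F^n)_{\mathrm{GL}_n(\mathbb F)}$ with unit $1$. For a commutative ring $k$ put $\mathrm{St}^2_k(\mathbb F^n)=k\otimes_{\mathbb Z}\mathrm{St}^2(\mathbb F^n)$ and $R_k=k1\oplus\bigoplus_{n\ge1}\mathrm{St}^2_k(\mathbb F^n)_{\mathrm{GL}_n(\mathbb F)}$, with the $k$-bilinear extension of the product. Then: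 (1) For every $n\ge1$ the form $\langle-,-\rangle$ induces an isomorphism $\mathrm{St}^2(\mathbb F^n)_{\mathrm{GL}_n(\mathbb F)}\cong\mathbb Z$. Let $\gamma_n$ be the element corresponding to $(-1)^{n(n-1)/2}$. (2) $R$ is an associative commutative ring, and there is a ring isomorphism from the divided power algebra $\Gamma_{\mathbb Z}[x]$ on one generator to $R$ which sends the $n$-th divided power $\gamma_n(x)$ to $\gamma_n$ for every $n\ge1$. (3) For every commutative ring $k$, $R_k$ is an associative commutative $k$-algebra, and there is an isomorphism of $k$-algebras $\Gamma_k[x]\cong R_k$ which sends $\gamma_n(x)$ to the image of $\gamma_n$ for every $n\ge1$. -/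

import Mathlib

open scoped TensorProduct DirectSum

noncomputable section

namespace Steinberg

section Building

variable (F : Type*) [Field F] (V : Type*) [AddCommGroup V] [Module F V]

/-- The Tits building: the poset of proper non-zero linear subspaces, ordered by inclusion. -/
abbrev TitsBuilding : Type _ := {W : Submodule F V // W ≠ ⊥ ∧ W ≠ ⊤}

/-- The non-degenerate `(q-1)`-simplices of the nerve of the Tits building: strict chains
`W₀ < ⋯ < W_{q-1}` of `q` proper non-zero subspaces. For `q = 0` there is exactly one (the empty
simplex, which accounts for the augmentation). -/
abbrev Simplices (q : ℕ) : Type _ := Fin q ↪o TitsBuilding F V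

/-- The augmented simplicial chains of degree `q - 1` of the Tits building, with coefficients in
`ℤ`. -/
abbrev Chains (q : ℕ) : Type _ := Simplices F V q →₀ ℤ

instance instModuleChains (q : ℕ) : Module ℤ (Chains F V q) := Finsupp.module _ _

/-- The order embedding of `Fin (q - 1)` into `Fin q` whose image omits exactly `j`. -/
def skip {q : ℕ} (j : Fin q) : Fin (q - 1) ↪o Fin q :=
  OrderEmbedding.ofStrictMono
    (fun i => if i.1 < j.1 then ⟨i.1, by omega⟩ else ⟨i.1 + 1, by omega⟩) (by
      intro i i' h
      have h' : i.1 < i'.1 := h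
      rw [Fin.lt_def]
      dsimp only
      split_ifs <;> simp <;> omega)

variable {F V}

/-- The `j`-th face: delete the `j`-th subspace of a chain. -/
def face {q : ℕ} (j : Fin q) (s : Simplices F V q) : Simplices F V (q - 1) :=
  (skip j).trans s

variable (F V)

/-- The boundary map `∑ j, (-1) ^ j d_j` of the augmented simplicial chain complex. -/
def boundary (q : ℕ) : Chains F V q →ₗ[ℤ] Chains F V (q - 1) :=
  ∑ j : Fin q, (-1 : ℤ) ^ (j : ℕ) • Finsupp.lmapDomain ℤ ℤ (face j)

/-- Cycles of degree `q - 1` in the augmented simplicial chain complex of the Tits building. -/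
abbrev Cycles (q : ℕ) : Submodule ℤ (Chains F V q) := LinearMap.ker (boundary F V q)

instance instModuleCycles (q : ℕ) : Module ℤ (Cycles F V q) := Submodule.module _

end Building

/-- The Steinberg module `St(F^(n+1))`: the top reduced homology `H̃_{n-1}(T(F^(n+1)); ℤ)` of the
Tits building (the index is the dimension minus one, so all dimensions `≥ 1` occur). There are no
simplices of dimension `n` in the building, see `isEmpty_simplices`, so this homology group is the
group of cycles of degree `n - 1`, a subgroup of the free abelian group on complete flags. -/
def St (F : Type*) [Field F] (n : ℕ) : Type _ := Cycles F (Fin (n + 1) → F) n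

instance (F : Type*) [Field F] (n : ℕ) : AddCommGroup (St F n) :=
  inferInstanceAs (AddCommGroup (Cycles F (Fin (n + 1) → F) n))

instance (F : Type*) [Field F] (n : ℕ) : Module ℤ (St F n) :=
  inferInstanceAs (Module ℤ (Cycles F (Fin (n + 1) → F) n))

section Basic

variable {F : Type*} [Field F] {V : Type*} [AddCommGroup V] [Module F V]

theorem face_apply_lt {q : ℕ} (j : Fin q) (s : Simplices F V q) (i : Fin (q - 1))
    (h : i.1 < j.1) : face j s i = s ⟨i.1, by omega⟩ :=
  congrArg s (if_pos h)

theorem face_apply_ge {q : ℕ} (j : Fin q) (s : Simplices F V q) (i : Fin (q - 1))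
    (h : ¬ i.1 < j.1) : face j s i = s ⟨i.1 + 1, by omega⟩ :=
  congrArg s (if_neg h)

theorem finrank_ge [FiniteDimensional F V] {q : ℕ} (s : Simplices F V q) :
    ∀ (i : ℕ) (h : i < q), i + 1 ≤ Module.finrank F (s ⟨i, h⟩).1 := by
  intro i
  induction i with
  | zero =>
    intro h
    have := (s ⟨0, h⟩).2.1
    have h2 : Module.finrank F (s ⟨0, h⟩).1 ≠ 0 := fun h0 => this (Submodule.finrank_eq_zero.1 h0)
    omega
  | succ i ih =>
    intro h
    have h1 := ih (by omega)
    have h2 : (s ⟨i, by omega⟩).1 < (s ⟨i + 1, h⟩).1 := by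
      apply s.strictMono
      simp [Fin.lt_def]
    have := Submodule.finrank_lt_finrank_of_lt h2
    omega

theorem isEmpty_simplices [FiniteDimensional F V] {q : ℕ} (hq : q + 1 = Module.finrank F V) :
    IsEmpty (Simplices F V (q + 1)) := by
  refine ⟨fun s => ?_⟩
  have h1 := finrank_ge s q (by omega)
  have h2 := Submodule.finrank_lt (s ⟨q, by omega⟩).2.2
  omega

theorem finrank_le [FiniteDimensional F V] {q : ℕ} (hq : Module.finrank F V = q + 1)
    (s : Simplices F V q) :
    ∀ (i : ℕ) (h : i < q), Module.finrank F (s ⟨q - 1 - i, by omega⟩).1 + i ≤ q := by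
  intro i
  induction i with
  | zero =>
    intro h
    have := Submodule.finrank_lt (s ⟨q - 1 - 0, by omega⟩).2.2
    omega
  | succ i ih =>
    intro h
    have h1 := ih (by omega)
    have h2 : (s ⟨q - 1 - (i + 1), by omega⟩).1 < (s ⟨q - 1 - i, by omega⟩).1 := by
      apply s.strictMono
      simp [Fin.lt_def]
      omega
    have := Submodule.finrank_lt_finrank_of_lt h2
    omega

theorem finrank_eq [FiniteDimensional F V] {q : ℕ} (hq : Module.finrank F V = q + 1)
    (s : Simplices F V q) (i : Fin q) : Module.finrank F (s i).1 = i.1 + 1 := by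
  have h1 := finrank_ge s i.1 i.2
  have h2 := finrank_le hq s (q - 1 - i.1) (by omega)
  have h3 : (⟨q - 1 - (q - 1 - i.1), by omega⟩ : Fin q) = i := by
    ext; simp; omega
  rw [h3] at h2
  have h4 : (⟨i.1, i.2⟩ : Fin q) = i := rfl
  rw [h4] at h1
  omega

/-- In the top degree distinct faces never agree. -/
theorem face_index_eq [FiniteDimensional F V] {q : ℕ} (hq : Module.finrank F V = q + 1)
    {j k : Fin q} {s t : Simplices F V q} (h : face j s = face k t) : j = k := by
  by_contra hne
  wlog hlt : j.1 < k.1 generalizing j k s t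
  · exact this h.symm (Ne.symm hne) (by
      have : j.1 ≠ k.1 := fun h => hne (Fin.ext h)
      omega)
  have e : face j s ⟨j.1, by omega⟩ = face k t ⟨j.1, by omega⟩ := by rw [h]
  rw [face_apply_ge j s _ (by simp), face_apply_lt k t _ (by simpa using hlt)] at e
  have h1 := finrank_eq hq s ⟨j.1 + 1, by omega⟩
  have h2 := finrank_eq hq t ⟨j.1, by omega⟩
  simp only at e h1 h2
  rw [e] at h1
  omega

/-- Each face of a top-dimensional cycle vanishes. -/
theorem face_eq_zero [FiniteDimensional F V] {q : ℕ} (hq : Module.finrank F V = q + 1)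
    {x : Chains F V q} (hx : x ∈ Cycles F V q) (j : Fin q) :
    Finsupp.mapDomain (face j) x = 0 := by
  ext H
  by_cases hH : H ∈ Set.range (face (F := F) (V := V) j)
  · obtain ⟨s, rfl⟩ := hH
    have h : boundary F V q x (face j s) = 0 := by
      rw [LinearMap.mem_ker.1 hx]; rfl
    simp only [boundary, LinearMap.sum_apply, LinearMap.smul_apply, Finsupp.lmapDomain_apply,
      Finsupp.finsetSum_apply, Finsupp.smul_apply] at h
    rw [Finset.sum_eq_single j] at h
    · simpa using h
    · intro k _ hk
      rw [Finsupp.mapDomain_of_notMem_range, smul_zero]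
      rintro ⟨t, ht⟩
      exact hk (face_index_eq hq ht)
    · simp
  · rw [Finsupp.mapDomain_of_notMem_range _ _ hH]; rfl

theorem mem_cycles_of_face {q : ℕ} {x : Chains F V q}
    (h : ∀ j, Finsupp.mapDomain (face j) x = 0) : x ∈ Cycles F V q := by
  rw [LinearMap.mem_ker]
  simp [boundary, LinearMap.sum_apply, h]

theorem linearCombination_eq_zero [FiniteDimensional F V] {q : ℕ}
    (hq : Module.finrank F V = q + 1) {x : Chains F V q} (hx : x ∈ Cycles F V q) (j : Fin q)
    {M : Type*} [AddCommGroup M] (φ : Simplices F V q → M)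
    (hφ : ∀ s t, face j s = face j t → φ s = φ t) : Finsupp.linearCombination ℤ φ x = 0 := by
  have h : φ = Function.extend (face j) φ 0 ∘ face j := by
    funext s
    exact (Function.FactorsThrough.extend_apply (fun a b hab => hφ a b hab) 0 s).symm
  rw [h, ← Finsupp.linearCombination_mapDomain, face_eq_zero hq hx j, map_zero]

end Basic

section Functoriality

variable {F : Type*} [Field F] {V W X : Type*} [AddCommGroup V] [Module F V]
  [AddCommGroup W] [Module F W] [AddCommGroup X] [Module F X]

/-- A linear isomorphism sends subspaces to their images. -/
def mapBuilding (e : V ≃ₗ[F] W) : TitsBuilding F V ↪o TitsBuilding F W where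
  toFun U := ⟨U.1.map (e : V →ₗ[F] W),
    fun h => U.2.1 ((Submodule.map_eq_bot_iff (e := e)).1 h), fun h => U.2.2 (by
      have h2 := congrArg (Submodule.comap (e : V →ₗ[F] W)) h
      rwa [Submodule.comap_map_eq_of_injective e.injective, Submodule.comap_top] at h2)⟩
  inj' U U' h := Subtype.ext
    (Submodule.map_injective_of_injective (f := (e : V →ₗ[F] W)) e.injective
      (congrArg Subtype.val h))
  map_rel_iff' {U U'} := Submodule.map_le_map_iff_of_injective (f := (e : V →ₗ[F] W)) e.injective
    U.1 U'.1

/-- The induced map on simplices. -/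
def mapSimplex (e : V ≃ₗ[F] W) {q : ℕ} (s : Simplices F V q) : Simplices F W q :=
  s.trans (mapBuilding e)

theorem mapSimplex_apply (e : V ≃ₗ[F] W) {q : ℕ} (s : Simplices F V q) (i : Fin q) :
    (mapSimplex e s i).1 = (s i).1.map (e : V →ₗ[F] W) := rfl

theorem mapSimplex_refl {q : ℕ} (s : Simplices F V q) :
    mapSimplex (LinearEquiv.refl F V) s = s := by
  ext i : 2
  rw [mapSimplex_apply]
  exact Submodule.map_id _

theorem mapSimplex_trans (e : V ≃ₗ[F] W) (f : W ≃ₗ[F] X) {q : ℕ} (s : Simplices F V q) :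
    mapSimplex (e.trans f) s = mapSimplex f (mapSimplex e s) := by
  ext i : 2
  simp only [mapSimplex_apply]
  exact Submodule.map_comp _ _ _

/-- The induced map on chains. -/
def mapChains (e : V ≃ₗ[F] W) (q : ℕ) : Chains F V q →ₗ[ℤ] Chains F W q :=
  Finsupp.lmapDomain ℤ ℤ (mapSimplex e)

theorem mapChains_mem (e : V ≃ₗ[F] W) (q : ℕ) (x : Chains F V q) (hx : x ∈ Cycles F V q) :
    mapChains e q x ∈ Cycles F W q := by
  have h : boundary F W q (mapChains e q x) = mapChains e (q - 1) (boundary F V q x) := by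
    simp only [boundary, LinearMap.sum_apply, LinearMap.smul_apply, map_sum, map_smul, mapChains,
      Finsupp.lmapDomain_apply, ← Finsupp.mapDomain_comp]
    rfl
  rw [LinearMap.mem_ker, h, LinearMap.mem_ker.1 hx, map_zero]

/-- The induced map on cycles. -/
def mapCycles (e : V ≃ₗ[F] W) (q : ℕ) : Cycles F V q →ₗ[ℤ] Cycles F W q :=
  (mapChains e q).restrict (mapChains_mem e q)

theorem mapChains_refl (q : ℕ) (x : Chains F V q) :
    mapChains (LinearEquiv.refl F V) q x = x := by
  have h : mapSimplex (LinearEquiv.refl F V) = (id : Simplices F V q → _) :=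
    funext mapSimplex_refl
  simp [mapChains, h]

theorem mapChains_trans (e : V ≃ₗ[F] W) (f : W ≃ₗ[F] X) (q : ℕ) (x : Chains F V q) :
    mapChains (e.trans f) q x = mapChains f q (mapChains e q x) := by
  have h : mapSimplex (e.trans f) = mapSimplex f ∘ mapSimplex (q := q) e :=
    funext (mapSimplex_trans e f)
  simp [mapChains, h, Finsupp.mapDomain_comp]

end Functoriality

section Pairing

variable {F : Type*} [Field F] {V : Type*} [AddCommGroup V] [Module F V]

variable (F V) in
/-- The bilinear form on chains for which the simplices form an orthonormal basis. -/
def chainPairing (q : ℕ) : Chains F V q →ₗ[ℤ] Chains F V q →ₗ[ℤ] ℤ :=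
  Finsupp.linearCombination ℤ (fun s => (Finsupp.lapply s : Chains F V q →ₗ[ℤ] ℤ))

theorem mapSimplex_injective (e : V ≃ₗ[F] V) (q : ℕ) :
    Function.Injective (mapSimplex e : Simplices F V q → Simplices F V q) := by
  intro s t h
  ext i : 1
  exact (mapBuilding e).injective (DFunLike.congr_fun h i)

theorem chainPairing_map (e : V ≃ₗ[F] V) (q : ℕ) (x y : Chains F V q) :
    chainPairing F V q (mapChains e q x) (mapChains e q y) = chainPairing F V q x y := by
  induction x using Finsupp.induction_linear with
  | zero => simp
  | add f g hf hg => simp only [map_add, LinearMap.add_apply, hf, hg]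
  | single s r =>
    simp [chainPairing, mapChains, Finsupp.mapDomain_apply (mapSimplex_injective e q)]

end Pairing

section Shuffle

/-- `(m, n)`-shuffles `(μ, ν)`, recorded by the set `μ` of `m` elements of `{0, …, m+n-1}`; the
set `ν` is its complement. -/
abbrev Shuffle (m n : ℕ) : Type := {S : Finset (Fin (m + n)) // S.card = m}

/-- The sign of a shuffle, `(-1) ^ ∑ (μ_i - (i - 1))` where `μ_1 < ⋯ < μ_m`. -/
def Shuffle.sign {m n : ℕ} (S : Shuffle m n) : ℤ :=
  (-1) ^ (∑ i ∈ S.1, (i : ℕ)) * (-1) ^ (∑ i ∈ Finset.range m, i)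

/-- The number of elements of `μ` below `k`. -/
def Shuffle.left {m n : ℕ} (S : Shuffle m n) (k : ℕ) : ℕ :=
  (S.1.filter (fun i : Fin _ => i.1 < k)).card

/-- The number of elements of `ν` below `k`. -/
def Shuffle.right {m n : ℕ} (S : Shuffle m n) (k : ℕ) : ℕ :=
  (S.1ᶜ.filter (fun i : Fin _ => i.1 < k)).card

variable {m n : ℕ} (S : Shuffle m n)

theorem Shuffle.left_le (k : ℕ) : S.left k ≤ m :=
  (Finset.card_filter_le _ _).trans S.2.le

theorem Shuffle.right_le (k : ℕ) : S.right k ≤ n := by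
  refine (Finset.card_filter_le _ _).trans ?_
  rw [Finset.card_compl, S.2, Fintype.card_fin]
  omega

theorem Shuffle.left_mono {k l : ℕ} (h : k ≤ l) : S.left k ≤ S.left l :=
  Finset.card_le_card (Finset.monotone_filter_right _ (fun _ _ hi => lt_of_lt_of_le hi h))

theorem Shuffle.right_mono {k l : ℕ} (h : k ≤ l) : S.right k ≤ S.right l :=
  Finset.card_le_card (Finset.monotone_filter_right _ (fun _ _ hi => lt_of_lt_of_le hi h))

theorem card_filter_succ {N : ℕ} (T : Finset (Fin N)) (k : ℕ) (hk : k < N) :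
    (T.filter (fun i : Fin _ => i.1 < k + 1)).card =
      (T.filter (fun i : Fin _ => i.1 < k)).card + if (⟨k, hk⟩ : Fin N) ∈ T then 1 else 0 := by
  have h : T.filter (fun i : Fin _ => i.1 < k + 1) =
      T.filter (fun i : Fin _ => i.1 < k) ∪ T.filter (fun i : Fin N => i = ⟨k, hk⟩) := by
    ext i
    simp only [Finset.mem_filter, Finset.mem_union, Fin.ext_iff, ← and_or_left]
    exact and_congr_right fun _ => by omega
  rw [h, Finset.card_union_of_disjoint]
  · rw [Finset.filter_eq']
    split_ifs <;> simp
  · rw [Finset.disjoint_left]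
    intro i hi hi'
    have h1 := (Finset.mem_filter.1 hi).2
    have h2 := (Finset.mem_filter.1 hi').2
    simp [h2] at h1

theorem Shuffle.left_succ (k : ℕ) (hk : k < m + n) :
    S.left (k + 1) = S.left k + if (⟨k, hk⟩ : Fin (m + n)) ∈ S.1 then 1 else 0 :=
  card_filter_succ _ _ _

theorem Shuffle.right_succ (k : ℕ) (hk : k < m + n) :
    S.right (k + 1) = S.right k + if (⟨k, hk⟩ : Fin (m + n)) ∈ S.1 then 0 else 1 := by
  have := card_filter_succ S.1ᶜ k hk
  rw [Shuffle.right, this, Shuffle.right]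
  congr 1
  by_cases h : (⟨k, hk⟩ : Fin (m + n)) ∈ S.1 <;> simp [h]

theorem Shuffle.left_add_right (k : ℕ) (hk : k ≤ m + n) : S.left k + S.right k = k := by
  induction k with
  | zero => simp [Shuffle.left, Shuffle.right]
  | succ k ih =>
    rw [S.left_succ k (by omega), S.right_succ k (by omega)]
    have := ih (by omega)
    split_ifs <;> omega

/-- Permute the positions of a shuffle by exchanging two of them. -/
def Shuffle.swap (a b : Fin (m + n)) : Shuffle m n :=
  ⟨S.1.map (Equiv.swap a b).toEmbedding, by rw [Finset.card_map, S.2]⟩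

theorem Shuffle.mem_swap (a b i : Fin (m + n)) :
    i ∈ (S.swap a b).1 ↔ Equiv.swap a b i ∈ S.1 := by
  simp only [Shuffle.swap, Finset.mem_map_equiv, Equiv.symm_swap]

theorem Shuffle.swap_swap (a b : Fin (m + n)) : (S.swap a b).swap a b = S := by
  apply Subtype.ext
  ext i
  rw [Shuffle.mem_swap, Shuffle.mem_swap, Equiv.swap_apply_self]

end Shuffle

section Product

variable {F : Type*} [Field F] {V W V' W' : Type*} [AddCommGroup V] [Module F V]
  [AddCommGroup W] [Module F W] [AddCommGroup V'] [Module F V'] [AddCommGroup W'] [Module F W']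

/-- A chain `W₀ < ⋯ < W_{q-1}` of proper non-zero subspaces, extended by `0` on the left and by
the whole space on the right: `0 < W₀ < ⋯ < W_{q-1} < V`. -/
def flag {q : ℕ} (s : Simplices F V q) : ℕ → Submodule F V
  | 0 => ⊥
  | i + 1 => if h : i < q then (s ⟨i, h⟩).1 else ⊤

theorem flag_lt {q : ℕ} (s : Simplices F V q) (hV : (⊥ : Submodule F V) ≠ ⊤) {i j : ℕ}
    (hij : i < j) (hi : i ≤ q) : flag s i < flag s j := by
  obtain ⟨j, rfl⟩ : ∃ l, j = l + 1 := ⟨j - 1, by omega⟩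
  rcases i with _ | i
  · simp only [flag]
    split_ifs with h
    · exact bot_lt_iff_ne_bot.2 (s ⟨j, h⟩).2.1
    · exact bot_lt_iff_ne_bot.2 hV.symm
  · simp only [flag]
    rw [dif_pos (by omega)]
    split_ifs with h
    · exact s.strictMono (by simp [Fin.lt_def]; omega)
    · exact lt_top_iff_ne_top.2 (s ⟨i, by omega⟩).2.2

theorem flag_le {q : ℕ} (s : Simplices F V q) (hV : (⊥ : Submodule F V) ≠ ⊤) {i j : ℕ}
    (hij : i ≤ j) (hj : j ≤ q + 1) : flag s i ≤ flag s j := by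
  rcases hij.eq_or_lt with rfl | h
  · exact le_rfl
  · exact (flag_lt s hV h (by omega)).le

theorem flag_last {q : ℕ} (s : Simplices F V q) : flag s (q + 1) = ⊤ := by simp [flag]

theorem prod_lt_prod {P P' : Submodule F V} {Q Q' : Submodule F W} (hP : P ≤ P') (hQ : Q ≤ Q')
    (h : P < P' ∨ Q < Q') : P.prod Q < P'.prod Q' := by
  refine lt_of_le_of_ne (Submodule.prod_mono hP hQ) fun heq => ?_
  rcases h with h | h
  · refine h.not_ge fun x hx => ?_
    have : ((x, 0) : V × W) ∈ P.prod Q := by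
      rw [heq]; exact ⟨hx, Q'.zero_mem⟩
    exact this.1
  · refine h.not_ge fun x hx => ?_
    have : ((0, x) : V × W) ∈ P.prod Q := by
      rw [heq]; exact ⟨P'.zero_mem, hx⟩
    exact this.2

theorem shuffle_flag_lt {a b : ℕ} (hV : (⊥ : Submodule F V) ≠ ⊤) (hW : (⊥ : Submodule F W) ≠ ⊤)
    (S : Shuffle (a + 1) (b + 1)) (s : Simplices F V a) (t : Simplices F W b) {k l : ℕ}
    (h : k < l) (hl : l ≤ a + 1 + (b + 1)) :
    (flag s (S.left k)).prod (flag t (S.right k)) <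
      (flag s (S.left l)).prod (flag t (S.right l)) := by
  have h1 := S.left_mono h.le
  have h2 := S.right_mono h.le
  have h3 := S.left_add_right k (by omega)
  have h4 := S.left_add_right l hl
  have h5 := S.left_le l
  have h6 := S.right_le l
  refine prod_lt_prod (flag_le s hV h1 h5) (flag_le t hW h2 h6) ?_
  by_cases h7 : S.left k < S.left l
  · exact Or.inl (flag_lt s hV h7 (by omega))
  · exact Or.inr (flag_lt t hW (by omega) (by omega))

/-- The simplex of the building of `V × W` obtained from complete flags
`0 = A₀ < ⋯ < A_{a+1} = V` and `0 = B₀ < ⋯ < B_{b+1} = W` and a shuffle `(μ, ν)`: the chain whose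
`k`-th term (`0 ≤ k ≤ a + b + 2`) is `A_i ⊕ B_j` with `i` and `j` the numbers of elements below `k`
of `μ` and of `ν`, where the terms `0` and `V × W` for `k = 0` and `k = a + b + 2` are left out. -/
def mulSimplex {a b : ℕ} (hV : (⊥ : Submodule F V) ≠ ⊤) (hW : (⊥ : Submodule F W) ≠ ⊤)
    (S : Shuffle (a + 1) (b + 1)) (s : Simplices F V a) (t : Simplices F W b) :
    Simplices F (V × W) (a + 1 + b) :=
  OrderEmbedding.ofStrictMono
    (fun k => ⟨(flag s (S.left (k.1 + 1))).prod (flag t (S.right (k.1 + 1))),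
      (bot_le.trans_lt (shuffle_flag_lt hV hW S s t (Nat.succ_pos k.1) (by omega))).ne',
      ((shuffle_flag_lt hV hW S s t (l := a + 1 + (b + 1)) (k := k.1 + 1)
        (by omega) le_rfl).trans_le le_top).ne⟩)
    (fun _ _ h => shuffle_flag_lt hV hW S s t (Nat.succ_lt_succ h) (by omega))

theorem mulSimplex_apply {a b : ℕ} (hV : (⊥ : Submodule F V) ≠ ⊤) (hW : (⊥ : Submodule F W) ≠ ⊤)
    (S : Shuffle (a + 1) (b + 1)) (s : Simplices F V a) (t : Simplices F W b)
    (k : Fin (a + 1 + b)) : (mulSimplex hV hW S s t k).1 =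
      (flag s (S.left (k.1 + 1))).prod (flag t (S.right (k.1 + 1))) := rfl

/-- The shuffle (Eilenberg–Zilber) product of chains on complete flags. -/
def mulChains {a b : ℕ} (hV : (⊥ : Submodule F V) ≠ ⊤) (hW : (⊥ : Submodule F W) ≠ ⊤) :
    Chains F V a →ₗ[ℤ] Chains F W b →ₗ[ℤ] Chains F (V × W) (a + 1 + b) :=
  Finsupp.linearCombination ℤ fun s => Finsupp.linearCombination ℤ fun t =>
    ∑ S : Shuffle (a + 1) (b + 1), Finsupp.single (mulSimplex hV hW S s t) S.sign

theorem mulChains_single {a b : ℕ} (hV : (⊥ : Submodule F V) ≠ ⊤) (hW : (⊥ : Submodule F W) ≠ ⊤)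
    (s : Simplices F V a) (t : Simplices F W b) (p r : ℤ) :
    mulChains hV hW (Finsupp.single s p) (Finsupp.single t r) = (p * r) •
      ∑ S : Shuffle (a + 1) (b + 1), Finsupp.single (mulSimplex hV hW S s t) S.sign := by
  simp [mulChains, mul_smul]

theorem flag_eq_of_face_eq {q : ℕ} {i : Fin q} {s t : Simplices F V q} (h : face i s = face i t)
    {c : ℕ} (hc : c ≠ i.1 + 1) : flag s c = flag t c := by
  rcases c with _ | c
  · rfl
  · simp only [flag]
    split_ifs with hq
    · by_cases hci : c < i.1
      · have := DFunLike.congr_fun h ⟨c, by omega⟩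
        rw [face_apply_lt _ _ _ (by simpa using hci),
          face_apply_lt _ _ _ (by simpa using hci)] at this
        exact congrArg Subtype.val this
      · obtain ⟨d, rfl⟩ : ∃ d, c = d + 1 := ⟨c - 1, by omega⟩
        have := DFunLike.congr_fun h ⟨d, by omega⟩
        rw [face_apply_ge _ _ _ (by simp; omega),
          face_apply_ge _ _ _ (by simp; omega)] at this
        exact congrArg Subtype.val this
    · rfl

theorem face_eq_of_forall {q : ℕ} {j : Fin q} {s t : Simplices F V q}
    (h : ∀ k, k ≠ j → (s k).1 = (t k).1) : face j s = face j t := by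
  ext i : 2
  by_cases hi : i.1 < j.1
  · rw [face_apply_lt _ _ _ hi, face_apply_lt _ _ _ hi]
    exact h _ (fun e => by have := congrArg Fin.val e; simp at this; omega)
  · rw [face_apply_ge _ _ _ hi, face_apply_ge _ _ _ hi]
    exact h _ (fun e => by have := congrArg Fin.val e; simp at this; omega)

theorem Shuffle.sign_swap {m n : ℕ} (S : Shuffle m n) (k : ℕ) (hk : k + 1 < m + n)
    (h1 : (⟨k, by omega⟩ : Fin (m + n)) ∈ S.1) (h2 : (⟨k + 1, hk⟩ : Fin (m + n)) ∉ S.1) :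
    (S.swap ⟨k, by omega⟩ ⟨k + 1, hk⟩).sign = - S.sign := by
  have h : ∑ i ∈ (S.swap ⟨k, by omega⟩ ⟨k + 1, hk⟩).1, (i : ℕ) = (∑ i ∈ S.1, (i : ℕ)) + 1 := by
    rw [Shuffle.swap]
    simp only [Finset.sum_map, Equiv.coe_toEmbedding]
    rw [← Finset.add_sum_erase _ _ h1, ← Finset.add_sum_erase S.1 _ h1, Equiv.swap_apply_left,
      Finset.sum_congr rfl (g := fun i : Fin (m + n) => (i : ℕ))]
    · simp only; omega
    · intro i hi
      rw [Equiv.swap_apply_of_ne_of_ne (Finset.ne_of_mem_erase hi)]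
      rintro rfl
      exact h2 (Finset.mem_of_mem_erase hi)
  rw [Shuffle.sign, h, Shuffle.sign]
  ring

theorem Shuffle.sign_swap' {m n : ℕ} (S : Shuffle m n) (k : ℕ) (hk : k + 1 < m + n)
    (h : ¬ ((⟨k, by omega⟩ : Fin (m + n)) ∈ S.1 ↔ (⟨k + 1, hk⟩ : Fin (m + n)) ∈ S.1)) :
    (S.swap ⟨k, by omega⟩ ⟨k + 1, hk⟩).sign = - S.sign := by
  by_cases h1 : (⟨k, by omega⟩ : Fin (m + n)) ∈ S.1
  · exact S.sign_swap k hk h1 (fun h2 => h (by simp [h1, h2]))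
  · have h2 : (⟨k + 1, hk⟩ : Fin (m + n)) ∈ S.1 := by
      by_contra h2
      exact h (by simp [h1, h2])
    have := (S.swap ⟨k, by omega⟩ ⟨k + 1, hk⟩).sign_swap k hk
      (by rw [Shuffle.mem_swap, Equiv.swap_apply_left]; exact h2)
      (by rw [Shuffle.mem_swap, Equiv.swap_apply_right]; exact h1)
    rw [Shuffle.swap_swap] at this
    rw [this, neg_neg]

theorem Shuffle.left_swap {m n : ℕ} (S : Shuffle m n) (k : ℕ) (hk : k + 1 < m + n) (l : ℕ)
    (hl : l ≠ k + 1) : (S.swap ⟨k, by omega⟩ ⟨k + 1, hk⟩).left l = S.left l := by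
  rw [Shuffle.left, Shuffle.swap]
  simp only [Finset.filter_map, Finset.card_map]
  rw [Shuffle.left]
  congr 1
  apply Finset.filter_congr
  intro i _
  simp only [Function.comp, Equiv.coe_toEmbedding]
  rcases eq_or_ne i ⟨k, by omega⟩ with rfl | h1
  · rw [Equiv.swap_apply_left]; simp only; omega
  · rcases eq_or_ne i ⟨k + 1, hk⟩ with rfl | h2
    · rw [Equiv.swap_apply_right]; simp only; omega
    · rw [Equiv.swap_apply_of_ne_of_ne h1 h2]

theorem Shuffle.right_swap {m n : ℕ} (S : Shuffle m n) (k : ℕ) (hk : k + 1 < m + n) (l : ℕ)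
    (hl : l ≠ k + 1) (hl' : l ≤ m + n) :
    (S.swap ⟨k, by omega⟩ ⟨k + 1, hk⟩).right l = S.right l := by
  have h1 := (S.swap ⟨k, by omega⟩ ⟨k + 1, hk⟩).left_add_right l hl'
  have h2 := S.left_add_right l hl'
  have h3 := S.left_swap k hk l hl
  omega

/-- The product of top-dimensional cycles is a cycle. -/
theorem mulChains_mem [FiniteDimensional F V] [FiniteDimensional F W] {a b : ℕ}
    (ha : Module.finrank F V = a + 1) (hb : Module.finrank F W = b + 1)
    (hV : (⊥ : Submodule F V) ≠ ⊤) (hW : (⊥ : Submodule F W) ≠ ⊤)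
    {x : Chains F V a} {y : Chains F W b} (hx : x ∈ Cycles F V a) (hy : y ∈ Cycles F W b) :
    mulChains hV hW x y ∈ Cycles F (V × W) (a + 1 + b) := by
  apply mem_cycles_of_face
  intro j
  let T : Shuffle (a + 1) (b + 1) → Chains F V a →ₗ[ℤ] Chains F W b →ₗ[ℤ]
      Chains F (V × W) (a + 1 + b - 1) := fun S =>
    Finsupp.linearCombination ℤ fun s => Finsupp.linearCombination ℤ fun t =>
      Finsupp.single (face j (mulSimplex hV hW S s t)) 1
  have hT : ∀ S s t p r, T S (Finsupp.single s p) (Finsupp.single t r) =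
      (p * r) • Finsupp.single (face j (mulSimplex hV hW S s t)) 1 := by
    intro S s t p r
    simp [T]
  have key : ∀ (x : Chains F V a) (y : Chains F W b),
      Finsupp.mapDomain (face j) (mulChains hV hW x y) = ∑ S, S.sign • T S x y := by
    intro x y
    rw [← Finsupp.lmapDomain_apply ℤ ℤ]
    induction x using Finsupp.induction_linear with
    | zero => simp
    | add f g hf hg =>
      simp only [map_add, LinearMap.add_apply, hf, hg, smul_add, Finset.sum_add_distrib]
    | single s p =>
      induction y using Finsupp.induction_linear with
      | zero => simp
      | add f g hf hg => simp only [map_add, hf, hg, smul_add, Finset.sum_add_distrib]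
      | single t r =>
        simp only [mulChains_single, hT, map_smul, map_sum, Finsupp.lmapDomain_apply,
          Finsupp.mapDomain_single, Finset.smul_sum]
        refine Finset.sum_congr rfl fun S _ => ?_
        rw [smul_comm S.sign (p * r), Finsupp.smul_single S.sign, smul_eq_mul, mul_one]
  rw [key]
  have hj := j.2
  have hk : j.1 + 1 < a + 1 + (b + 1) := by omega
  -- two consecutive steps in the same direction
  have same : ∀ S : Shuffle (a + 1) (b + 1),
      ((⟨j.1, by omega⟩ : Fin (a + 1 + (b + 1))) ∈ S.1 ↔
        (⟨j.1 + 1, hk⟩ : Fin (a + 1 + (b + 1))) ∈ S.1) → T S x y = 0 := by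
    intro S hS
    have e1 := S.left_succ j.1 (by omega)
    have e2 := S.left_succ (j.1 + 1) hk
    have f1 := S.right_succ j.1 (by omega)
    have f2 := S.right_succ (j.1 + 1) hk
    have l1 := S.left_le (j.1 + 1 + 1)
    have r1 := S.right_le (j.1 + 1 + 1)
    by_cases h1 : (⟨j.1, by omega⟩ : Fin (a + 1 + (b + 1))) ∈ S.1
    · have h2 := hS.1 h1
      rw [if_pos h1] at e1 f1
      rw [if_pos h2] at e2 f2
      have : T S x = 0 := by
        refine linearCombination_eq_zero ha hx ⟨S.left j.1, by omega⟩ _ ?_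
        intro s s' hs
        congr 1
        funext t
        congr 1
        apply face_eq_of_forall
        intro k hkj
        rw [mulSimplex_apply, mulSimplex_apply, flag_eq_of_face_eq hs]
        simp only
        rcases lt_or_gt_of_ne (fun h => hkj (Fin.ext h) : k.1 ≠ j.1) with h | h
        · have := S.left_mono (show k.1 + 1 ≤ j.1 by omega)
          omega
        · have := S.left_mono (show j.1 + 1 + 1 ≤ k.1 + 1 by omega)
          omega
      rw [this]; rfl
    · have h2 := fun h => h1 (hS.2 h)
      rw [if_neg h1] at e1 f1
      rw [if_neg h2] at e2 f2
      have : ∀ s p, T S (Finsupp.single s p) y = 0 := by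
        intro s p
        simp only [T, Finsupp.linearCombination_single, LinearMap.smul_apply]
        rw [linearCombination_eq_zero hb hy ⟨S.right j.1, by omega⟩, smul_zero]
        intro t t' ht
        congr 1
        apply face_eq_of_forall
        intro k hkj
        rw [mulSimplex_apply, mulSimplex_apply, flag_eq_of_face_eq ht]
        simp only
        rcases lt_or_gt_of_ne (fun h => hkj (Fin.ext h) : k.1 ≠ j.1) with h | h
        · have := S.right_mono (show k.1 + 1 ≤ j.1 by omega)
          omega
        · have := S.right_mono (show j.1 + 1 + 1 ≤ k.1 + 1 by omega)
          omega
      clear hx key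
      induction x using Finsupp.induction_linear with
      | zero => simp
      | add f g hf hg => rw [map_add, LinearMap.add_apply, hf, hg, add_zero]
      | single s p => exact this s p
  -- exchanging two consecutive steps in different directions
  have swapT : ∀ S : Shuffle (a + 1) (b + 1),
      T (S.swap ⟨j.1, by omega⟩ ⟨j.1 + 1, hk⟩) = T S := by
    intro S
    simp only [T]
    congr 1
    funext s
    congr 1
    funext t
    congr 1
    apply face_eq_of_forall
    intro k hkj
    have hne : k.1 + 1 ≠ j.1 + 1 := fun h => hkj (Fin.ext (by omega))
    rw [mulSimplex_apply, mulSimplex_apply, S.left_swap _ _ _ hne,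
      S.right_swap _ _ _ hne (by omega)]
  refine Finset.sum_involution (fun S _ => S.swap ⟨j.1, by omega⟩ ⟨j.1 + 1, hk⟩) ?_ ?_
    (fun _ _ => Finset.mem_univ _) (fun S _ => S.swap_swap _ _)
  · intro S _
    by_cases hS : ((⟨j.1, by omega⟩ : Fin (a + 1 + (b + 1))) ∈ S.1 ↔
        (⟨j.1 + 1, hk⟩ : Fin (a + 1 + (b + 1))) ∈ S.1)
    · rw [swapT, same S hS, smul_zero, smul_zero, add_zero]
    · rw [swapT, S.sign_swap' _ hk hS, neg_smul, add_neg_cancel]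
  · intro S _ hne heq
    by_cases hS : ((⟨j.1, by omega⟩ : Fin (a + 1 + (b + 1))) ∈ S.1 ↔
        (⟨j.1 + 1, hk⟩ : Fin (a + 1 + (b + 1))) ∈ S.1)
    · exact hne (by rw [same S hS, smul_zero])
    · have h1 := S.sign_swap' _ hk hS
      rw [heq] at h1
      have h2 : S.sign = 0 := by omega
      exact hne (by rw [h2, zero_smul])

/-- The product of top-dimensional cycles. -/
def mulCycles [FiniteDimensional F V] [FiniteDimensional F W] {a b : ℕ}
    (ha : Module.finrank F V = a + 1) (hb : Module.finrank F W = b + 1)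
    (hV : (⊥ : Submodule F V) ≠ ⊤) (hW : (⊥ : Submodule F W) ≠ ⊤) :
    Cycles F V a →ₗ[ℤ] Cycles F W b →ₗ[ℤ] Cycles F (V × W) (a + 1 + b) :=
  LinearMap.mk₂ ℤ
    (fun x y => ⟨mulChains hV hW x.1 y.1, mulChains_mem ha hb hV hW x.2 y.2⟩)
    (fun x x' y => Subtype.ext (LinearMap.map_add₂ (mulChains hV hW) x.1 x'.1 y.1))
    (fun c x y => Subtype.ext (LinearMap.map_smul₂ (mulChains hV hW) c x.1 y.1))
    (fun x y y' => Subtype.ext (map_add (mulChains hV hW x.1) y.1 y'.1))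
    (fun c x y => Subtype.ext (map_smul (mulChains hV hW x.1) c y.1))

theorem flag_map (g : V ≃ₗ[F] V') {q : ℕ} (s : Simplices F V q) (c : ℕ) :
    flag (mapSimplex g s) c = (flag s c).map (g : V →ₗ[F] V') := by
  rcases c with _ | c
  · simp [flag]
  · simp only [flag]
    split_ifs
    · rfl
    · rw [Submodule.map_top]
      exact (LinearEquiv.range g).symm

theorem mulChains_map {a b : ℕ} (hV : (⊥ : Submodule F V) ≠ ⊤) (hW : (⊥ : Submodule F W) ≠ ⊤)
    (g : V ≃ₗ[F] V) (h : W ≃ₗ[F] W) (x : Chains F V a) (y : Chains F W b) :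
    mulChains hV hW (mapChains g a x) (mapChains h b y) =
      mapChains (g.prodCongr h) (a + 1 + b) (mulChains hV hW x y) := by
  have key : ∀ (S : Shuffle (a + 1) (b + 1)) s t,
      mulSimplex hV hW S (mapSimplex g s) (mapSimplex h t) =
        mapSimplex (g.prodCongr h) (mulSimplex hV hW S s t) := by
    intro S s t
    ext k : 2
    rw [mapSimplex_apply, mulSimplex_apply, mulSimplex_apply, flag_map, flag_map]
    ext ⟨v, w⟩
    simp only [Submodule.mem_prod, Submodule.mem_map, Prod.exists]
    constructor
    · rintro ⟨⟨v', hv, rfl⟩, ⟨w', hw, rfl⟩⟩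
      exact ⟨v', w', ⟨hv, hw⟩, rfl⟩
    · rintro ⟨v', w', ⟨hv, hw⟩, e⟩
      exact ⟨⟨v', hv, congrArg Prod.fst e⟩, ⟨w', hw, congrArg Prod.snd e⟩⟩
  induction x using Finsupp.induction_linear with
  | zero => simp
  | add f g hf hg => simp only [map_add, LinearMap.add_apply, hf, hg]
  | single s p =>
    induction y using Finsupp.induction_linear with
    | zero => simp
    | add f g hf hg => simp only [map_add, hf, hg]
    | single t r =>
      simp only [mapChains, Finsupp.lmapDomain_apply, Finsupp.mapDomain_single, mulChains_single,
        Finsupp.mapDomain_smul, Finsupp.mapDomain_finsetSum, key]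

end Product

section SteinbergModule

variable (F : Type*) [Field F]

/-- The group `GL(F^n)` of linear automorphisms of `F^n`. -/
abbrev GLn (n : ℕ) : Type _ := (Fin n → F) ≃ₗ[F] (Fin n → F)

/-- The action of `GL(F^(n+1))` on the Steinberg module. -/
def stRep (n : ℕ) : Representation ℤ (GLn F (n + 1)) (St F n) where
  toFun g := mapCycles g n
  map_one' := LinearMap.ext fun x => Subtype.ext (mapChains_refl n x.1)
  map_mul' g h := LinearMap.ext fun x => Subtype.ext (mapChains_trans h g n x.1)

/-- The bilinear form on the Steinberg module, the restriction of the form on chains for which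
complete flags are orthonormal. -/
def stPairing (n : ℕ) : St F n →ₗ[ℤ] St F n →ₗ[ℤ] ℤ :=
  (chainPairing F (Fin (n + 1) → F) n).domRestrict₁₂ (Cycles F (Fin (n + 1) → F) n)
    (Cycles F (Fin (n + 1) → F) n)

/-- `St²(F^(n+1)) = St(F^(n+1)) ⊗ St(F^(n+1))`. -/
def StSq (n : ℕ) : Type _ := St F n ⊗[ℤ] St F n

instance (n : ℕ) : AddCommGroup (StSq F n) := inferInstanceAs (AddCommGroup (St F n ⊗[ℤ] St F n))

instance (n : ℕ) : Module ℤ (StSq F n) := inferInstanceAs (Module ℤ (St F n ⊗[ℤ] St F n))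

variable {F} in
/-- The pure tensors in `St²(F^(n+1))`. -/
def StSq.tmul {n : ℕ} (a b : St F n) : StSq F n := (a ⊗ₜ[ℤ] b : St F n ⊗[ℤ] St F n)

/-- The diagonal action of `GL(F^(n+1))` on `St²(F^(n+1))`. -/
def stSqRep (n : ℕ) : Representation ℤ (GLn F (n + 1)) (StSq F n) :=
  (stRep F n).tprod (stRep F n)

/-- The coinvariants `St²(F^(n+1))_{GL(F^(n+1))}`. -/
def Coinv (n : ℕ) : Type _ := (stSqRep F n).Coinvariants

instance (n : ℕ) : AddCommGroup (Coinv F n) := inferInstanceAs (AddCommGroup (stSqRep F n).Coinvariants)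

instance (n : ℕ) : Module ℤ (Coinv F n) := inferInstanceAs (Module ℤ (stSqRep F n).Coinvariants)

/-- The class of an element in the coinvariants. -/
def Coinv.mk (n : ℕ) : StSq F n →ₗ[ℤ] Coinv F n := Representation.Coinvariants.mk (stSqRep F n)

/-- The map `St²(F^(n+1))_{GL(F^(n+1))} → ℤ` induced by the bilinear form. -/
def coinvPairing (n : ℕ) : Coinv F n →ₗ[ℤ] ℤ :=
  Representation.Coinvariants.lift (stSqRep F n)
    (TensorProduct.lift (stPairing F n) : St F n ⊗[ℤ] St F n →ₗ[ℤ] ℤ) fun g =>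
    TensorProduct.ext' fun x y => chainPairing_map g n x.1 y.1

theorem coinvPairing_mk_tmul (n : ℕ) (x y : St F n) :
    coinvPairing F n (Coinv.mk F n (StSq.tmul x y)) = stPairing F n x y := rfl

/-- The standard isomorphism `F^(m+1) ⊕ F^(n+1) ≃ F^(m+n+2)`, concatenating coordinates. -/
def sumEquiv (m n : ℕ) :
    ((Fin (m + 1) → F) × (Fin (n + 1) → F)) ≃ₗ[F] (Fin (m + 1 + n + 1) → F) :=
  (LinearEquiv.sumArrowLequivProdArrow (Fin (m + 1)) (Fin (n + 1)) F F).symm.trans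
    (LinearEquiv.funCongrLeft F F (finSumFinEquiv (m := m + 1) (n := n + 1)).symm)

theorem bot_ne_top' (n : ℕ) : (⊥ : Submodule F (Fin (n + 1) → F)) ≠ ⊤ := bot_ne_top

/-- The product `St(F^(m+1)) ⊗ St(F^(n+1)) → St(F^(m+1) ⊕ F^(n+1)) = St(F^(m+n+2))`. -/
def stMul (m n : ℕ) : St F m →ₗ[ℤ] St F n →ₗ[ℤ] St F (m + 1 + n) :=
  (mulCycles (by simp) (by simp) (bot_ne_top' F m) (bot_ne_top' F n)).compr₂
    (mapCycles (sumEquiv F m n) (m + 1 + n))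

theorem stMul_coe (m n : ℕ) (x : St F m) (y : St F n) : (stMul F m n x y).1 =
    mapChains (sumEquiv F m n) (m + 1 + n)
      (mulChains (bot_ne_top' F m) (bot_ne_top' F n) x.1 y.1) := rfl

/-- The block sum of two automorphisms. -/
def blockSum (m n : ℕ) (g : GLn F (m + 1)) (h : GLn F (n + 1)) : GLn F (m + 1 + n + 1) :=
  ((sumEquiv F m n).symm.trans (g.prodCongr h)).trans (sumEquiv F m n)

theorem stMul_map (m n : ℕ) (g : GLn F (m + 1)) (h : GLn F (n + 1)) (x : St F m) (y : St F n) :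
    stMul F m n (stRep F m g x) (stRep F n h y) =
      stRep F (m + 1 + n) (blockSum F m n g h) (stMul F m n x y) := by
  apply Subtype.ext
  change mapChains _ _ (mulChains _ _ (mapChains g m x.1) (mapChains h n y.1)) =
    mapChains (blockSum F m n g h) _ (mapChains (sumEquiv F m n) _ (mulChains _ _ x.1 y.1))
  rw [mulChains_map, ← mapChains_trans, ← mapChains_trans]
  congr 1
  congr 1
  ext v : 1
  simp [blockSum]

/-- The product `St²(F^(m+1)) ⊗ St²(F^(n+1)) → St²(F^(m+n+2))`: the tensor square of the product
on Steinberg modules, where `St(F^d)` is placed in degree `d`, so that by the Koszul rule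
`(a ⊗ b) · (a' ⊗ b') = (-1) ^ (|b| |a'|) (a · a') ⊗ (b · b')`. -/
def stSqMul (m n : ℕ) : StSq F m →ₗ[ℤ] StSq F n →ₗ[ℤ] StSq F (m + 1 + n) :=
  (-1 : ℤ) ^ ((m + 1) * (n + 1)) • (TensorProduct.map₂ (stMul F m n) (stMul F m n) :
    (St F m ⊗[ℤ] St F m) →ₗ[ℤ] (St F n ⊗[ℤ] St F n) →ₗ[ℤ]
      (St F (m + 1 + n) ⊗[ℤ] St F (m + 1 + n)))

theorem stSqMul_tmul (m n : ℕ) (a b : St F m) (c d : St F n) :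
    stSqMul F m n (StSq.tmul a b) (StSq.tmul c d) =
      (-1 : ℤ) ^ ((m + 1) * (n + 1)) • StSq.tmul (stMul F m n a c) (stMul F m n b d) := rfl

theorem stSqRep_tmul (n : ℕ) (g : GLn F (n + 1)) (a b : St F n) :
    stSqRep F n g (StSq.tmul a b) = StSq.tmul (stRep F n g a) (stRep F n g b) := rfl

theorem stSq_induction {n : ℕ} {P : StSq F n → Prop} (x : StSq F n) (h0 : P 0)
    (ht : ∀ a b : St F n, P (StSq.tmul a b)) (ha : ∀ x y, P x → P y → P (x + y)) : P x :=
  TensorProduct.induction_on (motive := P) x h0 ht ha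

theorem stSqMul_map (m n : ℕ) (g : GLn F (m + 1)) (h : GLn F (n + 1)) (x : StSq F m)
    (y : StSq F n) : stSqMul F m n (stSqRep F m g x) (stSqRep F n h y) =
      stSqRep F (m + 1 + n) (blockSum F m n g h) (stSqMul F m n x y) := by
  induction x using stSq_induction with
  | h0 => simp
  | ha x x' hx hx' => simp only [map_add, LinearMap.add_apply, hx, hx']
  | ht a b =>
    induction y using stSq_induction with
    | h0 => simp
    | ha x x' hx hx' => simp only [map_add, hx, hx']
    | ht c d =>
      rw [stSqRep_tmul, stSqRep_tmul, stSqMul_tmul, stSqMul_tmul, stMul_map, stMul_map]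
      rw [map_smul, stSqRep_tmul]

end SteinbergModule

section Coinvariants

/-- A bilinear map which is equivariant along a map `G × H → K` descends to coinvariants. -/
def coinvMul {k : Type*} [CommRing k] {G H K A B C : Type*} [Monoid G] [Monoid H] [Monoid K]
    [AddCommGroup A] [Module k A] [AddCommGroup B] [Module k B] [AddCommGroup C] [Module k C]
    (ρ : Representation k G A) (σ : Representation k H B) (τ : Representation k K C)
    (μ : A →ₗ[k] B →ₗ[k] C) (φ : G → H → K)
    (hμ : ∀ g h a b, μ (ρ g a) (σ h b) = τ (φ g h) (μ a b)) :
    ρ.Coinvariants →ₗ[k] σ.Coinvariants →ₗ[k] τ.Coinvariants :=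
  Representation.Coinvariants.lift ρ
    (LinearMap.flip
      (Representation.Coinvariants.lift σ
        (LinearMap.flip (μ.compr₂ (Representation.Coinvariants.mk τ)))
        (fun h => LinearMap.ext fun b => LinearMap.ext fun a => by
          have := hμ 1 h a b
          rw [map_one, Module.End.one_apply] at this
          simp [this])))
    (fun g => LinearMap.ext fun a => Representation.Coinvariants.hom_ext
      (LinearMap.ext fun b => by
        have := hμ g 1 a b
        rw [map_one, Module.End.one_apply] at this
        simp [this]))

theorem coinvMul_mk {k : Type*} [CommRing k] {G H K A B C : Type*} [Monoid G] [Monoid H] [Monoid K]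
    [AddCommGroup A] [Module k A] [AddCommGroup B] [Module k B] [AddCommGroup C] [Module k C]
    (ρ : Representation k G A) (σ : Representation k H B) (τ : Representation k K C)
    (μ : A →ₗ[k] B →ₗ[k] C) (φ : G → H → K)
    (hμ : ∀ g h a b, μ (ρ g a) (σ h b) = τ (φ g h) (μ a b)) (a : A) (b : B) :
    coinvMul ρ σ τ μ φ hμ (Representation.Coinvariants.mk ρ a) (Representation.Coinvariants.mk σ b) =
      Representation.Coinvariants.mk τ (μ a b) := rfl

end Coinvariants

section BaseChange

variable (k : Type*) [CommRing k] (F : Type*) [Field F]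

/-- The product on `⨁_{d ≥ 1} St²(F^d)_{GL(F^d)}` induced by direct sum. -/
def coinvSqMul (m n : ℕ) : Coinv F m →ₗ[ℤ] Coinv F n →ₗ[ℤ] Coinv F (m + 1 + n) :=
  coinvMul (stSqRep F m) (stSqRep F n) (stSqRep F (m + 1 + n)) (stSqMul F m n) (blockSum F m n)
    (stSqMul_map F m n)

theorem coinvSqMul_mk (m n : ℕ) (x : StSq F m) (y : StSq F n) :
    coinvSqMul F m n (Coinv.mk F m x) (Coinv.mk F n y) =
      Coinv.mk F (m + 1 + n) (stSqMul F m n x y) := rfl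

/-- `St²_k(F^(n+1)) = k ⊗ St²(F^(n+1))`. -/
abbrev StSqOver (n : ℕ) : Type _ := k ⊗[ℤ] StSq F n

/-- The action of `GL(F^(n+1))` on `St²_k(F^(n+1))`. -/
def stSqOverRep (n : ℕ) : Representation k (GLn F (n + 1)) (StSqOver k F n) where
  toFun g := LinearMap.baseChange k (stSqRep F n g)
  map_one' := by rw [map_one]; exact LinearMap.baseChange_id
  map_mul' g h := by rw [map_mul]; exact LinearMap.baseChange_comp _ _

theorem stSqOverRep_tmul (n : ℕ) (g : GLn F (n + 1)) (c : k) (z : StSq F n) :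
    stSqOverRep k F n g (c ⊗ₜ z) = c ⊗ₜ stSqRep F n g z := rfl

/-- The `k`-bilinear extension of the product on `St²`. -/
def stSqOverMul (m n : ℕ) :
    StSqOver k F m →ₗ[k] StSqOver k F n →ₗ[k] StSqOver k F (m + 1 + n) :=
  TensorProduct.curry
    ((LinearMap.baseChange k (TensorProduct.lift (stSqMul F m n))).comp
      (TensorProduct.AlgebraTensorModule.distribBaseChange ℤ k (StSq F m) (StSq F n)).symm.toLinearMap)

theorem stSqOverMul_tmul (m n : ℕ) (a b : k) (x : StSq F m) (y : StSq F n) :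
    stSqOverMul k F m n (a ⊗ₜ x) (b ⊗ₜ y) = (a * b) ⊗ₜ[ℤ] stSqMul F m n x y := by
  simp [stSqOverMul]

theorem stSqOverMul_map (m n : ℕ) (g : GLn F (m + 1)) (h : GLn F (n + 1)) (x : StSqOver k F m)
    (y : StSqOver k F n) : stSqOverMul k F m n (stSqOverRep k F m g x) (stSqOverRep k F n h y) =
      stSqOverRep k F (m + 1 + n) (blockSum F m n g h) (stSqOverMul k F m n x y) := by
  induction x using TensorProduct.induction_on with
  | zero => simp
  | add x x' hx hx' => simp only [map_add, LinearMap.add_apply, hx, hx']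
  | tmul a b =>
    induction y using TensorProduct.induction_on with
    | zero => simp
    | add x x' hx hx' => simp only [map_add, hx, hx']
    | tmul c d =>
      rw [stSqOverRep_tmul, stSqOverRep_tmul, stSqOverMul_tmul, stSqOverMul_tmul,
        stSqOverRep_tmul, stSqMul_map]

/-- The coinvariants `St²_k(F^(n+1))_{GL(F^(n+1))}`. -/
def CoinvOver (n : ℕ) : Type _ := (stSqOverRep k F n).Coinvariants

instance (n : ℕ) : AddCommGroup (CoinvOver k F n) :=
  inferInstanceAs (AddCommGroup (stSqOverRep k F n).Coinvariants)

instance (n : ℕ) : Module k (CoinvOver k F n) :=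
  inferInstanceAs (Module k (stSqOverRep k F n).Coinvariants)

/-- The class of an element in the coinvariants. -/
def CoinvOver.mk (n : ℕ) : StSqOver k F n →ₗ[k] CoinvOver k F n :=
  Representation.Coinvariants.mk (stSqOverRep k F n)

/-- The product on `⨁_{d ≥ 1} St²_k(F^d)_{GL(F^d)}` induced by direct sum. -/
def coinvOverMul (m n : ℕ) :
    CoinvOver k F m →ₗ[k] CoinvOver k F n →ₗ[k] CoinvOver k F (m + 1 + n) :=
  coinvMul (stSqOverRep k F m) (stSqOverRep k F n) (stSqOverRep k F (m + 1 + n))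
    (stSqOverMul k F m n) (blockSum F m n) (stSqOverMul_map k F m n)

theorem coinvOverMul_mk (m n : ℕ) (x : StSqOver k F m) (y : StSqOver k F n) :
    coinvOverMul k F m n (CoinvOver.mk k F m x) (CoinvOver.mk k F n y) =
      CoinvOver.mk k F (m + 1 + n) (stSqOverMul k F m n x y) := rfl

/-- The map `St²(F^(n+1))_{GL} → St²_k(F^(n+1))_{GL}`, `[z] ↦ [1 ⊗ z]`. -/
def coinvBaseChange (n : ℕ) : Coinv F n →+ CoinvOver k F n :=
  (Representation.Coinvariants.lift (stSqRep F n)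
    (((CoinvOver.mk k F n).toAddMonoidHom.comp
      (TensorProduct.mk ℤ k (StSq F n) 1).toAddMonoidHom).toIntLinearMap) (fun g =>
        LinearMap.ext fun z =>
          Representation.Coinvariants.mk_self_apply (stSqOverRep k F n) g
            ((1 : k) ⊗ₜ[ℤ] z))).toAddMonoidHom

theorem coinvBaseChange_mk (n : ℕ) (z : StSq F n) :
    coinvBaseChange k F n (Coinv.mk F n z) = CoinvOver.mk k F n (1 ⊗ₜ z) := rfl

end BaseChange

section GradedRing

variable {k : Type*} [CommRing k] (A : ℕ → Type*) [∀ n, AddCommGroup (A n)]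
  [∀ n, Module k (A n)] (μ : ∀ m n, A m →ₗ[k] A n →ₗ[k] A (m + 1 + n))

/-- The multiplication on a direct sum `⨁_{d ≥ 1} A_d` of `k`-modules (the `n`-th summand `A n` has
degree `d = n + 1`) given by bilinear maps `A_d × A_e → A_{d+e}`. -/
def directSumMul : (⨁ n, A n) →ₗ[k] (⨁ n, A n) →ₗ[k] (⨁ n, A n) :=
  DirectSum.toModule k ℕ _ fun m => LinearMap.flip <| DirectSum.toModule k ℕ _ fun n =>
    LinearMap.flip ((μ m n).compr₂ (DirectSum.lof k ℕ A (m + 1 + n)))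

theorem directSumMul_lof (m n : ℕ) (x : A m) (y : A n) :
    directSumMul A μ (DirectSum.lof k ℕ A m x) (DirectSum.lof k ℕ A n y) =
      DirectSum.lof k ℕ A (m + 1 + n) (μ m n x y) := by
  rw [directSumMul, DirectSum.toModule_lof, LinearMap.flip_apply, DirectSum.toModule_lof]
  rfl

/-- The direct sum `⨁_{d ≥ 1} A_d`, with the multiplication `directSumMul`. -/
def PositivePart {k : Type*} [CommRing k] (A : ℕ → Type*) [∀ n, AddCommGroup (A n)]
    [∀ n, Module k (A n)] (_μ : ∀ m n, A m →ₗ[k] A n →ₗ[k] A (m + 1 + n)) : Type _ :=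
  ⨁ n, A n

instance : AddCommGroup (PositivePart A μ) := inferInstanceAs (AddCommGroup (⨁ n, A n))

instance : Module k (PositivePart A μ) := inferInstanceAs (Module k (⨁ n, A n))

instance : NonUnitalNonAssocRing (PositivePart A μ) where
  mul x y := directSumMul A μ x y
  left_distrib x y z := map_add (directSumMul A μ x) y z
  right_distrib x y z := LinearMap.map_add₂ (directSumMul A μ) x y z
  zero_mul x := LinearMap.map_zero₂ (directSumMul A μ) x
  mul_zero x := map_zero (directSumMul A μ x)

/-- The inclusion of a summand. -/
def PositivePart.of (n : ℕ) : A n →ₗ[k] PositivePart A μ := DirectSum.lof k ℕ A n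

theorem PositivePart.of_mul_of (m n : ℕ) (x : A m) (y : A n) :
    of A μ m x * of A μ n y = of A μ (m + 1 + n) (μ m n x y) :=
  directSumMul_lof A μ m n x y

end GradedRing

section SteinbergAlgebra

variable (F : Type*) [Field F]

/-- `⨁_{d ≥ 1} St²(F^d)_{GL(F^d)}` with the product induced by direct sum. -/
abbrev CoinvPositive : Type _ := PositivePart (Coinv F) (coinvSqMul F)

/-- `ℤ 1 ⊕ ⨁_{d ≥ 1} St²(F^d)_{GL(F^d)}` with the product induced by direct sum; the first summand
is spanned by the unit element. -/
abbrev CoinvAlgebra : Type _ := Unitization ℤ (CoinvPositive F)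

/-- The inclusion of `St²(F^(n+1))_{GL(F^(n+1))}`. -/
def CoinvAlgebra.of (n : ℕ) (z : Coinv F n) : CoinvAlgebra F :=
  Unitization.inr (PositivePart.of (Coinv F) (coinvSqMul F) n z)

variable (k : Type*) [CommRing k]

/-- `⨁_{d ≥ 1} St²_k(F^d)_{GL(F^d)}` with the product induced by direct sum. -/
abbrev CoinvPositiveOver : Type _ := PositivePart (CoinvOver k F) (coinvOverMul k F)

/-- `k 1 ⊕ ⨁_{d ≥ 1} St²_k(F^d)_{GL(F^d)}` with the product induced by direct sum; the first
summand is spanned by the unit element. -/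
abbrev CoinvAlgebraOver : Type _ := Unitization k (CoinvPositiveOver F k)

/-- The inclusion of `St²_k(F^(n+1))_{GL(F^(n+1))}`. -/
def CoinvAlgebraOver.of (n : ℕ) (z : CoinvOver k F n) : CoinvAlgebraOver F k :=
  Unitization.inr (PositivePart.of (CoinvOver k F) (coinvOverMul k F) n z)

end SteinbergAlgebra

end Steinberg

end

/-! The heart of the matter is that the class of x ⊗ y in the coinvariants equals ⟨x, y⟩ c for one
fixed c. This makes the map induced by the form injective; a pair of cycles with product one makes
it surjective (`exists_flagPairing_eq_one`).

Joining with a line spanned by a non-zero w ∈ U is a contracting homotopy: a cycle x of U is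
recovered by `join F w` from its top face `dropTop F V x`, which is a sum of cycles of hyperplanes
of U (`join_dropTop`). So the class of x ⊗ y is a sum of values at pairs (join w a, join w b), with
a and b cycles of hyperplanes H and H'. If H = H' and w ∉ H, the value is an equivariant form on the
cycles of H, hence ⟨a, b⟩ c₁ by induction on the dimension. If H ≠ H', put N = H ∩ H'. By
`mem_span_join`, itself a consequence of the three-term relation `join_join`, one may take a = join
l a' and b = join l' b' with a', b' cycles of N. For generic w = v + s l + t l' the value is then an
equivariant form on the cycles of N which also depends on v ∈ N, and by induction it is ⟨a', b'⟩ c₂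
= ⟨dropTop a, dropTop b⟩ c₂. This is why the induction concerns forms depending on a vector
(`IsSystem`) and yields a formula for generic vectors only; generic vectors exist because the field
is infinite. Both cases are covered by the biadditive expression ⟨a, b⟩ (c₁ - c₂) + ⟨dropTop a,
dropTop b⟩ c₂. Summed up at the top faces of x and y its second term vanishes, since a second top
face of a cycle is zero. Hence c = c₁ - c₂ (`IsSystem.exists_generic_formula`).

For the ring structure, a flag occurring in a shuffle product determines the two factors and the
shuffle. The form is therefore multiplicative up to the number of shuffles, a binomial coefficient
(`chainPairing_mulChains`), and the Koszul sign is absorbed by the signs (-1)^(n(n-1)/2)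
(`neg_one_pow_triangle`). So γ_m γ_n = C(m+n, m) γ_{m+n}, with γ_n a basis in degree n, and these
structure constants determine the algebra (`IsDividedPowerSystem.exists_linearEquiv`). Over k the
images of the γ_n still generate, and the base change of the form shows that they are still free. -/

noncomputable section

namespace Steinberg

/-! ### Flags as lists, cycles, and joins with lines. -/

section FlagChains

variable {F : Type*} [Field F] {V : Type*} [AddCommGroup V] [Module F V]

variable (F V) in
/-- Chains on flags of a vector space, a flag being recorded as the list of its non-zero members,
the largest one first. -/
abbrev FlagChains : Type _ := List (Submodule F V) →₀ ℤ

/-- Put the subspace `U` on top of each flag. -/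
def consTop (U : Submodule F V) : FlagChains F V →ₗ[ℤ] FlagChains F V :=
  Finsupp.lmapDomain ℤ ℤ (List.cons U)

variable (F V) in
/-- Remove the largest subspace of each flag. -/
def dropTop : FlagChains F V →ₗ[ℤ] FlagChains F V :=
  Finsupp.linearCombination ℤ fun t : List (Submodule F V) => match t with
    | [] => 0
    | _ :: s => Finsupp.single s 1

/-- The join of the line spanned by `v` with a flag. -/
def joinFlag (v : V) : List (Submodule F V) → FlagChains F V
  | [] => Finsupp.single [F ∙ v] 1
  | H :: t => consTop (H ⊔ F ∙ v) (Finsupp.single (H :: t) 1 - joinFlag v t)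

variable (F) in
/-- The join with the line spanned by `v`. -/
def join (v : V) : FlagChains F V →ₗ[ℤ] FlagChains F V :=
  Finsupp.linearCombination ℤ (joinFlag v)

theorem consTop_single (U : Submodule F V) (t : List (Submodule F V)) (c : ℤ) :
    consTop U (Finsupp.single t c) = Finsupp.single (U :: t) c :=
  Finsupp.mapDomain_single

theorem join_single (v : V) (t : List (Submodule F V)) :
    join F v (Finsupp.single t 1) = joinFlag v t := by
  simp [join]

theorem dropTop_single_nil (c : ℤ) : dropTop F V (Finsupp.single [] c) = 0 := by
  simp [dropTop]

theorem dropTop_consTop (U : Submodule F V) (x : FlagChains F V) :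
    dropTop F V (consTop U x) = x := by
  induction x using Finsupp.induction_linear with
  | zero => simp
  | add f g hf hg => simp only [map_add, hf, hg]
  | single t c => simp [consTop_single, dropTop]

theorem join_consTop (v : V) (U : Submodule F V) (x : FlagChains F V) :
    join F v (consTop U x) = consTop (U ⊔ F ∙ v) (consTop U x - join F v x) := by
  induction x using Finsupp.induction_linear with
  | zero => simp
  | add f g hf hg => simp only [map_add, hf, hg, map_sub]; abel
  | single t c =>
    have h : Finsupp.single t c = c • (Finsupp.single t 1 : FlagChains F V) := by simp
    rw [h, map_smul, map_smul, map_smul, ← smul_sub, map_smul, consTop_single, join_single,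
      join_single]
    rfl

/-- The homotopy identity ∂h + h∂ = 1, with the top face alone in the role of ∂. It is built into
the recursion for `joinFlag`, and it holds for the empty flag because `dropTop` kills that flag. -/
theorem dropTop_join (v : V) (x : FlagChains F V) :
    dropTop F V (join F v x) = x - join F v (dropTop F V x) := by
  induction x using Finsupp.induction_linear with
  | zero => simp
  | add f g hf hg => simp only [map_add, hf, hg]; abel
  | single t c =>
    have h : Finsupp.single t c = c • (Finsupp.single t 1 : FlagChains F V) := by simp
    rw [h]
    simp only [map_smul, ← smul_sub]
    congr 1
    cases t with
    | nil =>
      rw [join_single, dropTop_single_nil, map_zero, sub_zero, joinFlag, ← consTop_single,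
        dropTop_consTop]
    | cons U t => rw [← consTop_single, join_consTop, dropTop_consTop, dropTop_consTop]

theorem join_smul {s : F} (hs : s ≠ 0) (v : V) : join F (s • v) = join F v := by
  have h : ∀ t : List (Submodule F V), joinFlag (s • v) t = joinFlag v t := by
    intro t
    induction t with
    | nil => rw [joinFlag, joinFlag, Submodule.span_singleton_smul_eq (IsUnit.mk0 s hs)]
    | cons U t ih =>
      rw [joinFlag, joinFlag, Submodule.span_singleton_smul_eq (IsUnit.mk0 s hs), ih]
  rw [join, join, funext h]

/-- The top-dimensional cycles of the Tits building of an `n`-dimensional subspace `U`: the faces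
of a flag of `U` are obtained by deleting a subspace other than `U`. -/
def flagCycles : ℕ → Submodule F V → Submodule ℤ (FlagChains F V)
  | 0, U => Submodule.span ℤ {x | U = ⊥ ∧ x = Finsupp.single [] 1}
  | n + 1, U => (LinearMap.ker (dropTop F V) ⊓
      ⨆ H : {H : Submodule F V // H ⋖ U}, flagCycles n H.1).map (consTop U)

/-- The sums of cycles of the hyperplanes of `U`. -/
def hyperplaneCycles (n : ℕ) (U : Submodule F V) : Submodule ℤ (FlagChains F V) :=
  ⨆ H : {H : Submodule F V // H ⋖ U}, flagCycles n H.1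

theorem mem_hyperplaneCycles {n : ℕ} {U H : Submodule F V} (hH : H ⋖ U) {x : FlagChains F V}
    (hx : x ∈ flagCycles n H) : x ∈ hyperplaneCycles n U :=
  Submodule.mem_iSup_of_mem (p := fun H : {H : Submodule F V // H ⋖ U} => flagCycles n H.1)
    ⟨H, hH⟩ hx

theorem hyperplaneCycles_induction {n : ℕ} {U : Submodule F V} {P : FlagChains F V → Prop}
    {x : FlagChains F V} (hx : x ∈ hyperplaneCycles n U)
    (mem : ∀ H, H ⋖ U → ∀ x ∈ flagCycles n H, P x) (zero : P 0)
    (add : ∀ x y, P x → P y → P (x + y)) : P x :=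
  Submodule.iSup_induction _ (motive := P) hx (fun H x hx => mem H.1 H.2 x hx) zero add

theorem map_mem_of_mem_hyperplaneCycles {n : ℕ} {U : Submodule F V} {M : Type*} [AddCommGroup M]
    (f : FlagChains F V →ₗ[ℤ] M) (S : Submodule ℤ M)
    (hf : ∀ H, H ⋖ U → ∀ x ∈ flagCycles n H, f x ∈ S) {x : FlagChains F V}
    (hx : x ∈ hyperplaneCycles n U) : f x ∈ S :=
  (iSup_le fun H x hx => hf H.1 H.2 x hx : hyperplaneCycles n U ≤ S.comap f) hx

theorem mem_flagCycles_zero {U : Submodule F V} {x : FlagChains F V}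
    (hx : x ∈ flagCycles 0 U) : ∃ c : ℤ, x = Finsupp.single [] c := by
  rw [flagCycles] at hx
  induction hx using Submodule.span_induction with
  | mem x h => exact ⟨1, h.2⟩
  | zero => exact ⟨0, by simp⟩
  | add x y _ _ h h' =>
    obtain ⟨c, rfl⟩ := h
    obtain ⟨d, rfl⟩ := h'
    exact ⟨c + d, by simp⟩
  | smul a x _ h =>
    obtain ⟨c, rfl⟩ := h
    exact ⟨a * c, by simp⟩

theorem flagCycles_zero_of_ne {U : Submodule F V} (hU : U ≠ ⊥) {x : FlagChains F V}
    (hx : x ∈ flagCycles 0 U) : x = 0 := by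
  rw [flagCycles] at hx
  simpa [hU] using hx

theorem single_nil_mem_flagCycles (c : ℤ) :
    Finsupp.single [] c ∈ flagCycles 0 (⊥ : Submodule F V) := by
  have h : Finsupp.single [] c = c • (Finsupp.single [] 1 : FlagChains F V) := by simp
  rw [h]
  exact Submodule.smul_mem _ _ (Submodule.subset_span ⟨rfl, rfl⟩)

/-- A cycle of U is determined by its top face, so the recursive definition can be expressed by
conditions on that face. All later inductions use this form. -/
theorem mem_flagCycles_succ {n : ℕ} {U : Submodule F V} {x : FlagChains F V} :
    x ∈ flagCycles (n + 1) U ↔ dropTop F V x ∈ hyperplaneCycles n U ∧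
      dropTop F V (dropTop F V x) = 0 ∧ consTop U (dropTop F V x) = x := by
  constructor
  · rintro ⟨z, ⟨h1, h2⟩, rfl⟩
    rw [dropTop_consTop]
    exact ⟨h2, h1, rfl⟩
  · rintro ⟨h1, h2, h3⟩
    exact ⟨_, ⟨h2, h1⟩, h3⟩

theorem dropTop_dropTop {n : ℕ} {U : Submodule F V} {x : FlagChains F V}
    (hx : x ∈ flagCycles n U) : dropTop F V (dropTop F V x) = 0 := by
  cases n with
  | zero =>
    obtain ⟨c, rfl⟩ := mem_flagCycles_zero hx
    rw [dropTop_single_nil, map_zero]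
  | succ n => exact (mem_flagCycles_succ.1 hx).2.1

/-- The defining formula of the join, for a cycle. -/
theorem join_of_mem {n : ℕ} {U : Submodule F V} {x : FlagChains F V} (hx : x ∈ flagCycles n U)
    (v : V) : join F v x = consTop (U ⊔ F ∙ v) (x - join F v (dropTop F V x)) := by
  cases n with
  | zero =>
    by_cases hU : U = ⊥
    · subst hU
      obtain ⟨c, rfl⟩ := mem_flagCycles_zero hx
      rw [dropTop_single_nil, map_zero, sub_zero, bot_sup_eq, consTop_single]
      simp [join, joinFlag]
    · simp [flagCycles_zero_of_ne hU hx]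
  | succ n =>
    have h := (mem_flagCycles_succ.1 hx).2.2
    conv_lhs => rw [← h, join_consTop, h]

theorem sup_span_singleton_eq {U H : Submodule F V} (hH : H ⋖ U) {w : V} (hw : w ∈ U)
    (hwH : w ∉ H) : H ⊔ F ∙ w = U := by
  have h1 : H ≤ H ⊔ F ∙ w := le_sup_left
  have h2 : H ⊔ F ∙ w ≤ U := sup_le hH.le ((Submodule.span_singleton_le_iff_mem _ _).2 hw)
  rcases hH.eq_or_eq h1 h2 with h | h
  · exact absurd (h ▸ Submodule.mem_sup_right (Submodule.mem_span_singleton_self w)) hwH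
  · exact h

/-- The two assertions need each other: both in smaller dimension give the second one for U, and the
second one for U gives the first one for U. -/
theorem join_eq_zero_and_join_dropTop (n : ℕ) : ∀ {U : Submodule F V} {x : FlagChains F V} {w : V},
    x ∈ flagCycles n U → w ∈ U → w ≠ 0 → join F w x = 0 ∧ join F w (dropTop F V x) = x := by
  induction n with
  | zero =>
    intro U x w hx hw hw0
    have hU : U ≠ ⊥ := by rintro rfl; exact hw0 ((Submodule.mem_bot F).1 hw)
    simp [flagCycles_zero_of_ne hU hx]
  | succ n ih =>
    intro U x w hx hw hw0
    obtain ⟨h1, h2, h3⟩ := mem_flagCycles_succ.1 hx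
    -- For a cycle of a hyperplane H without w this is the formula for the join, as H + w = U. If w
    -- ∈ H, both sides vanish by induction.
    have key : ∀ z ∈ hyperplaneCycles n U,
        join F w z = consTop U (z - join F w (dropTop F V z)) := by
      intro z hz
      refine hyperplaneCycles_induction
        (P := fun z => join F w z = consTop U (z - join F w (dropTop F V z))) hz ?_ (by simp) ?_
      · intro H hH z hz
        by_cases hwH : w ∈ H
        · obtain ⟨e1, e2⟩ := ih hz hwH hw0
          rw [e1, e2, sub_self, map_zero]
        · rw [join_of_mem hz, sup_span_singleton_eq hH hw hwH]
      · intro y z hy hz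
        simp only [map_add, hy, hz, map_sub]; abel
    have e : join F w (dropTop F V x) = x := by
      rw [key _ h1, h2, map_zero, sub_zero, h3]
    refine ⟨?_, e⟩
    rw [join_of_mem hx, e, sub_self, map_zero]

/-- The join with a line contained in the ambient space vanishes. -/
theorem join_eq_zero {n : ℕ} {U : Submodule F V} {x : FlagChains F V} {w : V}
    (hx : x ∈ flagCycles n U) (hw : w ∈ U) (hw0 : w ≠ 0) : join F w x = 0 :=
  (join_eq_zero_and_join_dropTop n hx hw hw0).1

/-- Joins are contracting homotopies. -/
theorem join_dropTop {n : ℕ} {U : Submodule F V} {x : FlagChains F V} {w : V}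
    (hx : x ∈ flagCycles n U) (hw : w ∈ U) (hw0 : w ≠ 0) : join F w (dropTop F V x) = x :=
  (join_eq_zero_and_join_dropTop n hx hw hw0).2

theorem covBy_sup_span_singleton {N : Submodule F V} {w : V} (hw : w ∉ N) : N ⋖ N ⊔ F ∙ w := by
  rw [sup_comm]
  exact Submodule.covBy_span_singleton_sup hw

theorem inf_sup_span_singleton {H N : Submodule F V} (h : H ≤ N) {w : V} (hw : w ∉ N) :
    N ⊓ (H ⊔ F ∙ w) = H := by
  rw [inf_comm, sup_inf_assoc_of_le _ h]
  have : F ∙ w ⊓ N = ⊥ := by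
    rw [eq_bot_iff]
    rintro v ⟨hv, hvN⟩
    obtain ⟨c, rfl⟩ := Submodule.mem_span_singleton.1 hv
    by_cases hc : c = 0
    · simp [hc]
    · exact absurd ((Submodule.smul_mem_iff _ hc).1 hvN) hw
  rw [this, sup_bot_eq]

theorem sup_span_singleton_covBy {H N : Submodule F V} (h : H ⋖ N) {w : V} (hw : w ∉ N) :
    H ⊔ F ∙ w ⋖ N ⊔ F ∙ w := by
  have h1 : N ⊓ (H ⊔ F ∙ w) ⋖ N := by rwa [inf_sup_span_singleton h.le hw]
  have h2 := covBy_sup_of_inf_covBy_left h1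
  rwa [← sup_assoc, sup_eq_left.2 h.le] at h2

/-- Below the new top N + w lie x, a cycle of the hyperplane N, and the joins of the hyperplane
cycles making up `dropTop F V x`, which are cycles of the spaces H + w by induction. The next top
face cancels by the homotopy identity. -/
theorem join_mem (n : ℕ) : ∀ {N : Submodule F V} {x : FlagChains F V} {w : V},
    x ∈ flagCycles n N → w ∉ N → join F w x ∈ flagCycles (n + 1) (N ⊔ F ∙ w) := by
  induction n with
  | zero =>
    intro N x w hx hw
    obtain ⟨c, hc⟩ := mem_flagCycles_zero hx
    rw [mem_flagCycles_succ, join_of_mem hx, dropTop_consTop, hc, dropTop_single_nil, map_zero,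
      sub_zero, ← hc]
    refine ⟨mem_hyperplaneCycles (covBy_sup_span_singleton hw) hx, ?_, rfl⟩
    rw [hc, dropTop_single_nil]
  | succ n ih =>
    intro N x w hx hw
    rw [mem_flagCycles_succ, join_of_mem hx, dropTop_consTop]
    refine ⟨Submodule.sub_mem _ (mem_hyperplaneCycles (covBy_sup_span_singleton hw) hx) ?_, ?_, rfl⟩
    · refine map_mem_of_mem_hyperplaneCycles _ _ ?_ (mem_flagCycles_succ.1 hx).1
      · intro H hH y hy
        exact mem_hyperplaneCycles (sup_span_singleton_covBy hH hw) (ih hy fun h => hw (hH.le h))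
    · rw [map_sub, dropTop_join, dropTop_dropTop hx, map_zero, sub_zero, sub_self]

theorem join_dropTop_mem {n : ℕ} {N : Submodule F V} {x : FlagChains F V} {w : V}
    (hx : x ∈ flagCycles (n + 1) N) (hw : w ∉ N) :
    join F w (dropTop F V x) ∈ ⨆ H : {H : Submodule F V // H ⋖ N},
      flagCycles (n + 1) (H.1 ⊔ F ∙ w) := by
  refine map_mem_of_mem_hyperplaneCycles _ _ ?_ (mem_flagCycles_succ.1 hx).1
  · intro H hH y hy
    exact Submodule.mem_iSup_of_mem (p := fun H : {H : Submodule F V // H ⋖ N} =>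
      flagCycles (n + 1) (H.1 ⊔ F ∙ w)) ⟨H, hH⟩ (join_mem n hy fun h => hw (hH.le h))

/-- The three-term relation. -/
theorem join_join {n : ℕ} {M : Submodule F V} {x : FlagChains F V} {v w l : V}
    (hx : x ∈ flagCycles n M) (hl : l ∉ M) (hw : w ∉ M ⊔ F ∙ l) (hv : v ∈ F ∙ l ⊔ F ∙ w)
    (hv0 : v ≠ 0) :
    join F w (join F l x) = join F v (join F l x) - join F v (join F w x) := by
  have hle : ∀ H : Submodule F V, F ∙ l ⊔ F ∙ w ≤ H ⊔ F ∙ l ⊔ F ∙ w := fun H => by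
    rw [sup_assoc]; exact le_sup_right
  have h1 := join_mem n hx hl
  have h2 := join_mem (n + 1) h1 hw
  -- The left side is a cycle of a space containing v, so it is the join of v with its own top face.
  -- Expanding that face by the homotopy identity gives the right side and one more term.
  have h3 := join_dropTop h2 (hle M hv) hv0
  -- The extra term vanishes: it joins v to cycles of spaces H + l + w, which contain v already.
  have h4 : join F v (join F w (join F l (dropTop F V x))) = 0 := by
    cases n with
    | zero =>
      obtain ⟨c, rfl⟩ := mem_flagCycles_zero hx
      simp [dropTop_single_nil]
    | succ n =>
      refine hyperplaneCycles_induction (P := fun y => join F v (join F w (join F l y)) = 0)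
        (mem_flagCycles_succ.1 hx).1 ?_ (by simp) ?_
      · intro H hH y hy
        exact join_eq_zero (join_mem (n + 1) (join_mem n hy fun h => hl (hH.le h))
          fun h => hw (sup_le_sup_right hH.le _ h)) (hle H hv) hv0
      · intro y z hy hz
        rw [map_add, map_add, map_add, hy, hz, add_zero]
  rw [← h3, dropTop_join, dropTop_join]
  simp only [map_sub, h4, sub_zero]

/-- The three-term relation with v = l, where the first term on the right is a join with a line
already contained in the space. -/
theorem join_comm {n : ℕ} {M : Submodule F V} {x : FlagChains F V} {w l : V}
    (hx : x ∈ flagCycles n M) (hl : l ∉ M) (hw : w ∉ M ⊔ F ∙ l) :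
    join F w (join F l x) = - join F l (join F w x) := by
  have hl0 : l ≠ 0 := by rintro rfl; exact hl (Submodule.zero_mem _)
  rw [join_join hx hl hw (Submodule.mem_sup_left (Submodule.mem_span_singleton_self l)) hl0,
    join_eq_zero (join_mem n hx hl) (Submodule.mem_sup_right (Submodule.mem_span_singleton_self l))
      hl0, zero_sub]

theorem inf_covBy_of_covBy {H N U : Submodule F V} (hH : H ⋖ U) (hN : N ⋖ U) (hne : H ≠ N) :
    N ⊓ H ⋖ H := by
  have h : N ⊔ H = U := by
    rcases hN.eq_or_eq (c := N ⊔ H) le_sup_left (sup_le hN.le hH.le) with h | h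
    · have h' : H ≤ N := by rw [← h]; exact le_sup_right
      rcases hH.eq_or_eq h' hN.le with h'' | h''
      · exact absurd h''.symm hne
      · exact absurd h'' hN.ne
    · exact h
  exact inf_covBy_of_covBy_sup_left (by rwa [h])

/-- The cycles of `U` are generated by the joins of cycles of a hyperplane. -/
theorem mem_span_join (n : ℕ) : ∀ {N U : Submodule F V} {x : FlagChains F V}, N ⋖ U →
    x ∈ flagCycles (n + 1) U → x ∈ Submodule.span ℤ
      {x | ∃ l a, l ∈ U ∧ l ∉ N ∧ a ∈ flagCycles n N ∧ x = join F l a} := by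
  induction n with
  | zero =>
    intro N U x hN hx
    obtain ⟨w, hwU, hwN⟩ := Set.exists_of_ssubset hN.lt
    have hw0 : w ≠ 0 := by rintro rfl; exact hwN (Submodule.zero_mem _)
    rw [← join_dropTop hx hwU hw0]
    refine map_mem_of_mem_hyperplaneCycles _ _ ?_ (mem_flagCycles_succ.1 hx).1
    · intro H hH h hh
      by_cases hHb : H = ⊥
      · subst hHb
        rcases hH.eq_or_eq (c := N) bot_le hN.le with e | e
        · subst e
          exact Submodule.subset_span ⟨w, h, hwU, hwN, hh, rfl⟩
        · exact absurd e hN.ne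
      · rw [flagCycles_zero_of_ne hHb hh, map_zero]
        exact Submodule.zero_mem _
  | succ n ih =>
    intro N U x hN hx
    obtain ⟨w, hwU, hwN⟩ := Set.exists_of_ssubset hN.lt
    have hw0 : w ≠ 0 := by rintro rfl; exact hwN (Submodule.zero_mem _)
    rw [← join_dropTop hx hwU hw0]
    refine map_mem_of_mem_hyperplaneCycles _ _ ?_ (mem_flagCycles_succ.1 hx).1
    · intro H hH h hh
      by_cases hwH : w ∈ H
      · rw [join_eq_zero hh hwH hw0]; exact Submodule.zero_mem _
      by_cases hHN : H = N
      · subst hHN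
        exact Submodule.subset_span ⟨w, h, hwU, hwN, hh, rfl⟩
      have hMH : N ⊓ H ⋖ H := inf_covBy_of_covBy hH hN hHN
      have hMN : N ⊓ H ⋖ N := by rw [inf_comm]; exact inf_covBy_of_covBy hN hH (Ne.symm hHN)
      have hspan := ih hMH hh
      refine Submodule.span_induction (p := fun h _ => join F w h ∈ _) ?_ ?_ ?_ ?_ hspan
      · rintro _ ⟨l, a, hlH, hlM, ha, rfl⟩
        have hlN : l ∉ N := fun h => hlM ⟨h, hlH⟩
        have hlU := hH.le hlH
        -- Subtract a multiple of l from w to land in N: w = v + s l. The lines of v, l and w are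
        -- then coplanar, and the three-term relation trades the inner join with l for one with v,
        -- which produces a cycle of N.
        have hw' : w ∈ N ⊔ F ∙ l := by rw [sup_span_singleton_eq hN hlU hlN]; exact hwU
        obtain ⟨v, hvN, y, hy, hvy⟩ := Submodule.mem_sup.1 hw'
        obtain ⟨s, rfl⟩ := Submodule.mem_span_singleton.1 hy
        have hvH : v ∉ H := fun h => hwH (by
          rw [← hvy]; exact H.add_mem h (H.smul_mem _ hlH))
        have hvM : v ∉ N ⊓ H := fun h => hvH h.2
        have hs : s ≠ 0 := by
          rintro rfl
          rw [zero_smul, add_zero] at hvy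
          exact hwN (hvy ▸ hvN)
        have eN : N ⊓ H ⊔ F ∙ v = N := sup_span_singleton_eq hMN hvN hvM
        have eH : N ⊓ H ⊔ F ∙ l = H := sup_span_singleton_eq hMH hlH hlM
        have hl0 : l ≠ 0 := by rintro rfl; exact hlN (Submodule.zero_mem _)
        have hlvw : l ∈ F ∙ v ⊔ F ∙ w := by
          have : l = (-s⁻¹) • v + s⁻¹ • w := by
            rw [← hvy, smul_add, smul_smul, inv_mul_cancel₀ hs, one_smul, neg_smul]; abel
          rw [this]
          exact Submodule.add_mem_sup (Submodule.smul_mem _ _ (Submodule.mem_span_singleton_self v))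
            (Submodule.smul_mem _ _ (Submodule.mem_span_singleton_self w))
        have e1 := join_join (v := l) ha hvM (w := w) (by rwa [eN]) hlvw hl0
        have e2 := join_comm ha hlM (w := w) (by rwa [eH])
        have e3 : join F w (join F l a) = join F w (join F v a) - join F l (join F v a) := by
          rw [e1, e2]; abel
        have hva : join F v a ∈ flagCycles (n + 1) N := by
          have := join_mem n ha hvM
          rwa [eN] at this
        rw [e3]
        exact Submodule.sub_mem _ (Submodule.subset_span ⟨w, _, hwU, hwN, hva, rfl⟩)
          (Submodule.subset_span ⟨l, _, hlU, hlN, hva, rfl⟩)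
      · rw [map_zero]; exact Submodule.zero_mem _
      · intro y z _ _ hy hz
        rw [map_add]; exact Submodule.add_mem _ hy hz
      · intro c y _ hy
        rw [map_smul]; exact Submodule.smul_mem _ _ hy

end FlagChains

/-! ### The form on flag chains, and orthogonality through the tops of flags. -/

section FlagPairing

variable {F : Type*} [Field F] {V : Type*} [AddCommGroup V] [Module F V]

variable (F V) in
/-- The bilinear form for which the flags are orthonormal. -/
def flagPairing : FlagChains F V →ₗ[ℤ] FlagChains F V →ₗ[ℤ] ℤ :=
  Finsupp.linearCombination ℤ fun t => (Finsupp.lapply t : FlagChains F V →ₗ[ℤ] ℤ)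

theorem flagPairing_single (s t : List (Submodule F V)) (a b : ℤ) :
    flagPairing F V (Finsupp.single s a) (Finsupp.single t b) =
      a * (Finsupp.single t b : FlagChains F V) s := by
  simp [flagPairing]

theorem flagPairing_consTop (U : Submodule F V) (x y : FlagChains F V) :
    flagPairing F V (consTop U x) (consTop U y) = flagPairing F V x y := by
  induction x using Finsupp.induction_linear with
  | zero => simp
  | add f g hf hg => simp only [map_add, LinearMap.add_apply, hf, hg]
  | single s a =>
    induction y using Finsupp.induction_linear with
    | zero => simp
    | add f g hf hg => simp only [map_add, hf, hg]
    | single t b =>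
      classical
      simp [consTop_single, flagPairing_single, Finsupp.single_apply]

theorem flagPairing_eq_zero {S T : Set (List (Submodule F V))} (hST : Disjoint S T)
    {x y : FlagChains F V} (hx : x ∈ Finsupp.supported ℤ ℤ S) (hy : y ∈ Finsupp.supported ℤ ℤ T) :
    flagPairing F V x y = 0 := by
  rw [flagPairing, Finsupp.linearCombination_apply, Finsupp.sum, LinearMap.sum_apply]
  refine Finset.sum_eq_zero fun t ht => ?_
  have h1 : t ∈ S := hx ht
  have h2 : y t = 0 := by
    by_contra h
    exact Set.disjoint_left.1 hST h1 (hy (Finsupp.mem_support_iff.2 h))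
  simp [h2]

/-- The largest subspace of a flag, `0` for the empty flag. -/
def flagTop (t : List (Submodule F V)) : Submodule F V := t.headD ⊥

theorem flagCycles_le_supported (n : ℕ) (U : Submodule F V) :
    flagCycles n U ≤ Finsupp.supported ℤ ℤ {t | flagTop t = U} := by
  intro x hx
  cases n with
  | zero =>
    by_cases hU : U = ⊥
    · obtain ⟨c, rfl⟩ := mem_flagCycles_zero hx
      exact Finsupp.single_mem_supported ℤ _ hU.symm
    · rw [flagCycles_zero_of_ne hU hx]; exact Submodule.zero_mem _
  | succ n =>
    rw [← (mem_flagCycles_succ.1 hx).2.2]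
    classical
    intro t ht
    have := Finsupp.mapDomain_support ht
    obtain ⟨s, _, rfl⟩ := Finset.mem_image.1 this
    rfl

theorem flagPairing_eq_zero_of_ne {n : ℕ} {U U' : Submodule F V} (h : U ≠ U')
    {x y : FlagChains F V} (hx : x ∈ flagCycles n U) (hy : y ∈ flagCycles n U') :
    flagPairing F V x y = 0 :=
  flagPairing_eq_zero (Set.disjoint_left.2 fun _ h1 h2 => h (h1.symm.trans h2))
    (flagCycles_le_supported n U hx) (flagCycles_le_supported n U' hy)

/-- Control of the tops of the correction term in `join_of_mem`. Comparing tops is what kills the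
mixed terms whenever two joins are paired. -/
theorem join_dropTop_mem_supported {n : ℕ} {N : Submodule F V} {x : FlagChains F V} {w : V}
    (hx : x ∈ flagCycles n N) (hw : w ∉ N) :
    join F w (dropTop F V x) ∈ Finsupp.supported ℤ ℤ
      {t | ∃ K, K ⋖ N ∧ flagTop t = K ⊔ F ∙ w} := by
  cases n with
  | zero =>
    obtain ⟨c, rfl⟩ := mem_flagCycles_zero hx
    rw [dropTop_single_nil, map_zero]; exact Submodule.zero_mem _
  | succ n =>
    refine (iSup_le fun H => ?_ : _ ≤ Finsupp.supported ℤ ℤ _) (join_dropTop_mem hx hw)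
    refine (flagCycles_le_supported _ _).trans (Finsupp.supported_mono fun t ht => ?_)
    exact ⟨H.1, H.2, ht⟩

end FlagPairing

/-! ### The action of linear automorphisms on flag chains. -/

section FlagAction

variable {F : Type*} [Field F] {V : Type*} [AddCommGroup V] [Module F V]

/-- The action of a linear automorphism on flag chains. -/
def flagMap (g : V ≃ₗ[F] V) : FlagChains F V →ₗ[ℤ] FlagChains F V :=
  Finsupp.lmapDomain ℤ ℤ (List.map (Submodule.map (g : V →ₗ[F] V)))

theorem flagMap_single (g : V ≃ₗ[F] V) (t : List (Submodule F V)) (c : ℤ) :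
    flagMap g (Finsupp.single t c) =
      Finsupp.single (t.map (Submodule.map (g : V →ₗ[F] V))) c :=
  Finsupp.mapDomain_single

theorem flagMap_consTop (g : V ≃ₗ[F] V) (U : Submodule F V) (x : FlagChains F V) :
    flagMap g (consTop U x) = consTop (U.map (g : V →ₗ[F] V)) (flagMap g x) := by
  induction x using Finsupp.induction_linear with
  | zero => simp
  | add f g hf hg => simp only [map_add, hf, hg]
  | single t c => simp [consTop_single, flagMap_single]

theorem flagMap_dropTop (g : V ≃ₗ[F] V) (x : FlagChains F V) :
    flagMap g (dropTop F V x) = dropTop F V (flagMap g x) := by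
  induction x using Finsupp.induction_linear with
  | zero => simp
  | add f g hf hg => simp only [map_add, hf, hg]
  | single t c =>
    cases t with
    | nil => simp [flagMap_single, dropTop_single_nil]
    | cons U t => rw [← consTop_single, flagMap_consTop, dropTop_consTop, dropTop_consTop]

theorem map_span_singleton' (g : V ≃ₗ[F] V) (v : V) :
    (F ∙ v).map (g : V →ₗ[F] V) = F ∙ g v := by
  rw [Submodule.map_span, Set.image_singleton]; rfl

theorem flagMap_join (g : V ≃ₗ[F] V) (v : V) (x : FlagChains F V) :
    flagMap g (join F v x) = join F (g v) (flagMap g x) := by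
  induction x using Finsupp.induction_linear with
  | zero => simp
  | add f g hf hg => simp only [map_add, hf, hg]
  | single t c =>
    have h : Finsupp.single t c = c • (Finsupp.single t 1 : FlagChains F V) := by simp
    rw [h]
    simp only [map_smul]
    congr 1
    induction t with
    | nil =>
      rw [flagMap_single, join_single, List.map_nil, join_single, joinFlag, joinFlag,
        flagMap_single, List.map_singleton, map_span_singleton']
    | cons U t ih =>
      have ih := ih (by simp)
      rw [← consTop_single, join_consTop, flagMap_consTop, map_sub, flagMap_consTop, ih,
        join_consTop, Submodule.map_sup, map_span_singleton']

theorem map_covBy_map (g : V ≃ₗ[F] V) {H U : Submodule F V} (h : H ⋖ U) :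
    H.map (g : V →ₗ[F] V) ⋖ U.map (g : V →ₗ[F] V) :=
  (apply_covBy_apply_iff (Submodule.orderIsoMapComap g)).2 h

theorem flagMap_mem (g : V ≃ₗ[F] V) (n : ℕ) : ∀ {U : Submodule F V} {x : FlagChains F V},
    x ∈ flagCycles n U → flagMap g x ∈ flagCycles n (U.map (g : V →ₗ[F] V)) := by
  induction n with
  | zero =>
    intro U x hx
    by_cases hU : U = ⊥
    · subst hU
      obtain ⟨c, rfl⟩ := mem_flagCycles_zero hx
      rw [flagMap_single, Submodule.map_bot]
      exact single_nil_mem_flagCycles c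
    · rw [flagCycles_zero_of_ne hU hx, map_zero]; exact Submodule.zero_mem _
  | succ n ih =>
    intro U x hx
    obtain ⟨h1, h2, h3⟩ := mem_flagCycles_succ.1 hx
    rw [mem_flagCycles_succ, ← flagMap_dropTop, ← flagMap_dropTop, h2, map_zero,
      ← flagMap_consTop, h3]
    refine ⟨?_, rfl, rfl⟩
    refine map_mem_of_mem_hyperplaneCycles _ _ ?_ h1
    · intro H hH y hy
      exact mem_hyperplaneCycles (map_covBy_map g hH) (ih hy)

theorem map_eq_of_fix (g : V ≃ₗ[F] V) {U : Submodule F V} (hg : ∀ u ∈ U, g u = u) :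
    U.map (g : V →ₗ[F] V) = U := by
  ext v
  constructor
  · rintro ⟨u, hu, rfl⟩
    rw [LinearEquiv.coe_coe, hg u hu]; exact hu
  · intro hv
    exact ⟨v, hv, hg v hv⟩

theorem flagMap_eq_of_fix (g : V ≃ₗ[F] V) (n : ℕ) : ∀ {U : Submodule F V} {x : FlagChains F V},
    (∀ u ∈ U, g u = u) → x ∈ flagCycles n U → flagMap g x = x := by
  induction n with
  | zero =>
    intro U x _ hx
    obtain ⟨c, rfl⟩ := mem_flagCycles_zero hx
    rw [flagMap_single, List.map_nil]
  | succ n ih =>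
    intro U x hg hx
    obtain ⟨h1, h2, h3⟩ := mem_flagCycles_succ.1 hx
    rw [← h3, flagMap_consTop, map_eq_of_fix g hg]
    congr 1
    refine hyperplaneCycles_induction (P := fun y => flagMap g y = y) h1 ?_ (map_zero _) ?_
    · intro H hH y hy
      exact ih (fun u hu => hg u (hH.le hu)) hy
    · intro y z hy hz
      rw [map_add, hy, hz]

end FlagAction

/-! ### Generic vectors of a subspace. -/

section Generic

open Filter

variable {F : Type*} [Field F] {V : Type*} [AddCommGroup V] [Module F V]

/-- The filter of generic vectors of `U`: it is generated by the complements in `U` of the proper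
subspaces. -/
def generic (U : Submodule F V) : Filter V :=
  𝓟 (U : Set V) ⊓ ⨅ S : {S : Submodule F V // ¬ U ≤ S}, 𝓟 ((S.1 : Set V)ᶜ)

theorem eventually_mem_generic (U : Submodule F V) : ∀ᶠ w in generic U, w ∈ U :=
  (inf_le_left : generic U ≤ _) (mem_principal_self (U : Set V))

theorem eventually_notMem_generic {U S : Submodule F V} (h : ¬ U ≤ S) :
    ∀ᶠ w in generic U, w ∉ S :=
  (inf_le_right.trans (iInf_le _ (⟨S, h⟩ : {S : Submodule F V // ¬ U ≤ S})) : generic U ≤ _)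
    (mem_principal_self ((S : Set V)ᶜ))

/-- A vector space over an infinite field is not a finite union of proper subspaces. The infinitude
of the field enters here. -/
theorem generic_neBot [Infinite F] (U : Submodule F V) : (generic U).NeBot := by
  rw [generic, inf_comm, (hasBasis_iInf_principal_finite _).inf_principal_neBot_iff]
  intro t ht
  classical
  let s : Finset (Submodule F U) := ht.toFinset.image fun S => S.1.comap U.subtype
  have hs : ⊤ ∉ s := by
    intro h
    obtain ⟨S, _, hS⟩ := Finset.mem_image.1 h
    exact S.2 (Submodule.comap_subtype_eq_top.1 hS)
  have h := Subspace.biUnion_ne_univ_of_top_notMem hs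
  obtain ⟨w, hw⟩ := (Set.ne_univ_iff_exists_notMem _).1 h
  refine ⟨w.1, ?_, w.2⟩
  simp only [Set.mem_iInter]
  intro S hS hwS
  refine hw (Set.mem_iUnion₂.2 ⟨S.1.comap U.subtype, ?_, hwS⟩)
  exact Finset.mem_image.2 ⟨S, ht.mem_toFinset.2 hS, rfl⟩

/-- Generic vectors have generic components. -/
theorem eventually_generic_sup {N L : Submodule F V} (h : Disjoint N L) {P : V → Prop}
    (hP : ∀ᶠ w in generic N, P w) :
    ∀ᶠ w in generic (N ⊔ L), ∀ n ∈ N, w - n ∈ L → P n := by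
  -- Extending L to a complement of N gives a projection onto N defined on all of V and killing L.
  -- Preimages of subspaces not containing N do not contain N + L, so the projection sends generic
  -- vectors to generic vectors.
  obtain ⟨M, hLM, hM⟩ := h.symm.exists_isCompl
  let π : V →ₗ[F] V := N.subtype.comp (N.projectionOnto M hM.symm)
  have hπN : ∀ n ∈ N, π n = n := fun n hn => by
    have := Submodule.projectionOnto_apply_left hM.symm ⟨n, hn⟩
    simp only at this
    simp [π, this]
  have hπL : ∀ l ∈ L, π l = 0 := fun l hl => by
    have := Submodule.projectionOnto_apply_right hM.symm ⟨l, hLM hl⟩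
    simp only at this
    simp [π, this]
  have ht : Tendsto π (generic (N ⊔ L)) (generic N) := by
    refine tendsto_inf.2 ⟨?_, tendsto_iInf.2 fun S => ?_⟩
    · exact tendsto_principal.2 (Eventually.of_forall fun w => Submodule.coe_mem _)
    · refine tendsto_principal.2 ?_
      have : ¬ N ⊔ L ≤ S.1.comap π := fun hle => S.2 fun n hn => by
        have := hle (Submodule.mem_sup_left hn)
        rwa [Submodule.mem_comap, hπN n hn] at this
      exact eventually_notMem_generic this
  filter_upwards [ht.eventually hP] with w hw n hn hl
  have : π w = n := by
    have h1 := hπL _ hl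
    rw [map_sub, hπN n hn] at h1
    exact sub_eq_zero.1 h1
  rwa [this] at hw

end Generic

/-! ### Transitivity of pointwise stabilizers of subspaces. -/

section Transitivity

variable {F : Type*} [Field F] {V : Type*} [AddCommGroup V] [Module F V]

theorem exists_linearEquiv_fix [FiniteDimensional F V] {H : Submodule F V} {w w' : V} (hw : w ∉ H) (hw' : w' ∉ H) :
    ∃ g : V ≃ₗ[F] V, (∀ h ∈ H, g h = h) ∧ g w = w' := by
  -- Take one functional detecting w and one detecting w', both zero on H. If neither detects both
  -- vectors, their sum does.
  obtain ⟨f, hfw, hfw', hfH⟩ : ∃ f : V →ₗ[F] F, f w ≠ 0 ∧ f w' ≠ 0 ∧ ∀ h ∈ H, f h = 0 := by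
    obtain ⟨f, hf, hf'⟩ := Submodule.exists_le_ker_of_notMem hw
    obtain ⟨g, hg, hg'⟩ := Submodule.exists_le_ker_of_notMem hw'
    by_cases h1 : f w' = 0
    · by_cases h2 : g w = 0
      · refine ⟨f + g, ?_, ?_, fun h hh => ?_⟩
        · simpa [h2] using hf
        · simpa [h1] using hg
        · rw [LinearMap.add_apply, hf' hh, hg' hh, add_zero]
      · exact ⟨g, h2, hg, fun h hh => hg' hh⟩
    · exact ⟨f, hf, h1, fun h hh => hf' hh⟩
  -- This moves w to w' and fixes the kernel of f. It is injective because f (g v) is f v times the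
  -- non-zero scalar f w' / f w.
  let g : V →ₗ[F] V := LinearMap.id + ((f w)⁻¹ • f).smulRight (w' - w)
  have hg : ∀ v, g v = v + ((f w)⁻¹ * f v) • (w' - w) := fun v => by simp [g]
  have hinj : Function.Injective g := by
    rw [injective_iff_map_eq_zero]
    intro v hv
    rw [hg] at hv
    have h1 := congrArg f hv
    rw [map_add, map_smul, map_sub, map_zero, smul_eq_mul] at h1
    have h2 : (f w)⁻¹ * f v * f w' = 0 := by
      rw [← h1]; field_simp; ring
    have h3 : (f w)⁻¹ * f v = 0 := (mul_eq_zero.1 h2).resolve_right hfw'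
    rwa [h3, zero_smul, add_zero] at hv
  refine ⟨LinearEquiv.ofInjectiveEndo g hinj, fun h hh => ?_, ?_⟩
  · rw [LinearEquiv.coe_ofInjectiveEndo, hg, hfH h hh, mul_zero, zero_smul, add_zero]
  · rw [LinearEquiv.coe_ofInjectiveEndo, hg, inv_mul_cancel₀ hfw, one_smul, add_sub_cancel]

theorem exists_linearEquiv_fix₂ [FiniteDimensional F V] {N : Submodule F V} {p q p' q' : V}
    (hp : p ∉ N) (hq : q ∉ N ⊔ F ∙ p) (hp' : p' ∉ N) (hq' : q' ∉ N ⊔ F ∙ p') :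
    ∃ g : V ≃ₗ[F] V, (∀ h ∈ N, g h = h) ∧ g p = p' ∧ g q = q' := by
  obtain ⟨g, hg, hgp⟩ := exists_linearEquiv_fix hp hp'
  have h1 : g q ∉ N ⊔ F ∙ p' := by
    rw [← hgp, ← map_span_singleton', ← map_eq_of_fix g hg, ← Submodule.map_sup]
    intro h
    obtain ⟨v, hv, hvq⟩ := h
    exact hq (g.injective hvq ▸ hv)
  obtain ⟨k, hk, hkq⟩ := exists_linearEquiv_fix h1 hq'
  refine ⟨g.trans k, fun h hh => ?_, ?_, ?_⟩
  · rw [LinearEquiv.trans_apply, hg h hh, hk h (Submodule.mem_sup_left hh)]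
  · rw [LinearEquiv.trans_apply, hgp,
      hk _ (Submodule.mem_sup_right (Submodule.mem_span_singleton_self p'))]
  · rw [LinearEquiv.trans_apply, hkq]

end Transitivity

/-! ### Equivariant systems of forms and the systems induced in codimension one and two. -/

section Systems

open Filter

variable {F : Type*} [Field F] {V : Type*} [AddCommGroup V] [Module F V] {A : Type*}
  [AddCommGroup A]

/-- A family of biadditive forms `β U w` on the cycles of the `n`-dimensional subspaces `U`,
depending on a vector `w` of `U`, which is equivariant under linear automorphisms. -/
structure IsSystem (n : ℕ) (β : Submodule F V → V → FlagChains F V → FlagChains F V → A) :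
    Prop where
  add_left : ∀ (U : Submodule F V) w x x' y, Module.finrank F U = n → w ∈ U → x ∈ flagCycles n U → x' ∈ flagCycles n U →
    y ∈ flagCycles n U → β U w (x + x') y = β U w x y + β U w x' y
  add_right : ∀ (U : Submodule F V) w x y y', Module.finrank F U = n → w ∈ U → x ∈ flagCycles n U → y ∈ flagCycles n U →
    y' ∈ flagCycles n U → β U w x (y + y') = β U w x y + β U w x y'
  map : ∀ (g : V ≃ₗ[F] V) (U : Submodule F V) w x y, Module.finrank F U = n → w ∈ U → x ∈ flagCycles n U →
    y ∈ flagCycles n U →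
    β (U.map (g : V →ₗ[F] V)) (g w) (flagMap g x) (flagMap g y) = β U w x y

namespace IsSystem

variable {n : ℕ} {β : Submodule F V → V → FlagChains F V → FlagChains F V → A}

theorem zsmul_left (hβ : IsSystem n β) {U : Submodule F V} (hU : Module.finrank F U = n) {w : V}
    (hw : w ∈ U)
    {x y : FlagChains F V} (hx : x ∈ flagCycles n U) (hy : y ∈ flagCycles n U) (c : ℤ) :
    β U w (c • x) y = c • β U w x y :=
  map_zsmul (AddMonoidHom.mk' (fun x : flagCycles n U => β U w x.1 y)
    fun a b => hβ.add_left U w a.1 b.1 y hU hw a.2 b.2 hy) c ⟨x, hx⟩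

theorem zsmul_right (hβ : IsSystem n β) {U : Submodule F V} (hU : Module.finrank F U = n) {w : V}
    (hw : w ∈ U)
    {x y : FlagChains F V} (hx : x ∈ flagCycles n U) (hy : y ∈ flagCycles n U) (c : ℤ) :
    β U w x (c • y) = c • β U w x y :=
  map_zsmul (AddMonoidHom.mk' (fun y : flagCycles n U => β U w x y.1)
    fun a b => hβ.add_right U w x a.1 b.1 hU hw hx a.2 b.2) c ⟨y, hy⟩

theorem zero_left (hβ : IsSystem n β) {U : Submodule F V} (hU : Module.finrank F U = n) {w : V}
    (hw : w ∈ U)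
    {y : FlagChains F V} (hy : y ∈ flagCycles n U) : β U w 0 y = 0 := by
  have := hβ.zsmul_left hU hw (Submodule.zero_mem _) hy 0
  rwa [zero_smul, zero_smul] at this

theorem zero_right (hβ : IsSystem n β) {U : Submodule F V} (hU : Module.finrank F U = n) {w : V}
    (hw : w ∈ U)
    {x : FlagChains F V} (hx : x ∈ flagCycles n U) : β U w x 0 = 0 := by
  have := hβ.zsmul_right hU hw hx (Submodule.zero_mem _) 0
  rwa [zero_smul, zero_smul] at this

theorem map_of_fix (hβ : IsSystem n β) {g : V ≃ₗ[F] V} {U U' : Submodule F V} {w w' : V}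
    {x y x' y' : FlagChains F V} (hU : Module.finrank F U = n) (hw : w ∈ U)
    (hx : x ∈ flagCycles n U) (hy : y ∈ flagCycles n U) (hU' : U.map (g : V →ₗ[F] V) = U')
    (hw' : g w = w') (hx' : flagMap g x = x') (hy' : flagMap g y = y') :
    β U' w' x' y' = β U w x y := by
  rw [← hU', ← hw', ← hx', ← hy']
  exact hβ.map g U w x y hU hw hx hy

end IsSystem

theorem finrank_sup_span_singleton [FiniteDimensional F V] {H : Submodule F V} {w : V}
    (hw : w ∉ H) : Module.finrank F (H ⊔ F ∙ w : Submodule F V) = Module.finrank F H + 1 := by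
  have h := Submodule.finrank_sup_add_finrank_inf_eq H (F ∙ w)
  have h0 : H ⊓ F ∙ w = ⊥ := by
    rw [eq_bot_iff]
    rintro v ⟨hvN, hv⟩
    obtain ⟨c, rfl⟩ := Submodule.mem_span_singleton.1 hv
    by_cases hc : c = 0
    · simp [hc]
    · exact absurd ((Submodule.smul_mem_iff _ hc).1 hvN) hw
  have hw0 : w ≠ 0 := by rintro rfl; exact hw (Submodule.zero_mem _)
  rw [h0, finrank_bot, finrank_span_singleton hw0] at h
  omega

theorem finrank_of_covBy [FiniteDimensional F V] {H U : Submodule F V} (h : H ⋖ U) :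
    Module.finrank F U = Module.finrank F H + 1 := by
  obtain ⟨w, hwU, hwH⟩ := Set.exists_of_ssubset h.lt
  rw [← sup_span_singleton_eq h hwU hwH, finrank_sup_span_singleton hwH]

theorem map_sup_span_singleton (g : V ≃ₗ[F] V) (H : Submodule F V) (w : V) :
    (H ⊔ F ∙ w).map (g : V →ₗ[F] V) = H.map (g : V →ₗ[F] V) ⊔ F ∙ g w := by
  rw [Submodule.map_sup, map_span_singleton']

theorem apply_notMem_map (g : V ≃ₗ[F] V) {H : Submodule F V} {w : V} (hw : w ∉ H) :
    g w ∉ H.map (g : V →ₗ[F] V) := by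
  rintro ⟨v, hv, hvw⟩
  exact hw (g.injective hvw ▸ hv)

theorem finrank_map (g : V ≃ₗ[F] V) (H : Submodule F V) :
    Module.finrank F (H.map (g : V →ₗ[F] V)) = Module.finrank F H :=
  LinearEquiv.finrank_map_eq g H

/-- The forms on hyperplanes obtained from a system by joining with a line. -/
def hyperplaneForm (β : Submodule F V → V → FlagChains F V → FlagChains F V → A)
    (H : Submodule F V) (_ : V) (a b : FlagChains F V) : A :=
  let w : V := Classical.epsilon fun w => w ∉ H
  β (H ⊔ F ∙ w) w (join F w a) (join F w b)

/-- The chosen vector is irrelevant: an automorphism fixing H pointwise, hence fixing its cycles,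
carries w to it. For the same reason the form does not depend on the vector argument v. -/
theorem hyperplaneForm_eq [FiniteDimensional F V] {m : ℕ}
    {β : Submodule F V → V → FlagChains F V → FlagChains F V → A} (hβ : IsSystem (m + 1) β)
    {H : Submodule F V} (hH : Module.finrank F H = m) {w : V} (hw : w ∉ H) (v : V)
    {a b : FlagChains F V} (ha : a ∈ flagCycles m H) (hb : b ∈ flagCycles m H) :
    hyperplaneForm β H v a b = β (H ⊔ F ∙ w) w (join F w a) (join F w b) := by
  have hw' : Classical.epsilon (fun w => w ∉ H) ∉ H := Classical.epsilon_spec (p := fun w => w ∉ H) ⟨w, hw⟩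
  obtain ⟨g, hg, hgw⟩ := exists_linearEquiv_fix hw hw'
  refine hβ.map_of_fix (g := g) (by rw [finrank_sup_span_singleton hw, hH])
    (Submodule.mem_sup_right (Submodule.mem_span_singleton_self w)) (join_mem m ha hw)
    (join_mem m hb hw) ?_ hgw ?_ ?_
  · rw [map_sup_span_singleton, hgw, map_eq_of_fix g hg]
  · rw [flagMap_join, hgw, flagMap_eq_of_fix g m hg ha]
  · rw [flagMap_join, hgw, flagMap_eq_of_fix g m hg hb]

theorem exists_notMem_of_finrank_lt [FiniteDimensional F V] {H : Submodule F V}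
    (h : Module.finrank F H < Module.finrank F V) : ∃ w, w ∉ H := by
  by_contra! hc
  rw [(Submodule.eq_top_iff'.2 hc : H = ⊤), finrank_top] at h
  exact h.ne rfl

theorem isSystem_hyperplaneForm [FiniteDimensional F V] {m : ℕ} (hm : m < Module.finrank F V)
    {β : Submodule F V → V → FlagChains F V → FlagChains F V → A} (hβ : IsSystem (m + 1) β) :
    IsSystem m (hyperplaneForm β) where
  add_left H v x x' y hH _ hx hx' hy := by
    obtain ⟨w, hw⟩ := exists_notMem_of_finrank_lt (hH.trans_lt hm)
    rw [hyperplaneForm_eq hβ hH hw v (Submodule.add_mem _ hx hx') hy,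
      hyperplaneForm_eq hβ hH hw v hx hy, hyperplaneForm_eq hβ hH hw v hx' hy, map_add]
    exact hβ.add_left _ _ _ _ _ (by rw [finrank_sup_span_singleton hw, hH])
      (Submodule.mem_sup_right (Submodule.mem_span_singleton_self w)) (join_mem m hx hw)
      (join_mem m hx' hw) (join_mem m hy hw)
  add_right H v x y y' hH _ hx hy hy' := by
    obtain ⟨w, hw⟩ := exists_notMem_of_finrank_lt (hH.trans_lt hm)
    rw [hyperplaneForm_eq hβ hH hw v hx (Submodule.add_mem _ hy hy'),
      hyperplaneForm_eq hβ hH hw v hx hy, hyperplaneForm_eq hβ hH hw v hx hy', map_add]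
    exact hβ.add_right _ _ _ _ _ (by rw [finrank_sup_span_singleton hw, hH])
      (Submodule.mem_sup_right (Submodule.mem_span_singleton_self w)) (join_mem m hx hw)
      (join_mem m hy hw) (join_mem m hy' hw)
  map g H v x y hH _ hx hy := by
    obtain ⟨w, hw⟩ := exists_notMem_of_finrank_lt (hH.trans_lt hm)
    rw [hyperplaneForm_eq hβ hH hw v hx hy, hyperplaneForm_eq hβ ((finrank_map g H).trans hH)
      (apply_notMem_map g hw) (g v) (flagMap_mem g m hx) (flagMap_mem g m hy)]
    exact hβ.map_of_fix (g := g) (by rw [finrank_sup_span_singleton hw, hH])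
      (Submodule.mem_sup_right (Submodule.mem_span_singleton_self w)) (join_mem m hx hw)
      (join_mem m hy hw) (map_sup_span_singleton g H w) rfl (flagMap_join g w x)
      (flagMap_join g w y)

/-- The forms on subspaces of codimension two obtained from a system by joining with lines in
general position. -/
def codimTwoForm (β : Submodule F V → V → FlagChains F V → FlagChains F V → A)
    (N : Submodule F V) (v : V) (a b : FlagChains F V) : A :=
  let r : V × V := Classical.epsilon fun r => r.1 ∉ N ∧ r.2 ∉ N ⊔ F ∙ r.1
  β (N ⊔ F ∙ r.1 ⊔ F ∙ r.2) (v + r.1 + r.2) (join F (v + r.1 + r.2) (join F r.1 a))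
    (join F (v + r.1 + r.2) (join F r.2 b))

section CodimTwo

variable {N : Submodule F V} {p q v : V}

theorem notMem_of_notMem_sup (hq : q ∉ N ⊔ F ∙ p) : q ∉ N :=
  fun h => hq (Submodule.mem_sup_left h)

theorem notMem_sup_comm (hp : p ∉ N) (hq : q ∉ N ⊔ F ∙ p) : p ∉ N ⊔ F ∙ q := by
  intro h
  obtain ⟨n, hn, y, hy, e⟩ := Submodule.mem_sup.1 h
  obtain ⟨s, rfl⟩ := Submodule.mem_span_singleton.1 hy
  have hs : s ≠ 0 := by
    rintro rfl
    rw [zero_smul, add_zero] at e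
    exact hp (e ▸ hn)
  apply hq
  have : q = -(s⁻¹ • n) + s⁻¹ • p := by
    rw [← e, smul_add, smul_smul, inv_mul_cancel₀ hs, one_smul]; abel
  rw [this]
  exact Submodule.add_mem_sup (N.neg_mem (N.smul_mem _ hn))
    (Submodule.smul_mem _ _ (Submodule.mem_span_singleton_self p))

theorem add_add_notMem_left (hq : q ∉ N ⊔ F ∙ p) (hv : v ∈ N) :
    v + p + q ∉ N ⊔ F ∙ p := fun h =>
  hq ((Submodule.add_mem_iff_right _ (Submodule.add_mem_sup hv
    (Submodule.mem_span_singleton_self p))).1 h)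

theorem sup_sup_add_add_left (hv : v ∈ N) :
    N ⊔ F ∙ p ⊔ F ∙ (v + p + q) = N ⊔ F ∙ p ⊔ F ∙ q := by
  have h1 : v + p ∈ N ⊔ F ∙ p := Submodule.add_mem_sup hv (Submodule.mem_span_singleton_self p)
  apply le_antisymm
  · refine sup_le le_sup_left ((Submodule.span_singleton_le_iff_mem _ _).2 ?_)
    exact Submodule.add_mem_sup h1 (Submodule.mem_span_singleton_self q)
  · refine sup_le le_sup_left ((Submodule.span_singleton_le_iff_mem _ _).2 ?_)
    have h2 := Submodule.add_mem_sup (Submodule.neg_mem _ h1)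
      (Submodule.mem_span_singleton_self (R := F) (v + p + q))
    rwa [neg_add_cancel_left] at h2

theorem join_join_mem_left {k : ℕ} (hp : p ∉ N) (hq : q ∉ N ⊔ F ∙ p) (hv : v ∈ N)
    {a : FlagChains F V} (ha : a ∈ flagCycles k N) :
    join F (v + p + q) (join F p a) ∈ flagCycles (k + 1 + 1) (N ⊔ F ∙ p ⊔ F ∙ q) := by
  rw [← sup_sup_add_add_left hv]
  exact join_mem (k + 1) (join_mem k ha hp) (add_add_notMem_left hq hv)

theorem join_join_mem_right {k : ℕ} (hp : p ∉ N) (hq : q ∉ N ⊔ F ∙ p) (hv : v ∈ N)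
    {b : FlagChains F V} (hb : b ∈ flagCycles k N) :
    join F (v + p + q) (join F q b) ∈ flagCycles (k + 1 + 1) (N ⊔ F ∙ p ⊔ F ∙ q) := by
  rw [add_right_comm v p q, sup_right_comm]
  exact join_join_mem_left (notMem_of_notMem_sup hq) (notMem_sup_comm hp hq) hv hb

theorem add_add_mem (hv : v ∈ N) : v + p + q ∈ N ⊔ F ∙ p ⊔ F ∙ q :=
  Submodule.add_mem_sup (Submodule.add_mem_sup hv (Submodule.mem_span_singleton_self p))
    (Submodule.mem_span_singleton_self q)

/-- Any p and q independent modulo N may be used, since an automorphism fixing N pointwise carries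
one such pair to another. The component v ∈ N of v + p + q cannot be moved in this way; therefore
systems have to depend on a vector. -/
theorem codimTwoForm_eq [FiniteDimensional F V] {k : ℕ}
    {β : Submodule F V → V → FlagChains F V → FlagChains F V → A} (hβ : IsSystem (k + 1 + 1) β)
    (hN : Module.finrank F N = k) (hp : p ∉ N) (hq : q ∉ N ⊔ F ∙ p) (hv : v ∈ N)
    {a b : FlagChains F V} (ha : a ∈ flagCycles k N) (hb : b ∈ flagCycles k N) :
    codimTwoForm β N v a b = β (N ⊔ F ∙ p ⊔ F ∙ q) (v + p + q)
      (join F (v + p + q) (join F p a)) (join F (v + p + q) (join F q b)) := by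
  rw [codimTwoForm]
  have hr := Classical.epsilon_spec (p := fun r : V × V => r.1 ∉ N ∧ r.2 ∉ N ⊔ F ∙ r.1)
    ⟨(p, q), hp, hq⟩
  generalize (Classical.epsilon fun r : V × V => r.1 ∉ N ∧ r.2 ∉ N ⊔ F ∙ r.1) = r at hr ⊢
  obtain ⟨hp', hq'⟩ := hr
  obtain ⟨g, hg, hgp, hgq⟩ := exists_linearEquiv_fix₂ hp hq hp' hq'
  have hgv : g (v + p + q) = v + r.1 + r.2 := by rw [map_add, map_add, hgp, hgq, hg v hv]
  refine hβ.map_of_fix (g := g)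
    (by rw [finrank_sup_span_singleton hq, finrank_sup_span_singleton hp, hN])
    (add_add_mem hv) (join_join_mem_left hp hq hv ha) (join_join_mem_right hp hq hv hb) ?_ hgv ?_ ?_
  · rw [map_sup_span_singleton, map_sup_span_singleton, hgp, hgq, map_eq_of_fix g hg]
  · rw [flagMap_join, flagMap_join, hgv, hgp, flagMap_eq_of_fix g k hg ha]
  · rw [flagMap_join, flagMap_join, hgv, hgq, flagMap_eq_of_fix g k hg hb]

end CodimTwo

theorem exists_notMem₂_of_finrank_lt [FiniteDimensional F V] {N : Submodule F V}
    (h : Module.finrank F N + 1 < Module.finrank F V) : ∃ p q, p ∉ N ∧ q ∉ N ⊔ F ∙ p := by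
  obtain ⟨p, hp⟩ := exists_notMem_of_finrank_lt (H := N) (by omega)
  obtain ⟨q, hq⟩ := exists_notMem_of_finrank_lt (H := N ⊔ F ∙ p)
    (by rw [finrank_sup_span_singleton hp]; omega)
  exact ⟨p, q, hp, hq⟩

theorem isSystem_codimTwoForm [FiniteDimensional F V] {k : ℕ}
    (hk : k + 1 < Module.finrank F V)
    {β : Submodule F V → V → FlagChains F V → FlagChains F V → A}
    (hβ : IsSystem (k + 1 + 1) β) : IsSystem k (codimTwoForm β) where
  add_left N v x x' y hN hv hx hx' hy := by
    obtain ⟨p, q, hp, hq⟩ := exists_notMem₂_of_finrank_lt (N := N) (by rwa [hN])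
    rw [codimTwoForm_eq hβ hN hp hq hv (Submodule.add_mem _ hx hx') hy,
      codimTwoForm_eq hβ hN hp hq hv hx hy, codimTwoForm_eq hβ hN hp hq hv hx' hy, map_add,
      map_add]
    exact hβ.add_left _ _ _ _ _
      (by rw [finrank_sup_span_singleton hq, finrank_sup_span_singleton hp, hN])
      (add_add_mem hv) (join_join_mem_left hp hq hv hx) (join_join_mem_left hp hq hv hx')
      (join_join_mem_right hp hq hv hy)
  add_right N v x y y' hN hv hx hy hy' := by
    obtain ⟨p, q, hp, hq⟩ := exists_notMem₂_of_finrank_lt (N := N) (by rwa [hN])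
    rw [codimTwoForm_eq hβ hN hp hq hv hx (Submodule.add_mem _ hy hy'),
      codimTwoForm_eq hβ hN hp hq hv hx hy, codimTwoForm_eq hβ hN hp hq hv hx hy', map_add,
      map_add]
    exact hβ.add_right _ _ _ _ _
      (by rw [finrank_sup_span_singleton hq, finrank_sup_span_singleton hp, hN])
      (add_add_mem hv) (join_join_mem_left hp hq hv hx) (join_join_mem_right hp hq hv hy)
      (join_join_mem_right hp hq hv hy')
  map g N v x y hN hv hx hy := by
    obtain ⟨p, q, hp, hq⟩ := exists_notMem₂_of_finrank_lt (N := N) (by rwa [hN])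
    have hgv : g v ∈ N.map (g : V →ₗ[F] V) := Submodule.mem_map_of_mem hv
    have hgq : g q ∉ N.map (g : V →ₗ[F] V) ⊔ F ∙ g p := by
      rw [← map_sup_span_singleton]; exact apply_notMem_map g hq
    have e : g (v + p + q) = g v + g p + g q := by rw [map_add, map_add]
    rw [codimTwoForm_eq hβ hN hp hq hv hx hy, codimTwoForm_eq hβ ((finrank_map g N).trans hN)
      (apply_notMem_map g hp) hgq hgv (flagMap_mem g k hx) (flagMap_mem g k hy)]
    refine hβ.map_of_fix (g := g)
      (by rw [finrank_sup_span_singleton hq, finrank_sup_span_singleton hp, hN])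
      (add_add_mem hv) (join_join_mem_left hp hq hv hx) (join_join_mem_right hp hq hv hy) ?_ e ?_ ?_
    · rw [map_sup_span_singleton, map_sup_span_singleton]
    · rw [flagMap_join, flagMap_join, e]
    · rw [flagMap_join, flagMap_join, e]

end Systems

/-! ### Systems of forms are generically multiples of the standard form. -/

section GenericFormula

open Filter

variable {F : Type*} [Field F] {V : Type*} [AddCommGroup V] [Module F V] {A : Type*}
  [AddCommGroup A]

theorem join_mem_of_mem_hyperplaneCycles {m : ℕ} {U : Submodule F V} {x : FlagChains F V} {w : V}
    (hx : x ∈ hyperplaneCycles m U) (hw : w ∈ U) (hw0 : w ≠ 0) :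
    join F w x ∈ flagCycles (m + 1) U := by
  refine map_mem_of_mem_hyperplaneCycles _ _ (fun H hH h hh => ?_) hx
  by_cases hwH : w ∈ H
  · rw [join_eq_zero hh hwH hw0]; exact Submodule.zero_mem _
  · rw [← sup_span_singleton_eq hH hw hwH]; exact join_mem m hh hwH

/-- The top faces are a and b with corrections whose flags have tops K + l and K' + l', for
hyperplanes K and K' of N. These tops differ from N and from each other, so only ⟨a, b⟩ remains. -/
theorem flagPairing_dropTop_join {n : ℕ} {N : Submodule F V} {l l' : V}
    {a b : FlagChains F V} (ha : a ∈ flagCycles n N) (hb : b ∈ flagCycles n N) (hl : l ∉ N)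
    (hl' : l' ∉ N) (hlH : l ∉ N ⊔ F ∙ l') :
    flagPairing F V (dropTop F V (join F l a)) (dropTop F V (join F l' b)) =
      flagPairing F V a b := by
  have ha' := flagCycles_le_supported n N ha
  have hb' := flagCycles_le_supported n N hb
  have hla := join_dropTop_mem_supported ha hl
  have hlb := join_dropTop_mem_supported hb hl'
  have h1 : flagPairing F V a (join F l' (dropTop F V b)) = 0 := by
    refine flagPairing_eq_zero (Set.disjoint_left.2 ?_) ha' hlb
    rintro t e ⟨K, _, e'⟩
    exact hl' (e.symm.trans e' ▸ Submodule.mem_sup_right (Submodule.mem_span_singleton_self l'))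
  have h2 : flagPairing F V (join F l (dropTop F V a)) b = 0 := by
    refine flagPairing_eq_zero (Set.disjoint_left.2 ?_) hla hb'
    rintro t ⟨K, _, e'⟩ e
    exact hl (e.symm.trans e' ▸ Submodule.mem_sup_right (Submodule.mem_span_singleton_self l))
  have h3 : flagPairing F V (join F l (dropTop F V a)) (join F l' (dropTop F V b)) = 0 := by
    refine flagPairing_eq_zero (Set.disjoint_left.2 ?_) hla hlb
    rintro t ⟨K, _, e⟩ ⟨K', hK', e'⟩
    refine hlH (sup_le_sup_right hK'.le _ (e'.symm.trans e ▸ ?_))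
    exact Submodule.mem_sup_right (Submodule.mem_span_singleton_self l)
  rw [dropTop_join, dropTop_join]
  simp only [map_sub, LinearMap.sub_apply, h1, h2, h3, sub_zero]

/-- The contribution of two distinct hyperplanes, for joins with lines. -/
theorem eventually_form_join_join [FiniteDimensional F V] {k : ℕ}
    {β : Submodule F V → V → FlagChains F V → FlagChains F V → A}
    (hβ : IsSystem (k + 1 + 1) β) {c : A} {N : Submodule F V} (hN : Module.finrank F N = k)
    {l l' : V} (hl : l ∉ N) (hl' : l' ∉ N ⊔ F ∙ l) {a b : FlagChains F V}
    (ha : a ∈ flagCycles k N) (hb : b ∈ flagCycles k N)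
    (hc : ∀ᶠ v in generic N, codimTwoForm β N v a b = flagPairing F V a b • c) :
    ∀ᶠ w in generic (N ⊔ F ∙ l ⊔ F ∙ l'),
      β (N ⊔ F ∙ l ⊔ F ∙ l') w (join F w (join F l a)) (join F w (join F l' b)) =
        flagPairing F V a b • c := by
  have hll' := notMem_sup_comm hl hl'
  have hnle : ∀ r s : V, r ∉ N ⊔ F ∙ s → ¬ N ⊔ F ∙ s ⊔ F ∙ r ≤ N ⊔ F ∙ s := fun r s h hle =>
    h (hle (Submodule.mem_sup_right (Submodule.mem_span_singleton_self r)))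
  have hdisj : Disjoint N (F ∙ l ⊔ F ∙ l') := by
    rw [disjoint_iff, eq_bot_iff]
    rintro v ⟨hvN, hv⟩
    obtain ⟨y, hy, z, hz, e⟩ := Submodule.mem_sup.1 hv
    obtain ⟨s, rfl⟩ := Submodule.mem_span_singleton.1 hy
    obtain ⟨t, rfl⟩ := Submodule.mem_span_singleton.1 hz
    have ht : t = 0 := by
      by_contra ht
      refine hl' ((Submodule.smul_mem_iff _ ht).1 ?_)
      rw [eq_sub_of_add_eq' e]
      exact Submodule.sub_mem _ (Submodule.mem_sup_left hvN) (Submodule.mem_sup_right hy)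
    subst ht
    rw [zero_smul, add_zero] at e
    have hs : s = 0 := by
      by_contra hs
      exact hl ((Submodule.smul_mem_iff _ hs).1 (e ▸ hvN))
    rw [← e, hs, zero_smul]; exact Submodule.zero_mem _
  -- The N-component of a generic vector of N + l + l' is generic in N, so the formula known for N
  -- applies to it.
  have h1 := eventually_generic_sup hdisj hc
  rw [← sup_assoc] at h1
  have h2 := eventually_notMem_generic (hnle l' l hl')
  have h3 := eventually_notMem_generic (hnle l l' hll')
  rw [sup_right_comm] at h3
  filter_upwards [h1, h2, h3, eventually_mem_generic _] with w h1 h2 h3 hw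
  obtain ⟨y, hy, z, hz, rfl⟩ := Submodule.mem_sup.1 hw
  obtain ⟨n, hn, x, hx, rfl⟩ := Submodule.mem_sup.1 hy
  obtain ⟨s, rfl⟩ := Submodule.mem_span_singleton.1 hx
  obtain ⟨t, rfl⟩ := Submodule.mem_span_singleton.1 hz
  have hs : s ≠ 0 := by
    rintro rfl
    rw [zero_smul, add_zero] at h3
    exact h3 (Submodule.add_mem_sup hn hz)
  have ht : t ≠ 0 := by
    rintro rfl
    rw [zero_smul, add_zero] at h2
    exact h2 hy
  -- With p = s l and q = t l' the vector becomes n + p + q, while lines and joins are unchanged as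
  -- s and t are non-zero. So the value is that of the form in codimension two.
  have e1 : F ∙ (s • l) = F ∙ l := Submodule.span_singleton_smul_eq (IsUnit.mk0 s hs) l
  have e2 : F ∙ (t • l') = F ∙ l' := Submodule.span_singleton_smul_eq (IsUnit.mk0 t ht) l'
  have h4 := codimTwoForm_eq (p := s • l) (q := t • l') hβ hN
    (fun h => hl ((Submodule.smul_mem_iff _ hs).1 h))
    (fun h => hl' ((Submodule.smul_mem_iff _ ht).1 (by rwa [e1] at h))) hn ha hb
  rw [e1, e2, join_smul hs, join_smul ht] at h4
  rw [← h4]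
  refine h1 n hn ?_
  rw [add_assoc, add_sub_cancel_left]
  exact Submodule.add_mem_sup hx hz

/-- A system of forms is generically a multiple of the standard form. -/
theorem IsSystem.exists_generic_formula [FiniteDimensional F V] [Infinite F] (n : ℕ) :
    ∀ {β : Submodule F V → V → FlagChains F V → FlagChains F V → A}, IsSystem n β →
    n ≤ Module.finrank F V →
    ∃ c : A, ∀ U : Submodule F V, Module.finrank F U = n → ∀ x ∈ flagCycles n U, ∀ y ∈ flagCycles n U,
      ∀ᶠ w in generic U, β U w x y = flagPairing F V x y • c := by
  induction n using Nat.strong_induction_on with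
  | _ n ih =>
  intro β hβ hn
  rcases n with _ | m
  -- In dimension zero the cycles are the multiples of the empty flag.
  · refine ⟨β ⊥ 0 (Finsupp.single [] 1) (Finsupp.single [] 1), fun U hU x hx y hy => ?_⟩
    have hU' : U = ⊥ := Submodule.finrank_eq_zero.1 hU
    subst hU'
    filter_upwards [eventually_mem_generic _] with w hw
    obtain rfl := (Submodule.mem_bot F).1 hw
    obtain ⟨a, rfl⟩ := mem_flagCycles_zero hx
    obtain ⟨b, rfl⟩ := mem_flagCycles_zero hy
    have e : ∀ c : ℤ, Finsupp.single [] c = c • (Finsupp.single [] 1 : FlagChains F V) := by simp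
    have h0 := single_nil_mem_flagCycles (F := F) (V := V) 1
    rw [e a, e b, hβ.zsmul_left hU hw h0 (Submodule.smul_mem _ _ h0), hβ.zsmul_right hU hw h0 h0,
      map_smul, map_smul, LinearMap.smul_apply, flagPairing_single]
    simp [smul_smul, mul_comm]
  -- the contribution of equal hyperplanes
  obtain ⟨c₁, hc₁⟩ : ∃ c₁ : A, ∀ U : Submodule F V, Module.finrank F U = m + 1 → ∀ H, H ⋖ U →
      ∀ x ∈ flagCycles m H, ∀ y ∈ flagCycles m H, ∀ᶠ w in generic U,
        β U w (join F w x) (join F w y) = flagPairing F V x y • c₁ := by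
    obtain ⟨c₁, hc₁⟩ := ih m (by omega) (isSystem_hyperplaneForm (by omega) hβ) (by omega)
    refine ⟨c₁, fun U hU H hH x hx y hy => ?_⟩
    have hH' : Module.finrank F H = m := by
      have := finrank_of_covBy hH
      omega
    have := generic_neBot H
    -- One generic v in H is enough, since the form on hyperplanes ignores its vector.
    obtain ⟨v, hv⟩ := (hc₁ H hH' x hx y hy).exists
    filter_upwards [eventually_mem_generic U, eventually_notMem_generic hH.lt.not_ge]
      with w hw hwH
    rw [hyperplaneForm_eq hβ hH' hwH v hx hy, sup_span_singleton_eq hH hw hwH] at hv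
    exact hv
  -- the contribution of distinct hyperplanes
  obtain ⟨c₂, hc₂⟩ : ∃ c₂ : A, ∀ U : Submodule F V, Module.finrank F U = m + 1 → ∀ H, H ⋖ U → ∀ H', H' ⋖ U →
      ∀ x ∈ flagCycles m H, ∀ y ∈ flagCycles m H', ∀ᶠ w in generic U,
        β U w (join F w x) (join F w y) = flagPairing F V x y • (c₁ - c₂) +
          flagPairing F V (dropTop F V x) (dropTop F V y) • c₂ := by
    rcases m with _ | k
    -- A line has only one hyperplane, so distinct hyperplanes contribute nothing.
    · refine ⟨0, fun U hU H hH H' hH' x hx y hy => ?_⟩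
      have e1 := finrank_of_covBy hH
      have e2 := finrank_of_covBy hH'
      have e : H' = H := by
        rw [Submodule.finrank_eq_zero.1 (by omega : Module.finrank F H = 0),
          Submodule.finrank_eq_zero.1 (by omega : Module.finrank F H' = 0)]
      subst e
      simpa using hc₁ U hU H' hH x hx y hy
    · obtain ⟨c₂, hc₂⟩ := ih k (by omega) (isSystem_codimTwoForm (by omega) hβ) (by omega)
      refine ⟨c₂, fun U hU H hH H' hH' x hx y hy => ?_⟩
      by_cases hne : H = H'
      · subst hne
        -- For equal hyperplanes both flags carry the same top, which can be removed. The two terms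
        -- then add up to a multiple of c₁.
        have e : flagPairing F V (dropTop F V x) (dropTop F V y) = flagPairing F V x y := by
          conv_rhs => rw [← (mem_flagCycles_succ.1 hx).2.2, ← (mem_flagCycles_succ.1 hy).2.2,
            flagPairing_consTop]
        filter_upwards [hc₁ U hU H hH x hx y hy] with w hw
        rw [hw, e, ← smul_add, sub_add_cancel]
      · have hU0 : U ≠ ⊥ := by
          rintro rfl
          rw [finrank_bot] at hU
          omega
        have hgw : ∀ᶠ w in generic U, w ∈ U ∧ w ≠ 0 := by
          filter_upwards [eventually_mem_generic U,
            eventually_notMem_generic (S := (⊥ : Submodule F V)) fun h => hU0 (le_bot_iff.1 h)]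
            with w hw hw0
          exact ⟨hw, fun h => hw0 ((Submodule.mem_bot F).2 h)⟩
        have hNH' : H ⊓ H' ⋖ H' := inf_covBy_of_covBy hH' hH (Ne.symm hne)
        have hNH : H ⊓ H' ⋖ H := by rw [inf_comm]; exact inf_covBy_of_covBy hH hH' hne
        have hNk : Module.finrank F (H ⊓ H' : Submodule F V) = k := by
          have e1 := finrank_of_covBy hH
          have e2 := finrank_of_covBy hNH
          omega
        -- Flags with different tops are orthogonal, so only the term with c₂ remains.
        rw [flagPairing_eq_zero_of_ne hne hx hy, zero_smul]
        simp only [zero_add]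
        have hjoin : ∀ {K : Submodule F V} {z : FlagChains F V} {w : V}, K ⋖ U →
            z ∈ flagCycles (k + 1) K → w ∈ U ∧ w ≠ 0 → join F w z ∈ flagCycles (k + 1 + 1) U :=
          fun hK hz hw => join_mem_of_mem_hyperplaneCycles (mem_hyperplaneCycles hK hz) hw.1 hw.2
        have hmem : ∀ {K : Submodule F V} {z : FlagChains F V}, H ⊓ H' ⋖ K →
            z ∈ Submodule.span ℤ {x | ∃ l a, l ∈ K ∧ l ∉ H ⊓ H' ∧ a ∈ flagCycles k (H ⊓ H') ∧
              x = join F l a} → z ∈ flagCycles (k + 1) K := by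
          intro K z hK hz
          refine Submodule.span_le.2 ?_ hz
          rintro _ ⟨l, a, hl, hl', ha, rfl⟩
          have := join_mem k ha hl'
          rwa [sup_span_singleton_eq hK hl hl'] at this
        -- Both cycles are reduced to joins of cycles of H ∩ H', first in the left and then in the
        -- right variable. Each sum imposes finitely many generic conditions on w.
        refine Submodule.span_induction (p := fun x _ => ∀ᶠ w in generic U,
          β U w (join F w x) (join F w y) = flagPairing F V (dropTop F V x) (dropTop F V y) • c₂)
          ?_ ?_ ?_ ?_ (mem_span_join k hNH hx)
        · rintro _ ⟨l, a, hlH, hlN, ha, rfl⟩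
          have hxa : join F l a ∈ flagCycles (k + 1) H :=
            hmem hNH (Submodule.subset_span ⟨l, a, hlH, hlN, ha, rfl⟩)
          refine Submodule.span_induction (p := fun y _ => ∀ᶠ w in generic U,
            β U w (join F w (join F l a)) (join F w y) =
              flagPairing F V (dropTop F V (join F l a)) (dropTop F V y) • c₂)
            ?_ ?_ ?_ ?_ (mem_span_join k hNH' hy)
          · rintro _ ⟨l', b, hlH', hlN', hb, rfl⟩
            have eH : H ⊓ H' ⊔ F ∙ l = H := sup_span_singleton_eq hNH hlH hlN
            have eH' : H ⊓ H' ⊔ F ∙ l' = H' := sup_span_singleton_eq hNH' hlH' hlN'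
            have hl'H : l' ∉ H := fun h => hlN' ⟨h, hlH'⟩
            have hlH'' : l ∉ H' := fun h => hlN ⟨hlH, h⟩
            have eU : H ⊓ H' ⊔ F ∙ l ⊔ F ∙ l' = U := by
              rw [eH, sup_span_singleton_eq hH (hH'.le hlH') hl'H]
            rw [flagPairing_dropTop_join ha hb hlN hlN' (by rwa [eH'])]
            have := eventually_form_join_join hβ hNk hlN (by rwa [eH]) ha hb
              (hc₂ _ hNk a ha b hb)
            rwa [eU] at this
          · filter_upwards [hgw] with w hw
            rw [map_zero, map_zero, map_zero, zero_smul, hβ.zero_right hU hw.1 (hjoin hH hxa hw)]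
          · intro y z hy hz h1 h2
            filter_upwards [hgw, h1, h2] with w hw h1 h2
            rw [map_add, map_add, map_add, add_smul, hβ.add_right _ _ _ _ _ hU hw.1
              (hjoin hH hxa hw) (hjoin hH' (hmem hNH' hy) hw) (hjoin hH' (hmem hNH' hz) hw), h1, h2]
          · intro c y hy h1
            filter_upwards [hgw, h1] with w hw h1
            rw [map_smul, map_smul, map_smul, smul_assoc, hβ.zsmul_right hU hw.1
              (hjoin hH hxa hw) (hjoin hH' (hmem hNH' hy) hw), h1]
        · filter_upwards [hgw] with w hw
          rw [map_zero, map_zero, map_zero, LinearMap.zero_apply, zero_smul,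
            hβ.zero_left hU hw.1 (hjoin hH' hy hw)]
        · intro x z hx hz h1 h2
          filter_upwards [hgw, h1, h2] with w hw h1 h2
          rw [map_add, map_add, map_add, LinearMap.add_apply, add_smul, hβ.add_left _ _ _ _ _ hU
            hw.1 (hjoin hH (hmem hNH hx) hw) (hjoin hH (hmem hNH hz) hw) (hjoin hH' hy hw), h1, h2]
        · intro c x hx h1
          filter_upwards [hgw, h1] with w hw h1
          rw [map_smul, map_smul, map_smul, LinearMap.smul_apply, smul_assoc,
            hβ.zsmul_left hU hw.1 (hjoin hH (hmem hNH hx) hw) (hjoin hH' hy hw), h1]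
  -- At the top faces of x and y only the coefficient of the first term of the formula matters,
  -- because their own top faces vanish.
  refine ⟨c₁ - c₂, fun U hU x hx y hy => ?_⟩
  have hU0 : U ≠ ⊥ := by
    rintro rfl
    rw [finrank_bot] at hU
    omega
  have hgw : ∀ᶠ w in generic U, w ∈ U ∧ w ≠ 0 := by
    filter_upwards [eventually_mem_generic U,
      eventually_notMem_generic (S := (⊥ : Submodule F V)) fun h => hU0 (le_bot_iff.1 h)]
      with w hw hw0
    exact ⟨hw, fun h => hw0 ((Submodule.mem_bot F).2 h)⟩
  obtain ⟨hx1, hx2, hx3⟩ := mem_flagCycles_succ.1 hx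
  obtain ⟨hy1, hy2, hy3⟩ := mem_flagCycles_succ.1 hy
  -- The formula is biadditive and no longer refers to particular hyperplanes, so it extends to sums
  -- of hyperplane cycles.
  have key : ∀ x ∈ hyperplaneCycles m U, ∀ y ∈ hyperplaneCycles m U, ∀ᶠ w in generic U,
      β U w (join F w x) (join F w y) = flagPairing F V x y • (c₁ - c₂) +
        flagPairing F V (dropTop F V x) (dropTop F V y) • c₂ := by
    have hjoin : ∀ {z : FlagChains F V} {w : V}, z ∈ hyperplaneCycles m U → w ∈ U ∧ w ≠ 0 →
        join F w z ∈ flagCycles (m + 1) U :=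
      fun hz hw => join_mem_of_mem_hyperplaneCycles hz hw.1 hw.2
    intro x hx y hy
    refine (hyperplaneCycles_induction (P := fun x => x ∈ hyperplaneCycles m U ∧
      ∀ᶠ w in generic U, β U w (join F w x) (join F w y) = flagPairing F V x y • (c₁ - c₂) +
        flagPairing F V (dropTop F V x) (dropTop F V y) • c₂) hx ?_ ?_ ?_).2
    · intro H hH x hx
      have hxU := mem_hyperplaneCycles hH hx
      refine ⟨hxU, (hyperplaneCycles_induction (P := fun y => y ∈ hyperplaneCycles m U ∧
        ∀ᶠ w in generic U, β U w (join F w x) (join F w y) = flagPairing F V x y • (c₁ - c₂) +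
          flagPairing F V (dropTop F V x) (dropTop F V y) • c₂) hy ?_ ?_ ?_).2⟩
      · exact fun H' hH' y hy => ⟨mem_hyperplaneCycles hH' hy, hc₂ U hU H hH H' hH' x hx y hy⟩
      · refine ⟨Submodule.zero_mem _, ?_⟩
        filter_upwards [hgw] with w hw
        simp only [map_zero, zero_smul, add_zero]
        exact hβ.zero_right hU hw.1 (hjoin hxU hw)
      · rintro y z ⟨hy, h1⟩ ⟨hz, h2⟩
        refine ⟨Submodule.add_mem _ hy hz, ?_⟩
        filter_upwards [hgw, h1, h2] with w hw h1 h2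
        simp only [map_add, add_smul]
        rw [hβ.add_right _ _ _ _ _ hU hw.1 (hjoin hxU hw) (hjoin hy hw) (hjoin hz hw), h1, h2]
        abel
    · refine ⟨Submodule.zero_mem _, ?_⟩
      filter_upwards [hgw] with w hw
      simp only [map_zero, LinearMap.zero_apply, zero_smul, add_zero]
      exact hβ.zero_left hU hw.1 (hjoin hy hw)
    · rintro x z ⟨hx, h1⟩ ⟨hz, h2⟩
      refine ⟨Submodule.add_mem _ hx hz, ?_⟩
      filter_upwards [hgw, h1, h2] with w hw h1 h2
      simp only [map_add, LinearMap.add_apply, add_smul]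
      rw [hβ.add_left _ _ _ _ _ hU hw.1 (hjoin hx hw) (hjoin hz hw) (hjoin hy hw), h1, h2]
      abel
  filter_upwards [hgw, key _ hx1 _ hy1] with w hw h
  rw [join_dropTop hx hw.1 hw.2, join_dropTop hy hw.1 hw.2, hx2, map_zero, LinearMap.zero_apply,
    zero_smul, add_zero] at h
  rw [h, ← hx3, ← hy3, flagPairing_consTop, dropTop_consTop, dropTop_consTop]

/-- Every space has cycles whose product is one. -/
theorem exists_flagPairing_eq_one [FiniteDimensional F V] [Infinite F] (n : ℕ) :
    ∀ {U : Submodule F V}, Module.finrank F U = n →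
      ∃ x ∈ flagCycles n U, ∃ y ∈ flagCycles n U, flagPairing F V x y = 1 := by
  induction n with
  | zero =>
    intro U hU
    obtain rfl := Submodule.finrank_eq_zero.1 hU
    refine ⟨_, single_nil_mem_flagCycles 1, _, single_nil_mem_flagCycles 1, ?_⟩
    rw [flagPairing_single, Finsupp.single_eq_same, one_mul]
  | succ n ih =>
    intro U hU
    have hU0 : ⊥ < U := by
      rw [bot_lt_iff_ne_bot]
      rintro rfl
      rw [finrank_bot] at hU
      omega
    obtain ⟨N, -, hN⟩ := exists_le_covBy_of_lt hU0
    have hNn : Module.finrank F N = n := by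
      have := finrank_of_covBy hN
      omega
    obtain ⟨a, ha, b, hb, hab⟩ := ih hNn
    obtain ⟨w, hwU, hwN⟩ := Set.exists_of_ssubset hN.lt
    have hwa := join_dropTop_mem_supported ha hwN
    -- The vector w' avoids the finitely many tops K + w occurring in the correction term of the
    -- join with w; these are hyperplanes of U. Every top in the other correction term contains w',
    -- so the two terms are orthogonal.
    have hev : ∀ᶠ w' in generic U, ∀ t ∈ (join F w (dropTop F V a)).support, w' ∉ flagTop t := by
      rw [Finset.eventually_all]
      intro t ht
      obtain ⟨K, hK, e⟩ := hwa ht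
      refine eventually_notMem_generic (e ▸ ?_)
      have := (sup_span_singleton_covBy hK hwN).lt.not_ge
      rwa [sup_span_singleton_eq hN hwU hwN] at this
    have := generic_neBot U
    obtain ⟨w', h1, h2, h3⟩ := ((eventually_mem_generic U).and
      ((eventually_notMem_generic hN.lt.not_ge).and hev)).exists
    refine ⟨join F w a, ?_, join F w' b, ?_, ?_⟩
    · have := join_mem n ha hwN
      rwa [sup_span_singleton_eq hN hwU hwN] at this
    · have := join_mem n hb h2
      rwa [sup_span_singleton_eq hN h1 h2] at this
    have hwb := join_dropTop_mem_supported hb h2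
    have ha' := flagCycles_le_supported n N ha
    have hb' := flagCycles_le_supported n N hb
    have e1 : flagPairing F V a (join F w' (dropTop F V b)) = 0 := by
      refine flagPairing_eq_zero (Set.disjoint_left.2 ?_) ha' hwb
      rintro t e ⟨K, _, e'⟩
      exact h2 (e.symm.trans e' ▸ Submodule.mem_sup_right (Submodule.mem_span_singleton_self w'))
    have e2 : flagPairing F V (join F w (dropTop F V a)) b = 0 := by
      refine flagPairing_eq_zero (Set.disjoint_left.2 ?_) hwa hb'
      rintro t ⟨K, _, e'⟩ e
      exact hwN (e.symm.trans e' ▸ Submodule.mem_sup_right (Submodule.mem_span_singleton_self w))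
    have e3 : flagPairing F V (join F w (dropTop F V a)) (join F w' (dropTop F V b)) = 0 := by
      refine flagPairing_eq_zero (Set.disjoint_left.2 ?_)
        ((Finsupp.mem_supported ℤ _).2 (subset_refl _)) hwb
      rintro t ht ⟨K, _, e⟩
      refine h3 t ht (e ▸ ?_)
      exact Submodule.mem_sup_right (Submodule.mem_span_singleton_self w')
    rw [join_of_mem ha, join_of_mem hb, sup_span_singleton_eq hN hwU hwN,
      sup_span_singleton_eq hN h1 h2, flagPairing_consTop]
    simp only [map_sub, LinearMap.sub_apply, e1, e2, e3, sub_zero, hab]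

end GenericFormula

/-! ### Simplicial cycles of the building are the recursively defined flag cycles. -/

section Comparison

variable {F : Type*} [Field F] {V : Type*} [AddCommGroup V] [Module F V]

/-- A chain of proper non-zero subspaces as a list, below the whole space. -/
def toFlag {q : ℕ} (s : Simplices F V q) : List (Submodule F V) :=
  ⊤ :: List.ofFn fun i : Fin q => (s i.rev).1

theorem toFlag_injective (q : ℕ) : Function.Injective (toFlag : Simplices F V q → _) := by
  intro s t h
  have h1 := List.ofFn_injective (List.cons_injective h)
  ext i : 2
  have h2 := congrFun h1 i.rev
  simpa using h2

/-- A simplicial chain of the building as a chain on flags. -/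
def toFlagChains (q : ℕ) : Chains F V q →ₗ[ℤ] FlagChains F V :=
  Finsupp.lmapDomain ℤ ℤ toFlag

theorem toFlagChains_single {q : ℕ} (s : Simplices F V q) (c : ℤ) :
    toFlagChains q (Finsupp.single s c) = Finsupp.single (toFlag s) c :=
  Finsupp.mapDomain_single

theorem toFlagChains_injective (q : ℕ) :
    Function.Injective (toFlagChains q : Chains F V q → FlagChains F V) :=
  Finsupp.mapDomain_injective (toFlag_injective q)

theorem flagPairing_toFlagChains {q : ℕ} (x y : Chains F V q) :
    flagPairing F V (toFlagChains q x) (toFlagChains q y) = chainPairing F V q x y := by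
  induction x using Finsupp.induction_linear with
  | zero => simp
  | add f g hf hg => simp only [map_add, LinearMap.add_apply, hf, hg]
  | single s a =>
    induction y using Finsupp.induction_linear with
    | zero => simp
    | add f g hf hg => simp only [map_add, hf, hg]
    | single t b =>
      classical
      simp [toFlagChains_single, flagPairing_single, chainPairing, Finsupp.single_apply,
        (toFlag_injective q).eq_iff]

theorem toFlag_mapSimplex (g : V ≃ₗ[F] V) {q : ℕ} (s : Simplices F V q) :
    toFlag (mapSimplex g s) = (toFlag s).map (Submodule.map (g : V →ₗ[F] V)) := by
  rw [toFlag, toFlag, List.map_cons, List.map_ofFn, Submodule.map_top]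
  congr 1
  exact (LinearEquiv.range g).symm

theorem toFlagChains_mapChains (g : V ≃ₗ[F] V) {q : ℕ} (x : Chains F V q) :
    toFlagChains q (mapChains g q x) = flagMap g (toFlagChains q x) := by
  induction x using Finsupp.induction_linear with
  | zero => simp
  | add f g hf hg => simp only [map_add, hf, hg]
  | single s a =>
    rw [toFlagChains_single, flagMap_single, mapChains, Finsupp.lmapDomain_apply,
      Finsupp.mapDomain_single, toFlagChains_single, toFlag_mapSimplex]

/-- Remove the `i`-th largest subspace (counted from zero) of each flag. -/
def eraseFlag (i : ℕ) : FlagChains F V →ₗ[ℤ] FlagChains F V :=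
  Finsupp.lmapDomain ℤ ℤ fun t => t.eraseIdx i

theorem eraseFlag_single (i : ℕ) (t : List (Submodule F V)) (c : ℤ) :
    eraseFlag i (Finsupp.single t c) = Finsupp.single (t.eraseIdx i) c :=
  Finsupp.mapDomain_single

theorem eraseFlag_succ_consTop (i : ℕ) (U : Submodule F V) (x : FlagChains F V) :
    eraseFlag (i + 1) (consTop U x) = consTop U (eraseFlag i x) := by
  induction x using Finsupp.induction_linear with
  | zero => simp
  | add f g hf hg => simp only [map_add, hf, hg]
  | single t c => rw [consTop_single, eraseFlag_single, eraseFlag_single, consTop_single]; rfl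

theorem eraseFlag_zero {x : FlagChains F V} (hx : x [] = 0) :
    eraseFlag 0 x = dropTop F V x := by
  rw [← Finsupp.sum_single x, Finsupp.sum, map_sum, map_sum]
  refine Finset.sum_congr rfl fun t ht => ?_
  cases t with
  | nil => exact absurd hx (Finsupp.mem_support_iff.1 ht)
  | cons U t => rw [eraseFlag_single, ← consTop_single, dropTop_consTop]; rfl

/-- Lists start with the largest subspace and include the whole space at position 0. So the j-th of
q proper subspaces sits at position q - j, and position 0 is never erased. -/
theorem toFlag_face {q : ℕ} (j : Fin q) (s : Simplices F V q) :
    toFlag (face j s) = (toFlag s).eraseIdx (q - j) := by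
  have hj := j.2
  obtain ⟨p, rfl⟩ : ∃ p, q = p + 1 := ⟨q - 1, by omega⟩
  have e : p + 1 - j.1 = (p - j.1) + 1 := by omega
  rw [toFlag, toFlag, e, List.eraseIdx_cons_succ]
  congr 1
  apply List.ext_getElem
  · rw [List.length_eraseIdx_of_lt (by rw [List.length_ofFn]; omega)]
    simp
  · intro i h1 h2
    rw [List.length_ofFn] at h1
    rw [List.getElem_eraseIdx]
    simp only [List.getElem_ofFn]
    split_ifs with h
    · rw [face_apply_ge _ _ _ (by simp [Fin.rev]; omega)]
      congr 2
      ext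
      simp [Fin.rev]
      omega
    · rw [face_apply_lt _ _ _ (by simp [Fin.rev]; omega)]
      congr 2
      ext
      simp [Fin.rev]

theorem toFlagChains_face {q : ℕ} (j : Fin q) (x : Chains F V q) :
    toFlagChains (q - 1) (Finsupp.mapDomain (face j) x) =
      eraseFlag (q - j) (toFlagChains q x) := by
  induction x using Finsupp.induction_linear with
  | zero => simp
  | add f g hf hg => simp only [Finsupp.mapDomain_add, map_add, hf, hg]
  | single s c =>
    rw [Finsupp.mapDomain_single, toFlagChains_single, toFlagChains_single, eraseFlag_single,
      toFlag_face]

/-- The part of a chain of flags below a given largest subspace. -/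
def belowTop (H : Submodule F V) : FlagChains F V →ₗ[ℤ] FlagChains F V :=
  Finsupp.lcomapDomain (List.cons H) List.cons_injective

theorem belowTop_apply (H : Submodule F V) (x : FlagChains F V) (t : List (Submodule F V)) :
    belowTop H x t = x (H :: t) := rfl

theorem belowTop_eraseFlag (H : Submodule F V) (i : ℕ) (x : FlagChains F V) :
    belowTop H (eraseFlag (i + 1) x) = eraseFlag i (belowTop H x) := by
  classical
  have hs : ∀ (K : Submodule F V) t (c : ℤ), belowTop H (Finsupp.single (K :: t) c) =
      if K = H then Finsupp.single t c else 0 := by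
    intro K t c
    ext s
    rw [belowTop_apply]
    by_cases h : K = H
    · subst h; simp [Finsupp.single_apply]
    · simp [h]
  induction x using Finsupp.induction_linear with
  | zero => simp
  | add f g hf hg => simp only [map_add, hf, hg]
  | single t c =>
    cases t with
    | nil =>
      have h0 : belowTop H (Finsupp.single [] c) = 0 := by
        ext s
        rw [belowTop_apply]
        simp
      rw [eraseFlag_single, List.eraseIdx_nil, h0, map_zero]
    | cons K t =>
      rw [eraseFlag_single, List.eraseIdx_cons_succ, hs, hs]
      split_ifs
      · rw [eraseFlag_single]
      · rw [map_zero]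

/-- Sorting flags by their tops splits a chain into the hyperplane parts required by the recursive
definition of cycles. -/
theorem sum_consTop_belowTop [DecidableEq (Submodule F V)] {x : FlagChains F V} (hx : x [] = 0) :
    ∑ H ∈ x.support.image flagTop, consTop H (belowTop H x) = x := by
  ext t
  rw [Finsupp.finsetSum_apply]
  cases t with
  | nil =>
    rw [hx]
    refine Finset.sum_eq_zero fun H _ => ?_
    refine Finsupp.mapDomain_of_notMem_range _ _ ?_
    rintro ⟨s, hs⟩
    exact List.cons_ne_nil _ _ hs
  | cons K t =>
    have h1 : ∀ H, H ≠ K → consTop H (belowTop H x) (K :: t) = 0 := by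
      intro H hH
      refine Finsupp.mapDomain_of_notMem_range _ _ ?_
      rintro ⟨s, hs⟩
      exact hH (List.cons.inj hs).1
    have h2 : consTop K (belowTop K x) (K :: t) = x (K :: t) :=
      Finsupp.mapDomain_apply List.cons_injective _ _
    rw [Finset.sum_eq_single K (fun H _ hH => h1 H hH), h2]
    intro hK
    rw [h2]
    by_contra h
    exact hK (Finset.mem_image.2 ⟨K :: t, Finsupp.mem_support_iff.2 h, rfl⟩)

theorem length_lt_finrank [FiniteDimensional F V] {t : List (Submodule F V)} :
    ∀ {H : Submodule F V}, (H :: t).Pairwise (· > ·) → ⊥ ∉ H :: t →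
      t.length < Module.finrank F H := by
  induction t with
  | nil =>
    intro H _ h
    rw [List.length_nil, Nat.pos_iff_ne_zero]
    exact fun h0 => h (by simp [Submodule.finrank_eq_zero.1 h0])
  | cons K t ih =>
    intro H h h0
    have h1 := ih h.of_cons fun h => h0 (List.mem_cons_of_mem _ h)
    have h2 := Submodule.finrank_lt_finrank_of_lt (List.rel_of_pairwise_cons h List.mem_cons_self)
    rw [List.length_cons]
    omega

theorem covBy_of_finrank_eq [FiniteDimensional F V] {H U : Submodule F V} (h : H < U)
    (hr : Module.finrank F U = Module.finrank F H + 1) : H ⋖ U := by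
  refine ⟨h, fun K h1 h2 => ?_⟩
  have := Submodule.finrank_lt_finrank_of_lt h1
  have := Submodule.finrank_lt_finrank_of_lt h2
  omega

/-- The lengths force the flags to be complete, so the tops H are hyperplanes of U. In the part with
top H, face i below H is face i + 1 of z, and hence vanishes. Face 0 of z is left free: only the
parts below each H need a vanishing top face. -/
theorem mem_hyperplaneCycles_of_eraseFlag [FiniteDimensional F V] (m : ℕ) :
    ∀ {U : Submodule F V} {z : FlagChains F V}, Module.finrank F U = m + 1 →
      (∀ t ∈ z.support, t.length = m ∧ (U :: t).Pairwise (· > ·) ∧ ⊥ ∉ t) →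
      (∀ i, 1 ≤ i → i < m → eraseFlag i z = 0) → z ∈ hyperplaneCycles m U := by
  induction m with
  | zero =>
    intro U z hU hz _
    have e : z = Finsupp.single [] (z []) := by
      rw [← Finsupp.support_subset_singleton]
      intro t ht
      exact Finset.mem_singleton.2 (List.length_eq_zero_iff.1 (hz t ht).1)
    have h : (⊥ : Submodule F V) ⋖ U := by
      refine covBy_of_finrank_eq (bot_lt_iff_ne_bot.2 ?_) (by rw [hU, finrank_bot])
      rintro rfl
      rw [finrank_bot] at hU
      omega
    rw [e]
    exact mem_hyperplaneCycles h (single_nil_mem_flagCycles _)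
  | succ m ih =>
    intro U z hU hz he
    classical
    have h0 : z [] = 0 := by
      by_contra h
      have := (hz [] (Finsupp.mem_support_iff.2 h)).1
      simp at this
    rw [← sum_consTop_belowTop h0]
    refine Submodule.sum_mem _ fun H hH => ?_
    obtain ⟨t, ht, rfl⟩ := Finset.mem_image.1 hH
    obtain ⟨hl, hp, hb⟩ := hz t ht
    rcases t with _ | ⟨H, t⟩
    · simp at hl
    change consTop H (belowTop H z) ∈ _
    have hHU : H < U := List.rel_of_pairwise_cons hp List.mem_cons_self
    have hr : Module.finrank F H = m + 1 := by
      have h1 := length_lt_finrank hp.of_cons hb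
      have h2 := Submodule.finrank_lt_finrank_of_lt hHU
      rw [List.length_cons] at hl
      omega
    refine mem_hyperplaneCycles (covBy_of_finrank_eq hHU (by rw [hU, hr])) ?_
    have hsupp : ∀ t ∈ (belowTop H z).support,
        t.length = m ∧ (H :: t).Pairwise (· > ·) ∧ ⊥ ∉ t := by
      intro t ht
      rw [Finsupp.mem_support_iff, belowTop_apply] at ht
      obtain ⟨hl, hp, hb⟩ := hz _ (Finsupp.mem_support_iff.2 ht)
      exact ⟨by simpa using hl, hp.of_cons, fun h => hb (List.mem_cons_of_mem _ h)⟩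
    have herase : ∀ i, i < m → eraseFlag i (belowTop H z) = 0 := by
      intro i hi
      rw [← belowTop_eraseFlag, he (i + 1) (by omega) (by omega), map_zero]
    have hmem := ih hr hsupp fun i _ hi => herase i hi
    rw [mem_flagCycles_succ, dropTop_consTop]
    refine ⟨hmem, ?_, rfl⟩
    cases m with
    | zero =>
      have e : belowTop H z = Finsupp.single [] (belowTop H z []) := by
        rw [← Finsupp.support_subset_singleton]
        intro t ht
        exact Finset.mem_singleton.2 (List.length_eq_zero_iff.1 (hsupp t ht).1)
      rw [e, dropTop_single_nil]
    | succ m =>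
      rw [← eraseFlag_zero, herase 0 (by omega)]
      by_contra h
      have := (hsupp [] (Finsupp.mem_support_iff.2 h)).1
      simp at this

theorem flagCycles_le_supported_flags (n : ℕ) : ∀ {U : Submodule F V},
    flagCycles (n + 1) U ≤ Finsupp.supported ℤ ℤ
      {t | ∃ s, t = U :: s ∧ s.length = n ∧ t.Pairwise (· > ·) ∧ ⊥ ∉ t} := by
  induction n with
  | zero =>
    intro U x hx
    rw [← (mem_flagCycles_succ.1 hx).2.2]
    refine map_mem_of_mem_hyperplaneCycles _ _ (fun H hH h hh => ?_) (mem_flagCycles_succ.1 hx).1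
    by_cases hb : H = ⊥
    · subst hb
      obtain ⟨c, rfl⟩ := mem_flagCycles_zero hh
      rw [consTop_single]
      refine Finsupp.single_mem_supported ℤ _ ⟨[], rfl, rfl, List.pairwise_singleton _ _, ?_⟩
      rw [List.mem_singleton]
      exact hH.ne
    · rw [flagCycles_zero_of_ne hb hh, map_zero]
      exact Submodule.zero_mem _
  | succ n ih =>
    intro U x hx
    rw [← (mem_flagCycles_succ.1 hx).2.2]
    refine map_mem_of_mem_hyperplaneCycles _ _ (fun H hH h hh => ?_) (mem_flagCycles_succ.1 hx).1
    classical
    intro t ht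
    obtain ⟨r, hr, rfl⟩ := Finset.mem_image.1 (Finsupp.mapDomain_support ht)
    obtain ⟨s, rfl, hl, hp, hb⟩ := ih hh hr
    refine ⟨_, rfl, by rw [List.length_cons, hl], List.pairwise_cons.2 ⟨?_, hp⟩, ?_⟩
    · intro K hK
      rcases List.mem_cons.1 hK with rfl | hK
      · exact hH.lt
      · exact (List.rel_of_pairwise_cons hp hK).trans hH.lt
    · rw [List.mem_cons, not_or]
      exact ⟨(bot_le.trans_lt hH.lt).ne, hb⟩

theorem apply_nil_of_mem_hyperplaneCycles {n : ℕ} {U : Submodule F V} {x : FlagChains F V}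
    (hx : x ∈ hyperplaneCycles (n + 1) U) : x [] = 0 := by
  refine (Submodule.mem_bot ℤ).1 (map_mem_of_mem_hyperplaneCycles
    (Finsupp.lapply [] : FlagChains F V →ₗ[ℤ] ℤ) ⊥ (fun H _ h hh => ?_) hx)
  rw [Submodule.mem_bot, Finsupp.lapply_apply]
  by_contra h0
  obtain ⟨s, hs, _⟩ := flagCycles_le_supported_flags n hh (Finsupp.mem_support_iff.2 h0)
  simp at hs

/-- Face 1 is the top face of what lies below U and vanishes by definition. The lower faces are
faces of cycles of hyperplanes, so induction applies. -/
theorem eraseFlag_of_mem_flagCycles (n : ℕ) : ∀ {U : Submodule F V} {x : FlagChains F V},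
    x ∈ flagCycles n U → ∀ i, 1 ≤ i → i < n → eraseFlag i x = 0 := by
  induction n with
  | zero => intro U x _ i _ hi; omega
  | succ n ih =>
    intro U x hx i h1 h2
    obtain ⟨hx1, hx2, hx3⟩ := mem_flagCycles_succ.1 hx
    obtain ⟨j, rfl⟩ : ∃ j, i = j + 1 := ⟨i - 1, by omega⟩
    rw [← hx3, eraseFlag_succ_consTop]
    suffices h : eraseFlag j (dropTop F V x) = 0 by rw [h, map_zero]
    rcases j with _ | j
    · obtain ⟨k, rfl⟩ : ∃ k, n = k + 1 := ⟨n - 1, by omega⟩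
      rw [eraseFlag_zero (apply_nil_of_mem_hyperplaneCycles hx1), hx2]
    · refine (Submodule.mem_bot ℤ).1 (map_mem_of_mem_hyperplaneCycles _ ⊥ (fun H _ h hh => ?_) hx1)
      rw [Submodule.mem_bot]
      exact ih hh (j + 1) (by omega) (by omega)

theorem pairwise_toFlag {q : ℕ} (s : Simplices F V q) : (toFlag s).Pairwise (· > ·) := by
  rw [toFlag, List.pairwise_cons]
  constructor
  · intro W hW
    obtain ⟨i, rfl⟩ := List.mem_ofFn.1 hW
    exact lt_top_iff_ne_top.2 (s i.rev).2.2
  · rw [List.pairwise_ofFn]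
    intro i j hij
    exact s.strictMono (Fin.rev_lt_rev.2 hij)

/-- In the top degree each face of a simplicial cycle vanishes separately, by `face_eq_zero`, since
different faces omit different dimensions. These are the vanishing conditions which the recursive
description needs. -/
theorem toFlagChains_mem [FiniteDimensional F V] {n : ℕ} (hV : Module.finrank F V = n + 1)
    {x : Chains F V n} (hx : x ∈ Cycles F V n) :
    toFlagChains n x ∈ flagCycles (n + 1) (⊤ : Submodule F V) := by
  let z : FlagChains F V := belowTop ⊤ (toFlagChains n x)
  have hz : consTop ⊤ z = toFlagChains n x := by
    have h : ∀ y : Chains F V n, consTop ⊤ (belowTop ⊤ (toFlagChains n y)) = toFlagChains n y := by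
      intro y
      induction y using Finsupp.induction_linear with
      | zero => simp
      | add f g hf hg => simp only [map_add, hf, hg]
      | single s c =>
        have e : belowTop ⊤ (Finsupp.single (toFlag s) c) =
            Finsupp.single (List.ofFn fun i : Fin n => (s i.rev).1) c := by
          classical
          ext t
          rw [belowTop_apply, toFlag]
          simp [Finsupp.single_apply]
        rw [toFlagChains_single, e, consTop_single]
        rfl
    exact h x
  have hsupp : ∀ t ∈ z.support, t.length = n ∧ (⊤ :: t).Pairwise (· > ·) ∧ ⊥ ∉ t := by
    classical
    intro t ht
    have h1 : ⊤ :: t ∈ (toFlagChains n x).support := by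
      rw [Finsupp.mem_support_iff] at ht ⊢
      exact ht
    obtain ⟨s, _, hs⟩ := Finset.mem_image.1 (Finsupp.mapDomain_support h1)
    have h2 := pairwise_toFlag s
    rw [hs] at h2
    obtain rfl := List.cons_injective hs
    refine ⟨List.length_ofFn, h2, fun h => ?_⟩
    obtain ⟨i, hi⟩ := List.mem_ofFn.1 h
    exact (s i.rev).2.1 hi
  have herase : ∀ i, i < n → eraseFlag i z = 0 := by
    intro i hi
    rw [← belowTop_eraseFlag]
    have h := toFlagChains_face (⟨n - (i + 1), by omega⟩ : Fin n) x
    rw [face_eq_zero hV hx, map_zero] at h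
    have e : n - (n - (i + 1)) = i + 1 := by omega
    rw [e] at h
    rw [← h, map_zero]
  have hmem := mem_hyperplaneCycles_of_eraseFlag n (by rw [finrank_top, hV]) hsupp
    fun i _ hi => herase i hi
  rw [mem_flagCycles_succ, ← hz, dropTop_consTop]
  refine ⟨hmem, ?_, rfl⟩
  cases n with
  | zero =>
    have e : z = Finsupp.single [] (z []) := by
      rw [← Finsupp.support_subset_singleton]
      intro t ht
      exact Finset.mem_singleton.2 (List.length_eq_zero_iff.1 (hsupp t ht).1)
    rw [e, dropTop_single_nil]
  | succ n =>
    rw [← eraseFlag_zero (apply_nil_of_mem_hyperplaneCycles hmem), herase 0 (by omega)]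

theorem exists_toFlag_eq {t : List (Submodule F V)} (hp : (⊤ :: t).Pairwise (· > ·))
    (hb : ⊥ ∉ t) : ∃ s : Simplices F V t.length, toFlag s = ⊤ :: t := by
  obtain ⟨h1, h2⟩ := List.pairwise_cons.1 hp
  refine ⟨OrderEmbedding.ofStrictMono (fun i => ⟨t.get i.rev, fun h => hb (h ▸ t.get_mem _),
    (h1 _ (t.get_mem _)).ne⟩) ?_, ?_⟩
  · intro i j hij
    exact List.pairwise_iff_get.1 h2 _ _ (Fin.rev_lt_rev.2 hij)
  · rw [toFlag]
    congr 1
    refine (congrArg List.ofFn (funext fun i => ?_)).trans (List.ofFn_get t)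
    exact congrArg t.get (Fin.rev_rev i)

theorem exists_toFlagChains_eq {n : ℕ} {y : FlagChains F V}
    (hy : y ∈ flagCycles (n + 1) (⊤ : Submodule F V)) :
    ∃ x ∈ Cycles F V n, toFlagChains n x = y := by
  have hrange : ∀ t ∈ y.support, t ∈ Set.range (toFlag : Simplices F V n → _) := by
    intro t ht
    obtain ⟨s, rfl, rfl, hp, hb⟩ := flagCycles_le_supported_flags n hy ht
    exact exists_toFlag_eq hp fun h => hb (List.mem_cons_of_mem _ h)
  have hyx : toFlagChains n (y.comapDomain toFlag (toFlag_injective n).injOn) = y :=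
    Finsupp.mapDomain_comapDomain _ (toFlag_injective n) _ hrange
  refine ⟨_, mem_cycles_of_face fun j => ?_, hyx⟩
  have hj := j.2
  apply toFlagChains_injective (n - 1)
  rw [toFlagChains_face, hyx, map_zero]
  exact eraseFlag_of_mem_flagCycles (n + 1) hy _ (by omega) (by omega)

end Comparison

/-! ### The coinvariants are infinite cyclic. -/

section CoinvariantsOfSteinberg

variable (F : Type*) [Field F]

/-- The Steinberg module as a group of chains on flags. -/
def stToFlagChains (n : ℕ) : St F n →ₗ[ℤ] FlagChains F (Fin (n + 1) → F) :=
  (toFlagChains n).comp (Cycles F (Fin (n + 1) → F) n).subtype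

theorem stToFlagChains_injective (n : ℕ) : Function.Injective (stToFlagChains F n) :=
  (toFlagChains_injective n).comp Subtype.val_injective

theorem stToFlagChains_mem {n : ℕ} (x : St F n) : stToFlagChains F n x ∈ flagCycles (n + 1) ⊤ :=
  toFlagChains_mem (by simp) x.2

/-- A chain on flags as an element of the Steinberg module, if possible. -/
def stOfFlagChains (n : ℕ) : FlagChains F (Fin (n + 1) → F) → St F n :=
  Function.invFun (stToFlagChains F n)

theorem stToFlagChains_stOfFlagChains {n : ℕ} {y : FlagChains F (Fin (n + 1) → F)}
    (hy : y ∈ flagCycles (n + 1) ⊤) : stToFlagChains F n (stOfFlagChains F n y) = y := by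
  obtain ⟨x, hx, e⟩ := exists_toFlagChains_eq hy
  exact Function.invFun_eq ⟨(⟨x, hx⟩ : Cycles F (Fin (n + 1) → F) n), e⟩

theorem stOfFlagChains_stToFlagChains {n : ℕ} (x : St F n) :
    stOfFlagChains F n (stToFlagChains F n x) = x :=
  stToFlagChains_injective F n (stToFlagChains_stOfFlagChains F (stToFlagChains_mem F x))

theorem stOfFlagChains_add {n : ℕ} {x y : FlagChains F (Fin (n + 1) → F)}
    (hx : x ∈ flagCycles (n + 1) ⊤) (hy : y ∈ flagCycles (n + 1) ⊤) :
    stOfFlagChains F n (x + y) = stOfFlagChains F n x + stOfFlagChains F n y := by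
  apply stToFlagChains_injective F n
  rw [map_add, stToFlagChains_stOfFlagChains F hx, stToFlagChains_stOfFlagChains F hy,
    stToFlagChains_stOfFlagChains F (Submodule.add_mem _ hx hy)]

theorem stToFlagChains_stRep {n : ℕ} (g : GLn F (n + 1)) (x : St F n) :
    stToFlagChains F n (stRep F n g x) = flagMap g (stToFlagChains F n x) :=
  toFlagChains_mapChains g x.1

theorem stOfFlagChains_flagMap {n : ℕ} (g : GLn F (n + 1)) {x : FlagChains F (Fin (n + 1) → F)}
    (hx : x ∈ flagCycles (n + 1) ⊤) :
    stOfFlagChains F n (flagMap g x) = stRep F n g (stOfFlagChains F n x) := by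
  rw [← stOfFlagChains_stToFlagChains F (stRep F n g _), stToFlagChains_stRep,
    stToFlagChains_stOfFlagChains F hx]

theorem stPairing_eq {n : ℕ} (x y : St F n) :
    stPairing F n x y = flagPairing F _ (stToFlagChains F n x) (stToFlagChains F n y) :=
  (flagPairing_toFlagChains x.1 y.1).symm

theorem coinv_mk_tmul_stRep {n : ℕ} (g : GLn F (n + 1)) (x y : St F n) :
    Coinv.mk F n (StSq.tmul (stRep F n g x) (stRep F n g y)) = Coinv.mk F n (StSq.tmul x y) :=
  Representation.Coinvariants.mk_self_apply (stSqRep F n) g (StSq.tmul x y)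

/-- Taking classes in the coinvariants is the universal invariant form. In full dimension the only
subspace is the whole space, and the vector plays no role. -/
theorem isSystem_coinv (n : ℕ) : IsSystem (F := F) (V := Fin (n + 1) → F) (n + 1)
    (fun _ _ x y => Coinv.mk F n (StSq.tmul (stOfFlagChains F n x) (stOfFlagChains F n y))) := by
  have htop : ∀ U : Submodule F (Fin (n + 1) → F), Module.finrank F U = n + 1 → U = ⊤ :=
    fun U hU => Submodule.eq_top_of_finrank_eq (by rw [hU]; simp)
  constructor
  · intro U w x x' y hU _ hx hx' _
    obtain rfl := htop U hU
    rw [stOfFlagChains_add F hx hx', ← map_add]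
    exact congrArg _ (TensorProduct.add_tmul _ _ _)
  · intro U w x y y' hU _ _ hy hy'
    obtain rfl := htop U hU
    rw [stOfFlagChains_add F hy hy', ← map_add]
    exact congrArg _ (TensorProduct.tmul_add _ _ _)
  · intro g U w x y hU _ hx hy
    obtain rfl := htop U hU
    rw [stOfFlagChains_flagMap F g hx, stOfFlagChains_flagMap F g hy, coinv_mk_tmul_stRep]

variable [Infinite F]

theorem exists_coinv_generator (n : ℕ) : ∃ c : Coinv F n, ∀ z, z = coinvPairing F n z • c := by
  obtain ⟨c, hc⟩ := (isSystem_coinv F n).exists_generic_formula (n + 1) (by simp)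
  refine ⟨c, fun z => ?_⟩
  obtain ⟨z, rfl⟩ := Representation.Coinvariants.mk_surjective (stSqRep F n) z
  change Coinv.mk F n z = coinvPairing F n (Coinv.mk F n z) • c
  induction z using stSq_induction with
  | h0 => simp
  | ha x y hx hy => rw [map_add, map_add, add_smul, ← hx, ← hy]
  | ht a b =>
    -- Neither side of the generic formula involves the vector here, so it holds outright as soon as
    -- a generic vector exists.
    have := generic_neBot (⊤ : Submodule F (Fin (n + 1) → F))
    obtain ⟨_, h⟩ := (hc ⊤ (by simp) _ (stToFlagChains_mem F a) _ (stToFlagChains_mem F b)).exists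
    rwa [stOfFlagChains_stToFlagChains, stOfFlagChains_stToFlagChains, ← stPairing_eq] at h

theorem coinvPairing_surjective (n : ℕ) : Function.Surjective (coinvPairing F n) := by
  obtain ⟨x, hx, y, hy, h⟩ := exists_flagPairing_eq_one (F := F) (V := Fin (n + 1) → F) (n + 1)
    (U := ⊤) (by simp)
  intro c
  refine ⟨c • Coinv.mk F n (StSq.tmul (stOfFlagChains F n x) (stOfFlagChains F n y)), ?_⟩
  rw [map_smul, coinvPairing_mk_tmul, stPairing_eq, stToFlagChains_stOfFlagChains F hx,
    stToFlagChains_stOfFlagChains F hy, h, smul_eq_mul, mul_one]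

/-- The coinvariants of the tensor square of the Steinberg module are infinite cyclic. -/
theorem coinvPairing_bijective (n : ℕ) : Function.Bijective (coinvPairing F n) := by
  refine ⟨?_, coinvPairing_surjective F n⟩
  obtain ⟨c, hc⟩ := exists_coinv_generator F n
  intro x y h
  rw [hc x, hc y, h]

end CoinvariantsOfSteinberg

/-! ### Recognition of the divided power algebra from its structure constants. -/

section DividedPowers

variable {k : Type*} [CommRing k]

/-- A divided power of m ∈ k is m ^ n times that of 1, and a product of two divided powers of 1 is
an integer multiple of a third. So the span is closed under multiplication by the algebra
generators. -/
theorem span_dp_eq_top :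
    Submodule.span k (Set.range fun n => DividedPowerAlgebra.dp k n (1 : k)) = ⊤ := by
  rw [Submodule.eq_top_iff']
  intro f
  induction f using DividedPowerAlgebra.induction_on with
  | C a =>
    rw [Algebra.algebraMap_eq_smul_one, ← DividedPowerAlgebra.dp_zero (m := (1 : k))]
    exact Submodule.smul_mem _ _ (Submodule.subset_span ⟨0, rfl⟩)
  | add f g hf hg => exact Submodule.add_mem _ hf hg
  | dp f n m hf =>
    have e : DividedPowerAlgebra.dp k n m = m ^ n • DividedPowerAlgebra.dp k n (1 : k) := by
      rw [← DividedPowerAlgebra.dp_smul, smul_eq_mul, mul_one]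
    rw [e, mul_smul_comm]
    refine Submodule.smul_mem _ _ ?_
    induction hf using Submodule.span_induction with
    | mem x hx =>
      obtain ⟨p, rfl⟩ := hx
      simp only [DividedPowerAlgebra.dp_mul]
      exact Submodule.smul_of_tower_mem _ _ (Submodule.subset_span ⟨_, rfl⟩)
    | zero => rw [zero_mul]; exact Submodule.zero_mem _
    | add x y _ _ hx hy => rw [add_mul]; exact Submodule.add_mem _ hx hy
    | smul a x _ hx => rw [smul_mul_assoc]; exact Submodule.smul_mem _ _ hx

variable {A : ℕ → Type*} [∀ n, AddCommGroup (A n)] [∀ n, Module k (A n)]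
  {μ : ∀ m n, A m →ₗ[k] A n →ₗ[k] A (m + 1 + n)}

instance : IsScalarTower k (PositivePart A μ) (PositivePart A μ) :=
  ⟨fun c x y => LinearMap.map_smul₂ (directSumMul A μ) c x y⟩

instance : SMulCommClass k (PositivePart A μ) (PositivePart A μ) :=
  ⟨fun c x y => (map_smul (directSumMul A μ x) c y).symm⟩

theorem PositivePart.induction {P : PositivePart A μ → Prop} (x : PositivePart A μ) (h0 : P 0)
    (hof : ∀ n a, P (PositivePart.of A μ n a)) (hadd : ∀ x y, P x → P y → P (x + y)) : P x :=
  DirectSum.induction_on (motive := P) x h0 hof hadd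

/-- The structure constants of a divided power algebra. -/
def IsDividedPowerSystem (μ : ∀ m n, A m →ₗ[k] A n →ₗ[k] A (m + 1 + n)) (g : ∀ n, A n) : Prop :=
  (∀ n a, ∃ c : k, a = c • g n) ∧
    ∀ m n, μ m n (g m) (g n) = (m + 1 + n + 1).choose (m + 1) • g (m + 1 + n)

namespace IsDividedPowerSystem

variable {g : ∀ n, A n}

theorem of_mul_of (h : IsDividedPowerSystem μ g) (m n : ℕ) :
    PositivePart.of A μ m (g m) * PositivePart.of A μ n (g n) =
      (m + 1 + n + 1).choose (m + 1) • PositivePart.of A μ (m + 1 + n) (g (m + 1 + n)) := by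
  rw [PositivePart.of_mul_of, h.2, map_nsmul]

theorem induction (h : IsDividedPowerSystem μ g) {P : PositivePart A μ → Prop}
    (x : PositivePart A μ) (h0 : P 0) (hof : ∀ n, P (PositivePart.of A μ n (g n)))
    (hadd : ∀ x y, P x → P y → P (x + y)) (hsmul : ∀ (c : k) x, P x → P (c • x)) : P x := by
  refine PositivePart.induction x h0 (fun n a => ?_) hadd
  obtain ⟨c, rfl⟩ := h.1 n a
  rw [map_smul]
  exact hsmul c _ (hof n)

theorem of_congr {m n : ℕ} (e : m = n) :
    PositivePart.of A μ m (g m) = PositivePart.of A μ n (g n) := by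
  subst e; rfl

theorem mul_comm' (h : IsDividedPowerSystem μ g) (x y : PositivePart A μ) : x * y = y * x := by
  induction x using h.induction with
  | h0 => rw [zero_mul, mul_zero]
  | hadd x x' hx hx' => rw [add_mul, mul_add, hx, hx']
  | hsmul c x hx => rw [smul_mul_assoc, mul_smul_comm, hx]
  | hof m =>
    induction y using h.induction with
    | h0 => rw [zero_mul, mul_zero]
    | hadd x x' hx hx' => rw [add_mul, mul_add, hx, hx']
    | hsmul c x hx => rw [smul_mul_assoc, mul_smul_comm, hx]
    | hof n =>
      rw [h.of_mul_of, h.of_mul_of, of_congr (by omega : m + 1 + n = n + 1 + m)]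
      congr 1
      rw [show n + 1 + m + 1 = m + 1 + n + 1 by omega]
      exact Nat.choose_symm_of_eq_add (by omega)

theorem mul_assoc' (h : IsDividedPowerSystem μ g) (x y z : PositivePart A μ) :
    x * y * z = x * (y * z) := by
  induction x using h.induction with
  | h0 => simp only [zero_mul]
  | hadd x x' hx hx' => simp only [add_mul, hx, hx']
  | hsmul c x hx => simp only [smul_mul_assoc, hx]
  | hof l =>
    induction y using h.induction with
    | h0 => simp only [zero_mul, mul_zero]
    | hadd x x' hx hx' => simp only [add_mul, mul_add, hx, hx']
    | hsmul c x hx => simp only [smul_mul_assoc, mul_smul_comm, hx]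
    | hof m =>
      induction z using h.induction with
      | h0 => simp only [mul_zero]
      | hadd x x' hx hx' => simp only [mul_add, hx, hx']
      | hsmul c x hx => simp only [mul_smul_comm, hx]
      | hof n =>
        rw [h.of_mul_of, h.of_mul_of, smul_mul_assoc, mul_smul_comm, h.of_mul_of, h.of_mul_of,
          of_congr (by omega : l + 1 + (m + 1 + n) = l + 1 + m + 1 + n), smul_smul, smul_smul]
        congr 1
        -- After multiplication by the three factorials, both products of binomial coefficients
        -- become the factorial of the total degree.
        have e : ∀ i j : ℕ, (i + j).choose i * i.factorial * j.factorial = (i + j).factorial :=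
          fun i j => by
            rw [Nat.choose_symm_add]
            exact Nat.add_choose_mul_factorial_mul_factorial i j
        have e1 := e (l + 1) (m + 1)
        have e2 := e (l + 1 + (m + 1)) (n + 1)
        have e3 := e (m + 1) (n + 1)
        have e4 := e (l + 1) (m + 1 + (n + 1))
        rw [show l + 1 + (m + 1 + (n + 1)) = l + 1 + (m + 1) + (n + 1) by omega] at e4
        rw [show l + 1 + m + 1 = l + 1 + (m + 1) by omega,
          show l + 1 + (m + 1) + n + 1 = l + 1 + (m + 1) + (n + 1) by omega,
          show m + 1 + n + 1 = m + 1 + (n + 1) by omega,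
          show l + 1 + (m + 1 + n) + 1 = l + 1 + (m + 1) + (n + 1) by omega]
        have hp : 0 < (l + 1).factorial * (m + 1).factorial * (n + 1).factorial := by positivity
        apply Nat.eq_of_mul_eq_mul_right hp
        calc _ = (l + 1 + (m + 1) + (n + 1)).choose (l + 1 + (m + 1)) *
              ((l + 1 + (m + 1)).choose (l + 1) * (l + 1).factorial * (m + 1).factorial) *
              (n + 1).factorial := by ring
          _ = (l + 1 + (m + 1) + (n + 1)).choose (l + 1) * (l + 1).factorial *
              ((m + 1 + (n + 1)).choose (m + 1) * (m + 1).factorial * (n + 1).factorial) := by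
            rw [e1, e2, e3, e4]
          _ = _ := by ring

/-- The commutative ring structure on the positive part. -/
abbrev nonUnitalCommRing (h : IsDividedPowerSystem μ g) : NonUnitalCommRing (PositivePart A μ) where
  mul_assoc := h.mul_assoc'
  mul_comm := h.mul_comm'

variable (μ g) in
/-- The divided powers of the generator. -/
def power : ℕ → Unitization k (PositivePart A μ)
  | 0 => 1
  | n + 1 => Unitization.inr (PositivePart.of A μ n (g n))

theorem power_mul_power (h : IsDividedPowerSystem μ g) (m n : ℕ) :
    power μ g m * power μ g n = (m + n).choose m • power μ g (m + n) := by
  rcases m with _ | m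
  · rw [power, one_mul, zero_add, Nat.choose_zero_right, one_smul]
  rcases n with _ | n
  · rw [add_zero, Nat.choose_self, one_smul]
    exact mul_one _
  · rw [power, power, ← Unitization.inr_mul, h.of_mul_of, Unitization.inr_smul,
      show m + 1 + (n + 1) = m + 1 + n + 1 by omega, power]

/-- The powers of the generator satisfy the defining relations of divided powers, which gives an
algebra map. Freeness allows a linear map back, and the two are inverse to each other on the
spanning families of divided powers. -/
theorem exists_linearEquiv (h : IsDividedPowerSystem μ g)
    (hfree : ∀ n (c : k), c • g n = 0 → c = 0) :
    (∀ x y z : Unitization k (PositivePart A μ), x * y * z = x * (y * z)) ∧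
    (∀ x y : Unitization k (PositivePart A μ), x * y = y * x) ∧
    ∃ e : DividedPowerAlgebra k k ≃ₗ[k] Unitization k (PositivePart A μ),
      e 1 = 1 ∧ (∀ x y, e (x * y) = e x * e y) ∧
      ∀ n : ℕ, e (DividedPowerAlgebra.dp k (n + 1) (1 : k)) =
        Unitization.inr (PositivePart.of A μ n (g n)) := by
  let _ := h.nonUnitalCommRing
  let Φ : DividedPowerAlgebra k k →ₐ[k] Unitization k (PositivePart A μ) :=
    -- The n-th divided power of r must go to r ^ n times that of 1. The relation for sums is then
    -- the binomial theorem.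
    DividedPowerAlgebra.lift' (f := fun p : ℕ × k => p.2 ^ p.1 • power μ g p.1)
      (fun m => by rw [pow_zero, one_smul]; rfl)
      (fun n r m => by rw [smul_eq_mul, mul_pow, mul_smul])
      (fun n p m => by
        have := h.power_mul_power n p
        rw [smul_mul_smul_comm, ← pow_add, this, smul_comm])
      (fun n u v => by
        rw [(Commute.all u v).add_pow', Finset.sum_smul]
        refine Finset.sum_congr rfl fun p hp => ?_
        obtain rfl := Finset.HasAntidiagonal.mem_antidiagonal.1 hp
        have := h.power_mul_power p.1 p.2
        simp only
        rw [smul_mul_smul_comm, this, smul_assoc, smul_comm])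
  have hΦ : ∀ n, Φ (DividedPowerAlgebra.dp k n 1) = power μ g n := fun n => by
    rw [DividedPowerAlgebra.lift'_apply_dp, one_pow, one_smul]
  have hbij : ∀ n, Function.Bijective (LinearMap.toSpanSingleton k (A n) (g n)) := fun n =>
    ⟨(injective_iff_map_eq_zero _).2 fun c hc => hfree n c hc, fun a => by
      obtain ⟨c, rfl⟩ := h.1 n a
      exact ⟨c, rfl⟩⟩
  let ε : ∀ n, k ≃ₗ[k] A n := fun n => LinearEquiv.ofBijective _ (hbij n)
  have hε : ∀ n, (ε n).symm (g n) = 1 := fun n => by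
    rw [LinearEquiv.symm_apply_eq]
    exact (one_smul k (g n)).symm
  let ψ : PositivePart A μ →ₗ[k] DividedPowerAlgebra k k :=
    DirectSum.toModule k ℕ _ fun n =>
      (LinearMap.toSpanSingleton k _ (DividedPowerAlgebra.dp k (n + 1) (1 : k))).comp
        (ε n).symm.toLinearMap
  have hψ : ∀ n, ψ (PositivePart.of A μ n (g n)) = DividedPowerAlgebra.dp k (n + 1) 1 := by
    intro n
    refine (DirectSum.toModule_lof k n (g n)).trans ?_
    simp [hε]
  let Ψ : Unitization k (PositivePart A μ) →ₗ[k] DividedPowerAlgebra k k :=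
    (LinearMap.coprod (Algebra.linearMap k _) ψ).comp
      ({ toFun := fun x => (x.fst, x.snd), map_add' := fun _ _ => rfl,
         map_smul' := fun _ _ => rfl } :
        Unitization k (PositivePart A μ) →ₗ[k] k × PositivePart A μ)
  have hΨ : ∀ n, Ψ (power μ g n) = DividedPowerAlgebra.dp k n 1 := by
    intro n
    rcases n with _ | n
    · simp [Ψ, power, DividedPowerAlgebra.dp_zero]
    · simp [Ψ, power, hψ]
  have h1 : Ψ.comp Φ.toLinearMap = LinearMap.id := by
    refine LinearMap.ext_on_range span_dp_eq_top fun n => ?_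
    rw [LinearMap.comp_apply, AlgHom.toLinearMap_apply, hΦ, hΨ, LinearMap.id_apply]
  have h2 : ∀ x, Φ (Ψ x) = x := by
    intro x
    have hx : x = x.fst • (power μ g 0) + Unitization.inr x.snd := by
      conv_lhs => rw [← Unitization.inl_fst_add_inr_snd_eq x]
      congr 1
      ext <;> simp [power]
    rw [hx, map_add, map_add, map_smul, map_smul, hΨ, hΦ]
    congr 1
    generalize x.snd = p
    induction p using h.induction with
    | h0 => simp
    | hadd x y hx hy => rw [Unitization.inr_add, map_add, map_add, hx, hy]
    | hsmul c x hx => rw [Unitization.inr_smul, map_smul, map_smul, hx]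
    | hof n =>
      have := hΦ (n + 1)
      rwa [← hΨ (n + 1)] at this
  refine ⟨mul_assoc, mul_comm, LinearEquiv.ofLinearMap Φ.toLinearMap Ψ (LinearMap.ext h2) h1,
    map_one Φ, map_mul Φ, fun n => hΦ (n + 1)⟩

end IsDividedPowerSystem

end DividedPowers

/-! ### The form on shuffle products. -/

section PairingOfProducts

variable {F : Type*} [Field F] {V W : Type*} [AddCommGroup V] [Module F V]
  [AddCommGroup W] [Module F W]

theorem chainPairing_single (q : ℕ) (s t : Simplices F V q) (a b : ℤ) :
    chainPairing F V q (Finsupp.single s a) (Finsupp.single t b) =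
      a * (Finsupp.single t b : Chains F V q) s := by
  simp [chainPairing]

theorem chainPairing_mapChains (e : V ≃ₗ[F] W) (q : ℕ) (x y : Chains F V q) :
    chainPairing F W q (mapChains e q x) (mapChains e q y) = chainPairing F V q x y := by
  have hinj : Function.Injective (mapSimplex e : Simplices F V q → Simplices F W q) := by
    intro s t h
    ext i : 1
    exact (mapBuilding e).injective (DFunLike.congr_fun h i)
  induction x using Finsupp.induction_linear with
  | zero => simp
  | add f g hf hg => simp only [map_add, LinearMap.add_apply, hf, hg]
  | single s r =>
    induction y using Finsupp.induction_linear with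
    | zero => simp
    | add f g hf hg => simp only [map_add, hf, hg]
    | single t c =>
      classical
      simp only [mapChains, Finsupp.lmapDomain_apply, Finsupp.mapDomain_single,
        chainPairing_single, Finsupp.single_apply, hinj.eq_iff]

theorem finrank_flag [FiniteDimensional F V] {q : ℕ} (hq : Module.finrank F V = q + 1)
    (s : Simplices F V q) {c : ℕ} (hc : c ≤ q + 1) : Module.finrank F (flag s c) = c := by
  rcases c with _ | c
  · exact finrank_bot F V
  · by_cases h : c < q
    · have e : flag s (c + 1) = (s ⟨c, h⟩).1 := dif_pos h
      rw [e]
      exact finrank_eq hq s ⟨c, h⟩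
    · have e : flag s (c + 1) = ⊤ := dif_neg h
      rw [e, finrank_top]; omega

theorem exists_eq_of_step {f : ℕ → ℕ} (h0 : f 0 = 0) (hstep : ∀ k, f (k + 1) ≤ f k + 1) {N i : ℕ}
    (hi : i ≤ f N) : ∃ k ≤ N, f k = i := by
  induction N with
  | zero => exact ⟨0, le_rfl, by omega⟩
  | succ N ih =>
    by_cases h : i ≤ f N
    · obtain ⟨k, hk, e⟩ := ih h
      exact ⟨k, by omega, e⟩
    · exact ⟨N + 1, le_rfl, by have := hstep N; omega⟩

theorem eq_of_flag_eq {q : ℕ} {s s' : Simplices F V q} (h : ∀ c ≤ q, flag s c = flag s' c) :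
    s = s' := by
  ext i : 2
  have := h (i.1 + 1) (by omega)
  simpa [flag] using this

theorem card_filter_succ_le {N : ℕ} (T : Finset (Fin N)) (k : ℕ) :
    (T.filter (fun i : Fin _ => i.1 < k + 1)).card ≤
      (T.filter (fun i : Fin _ => i.1 < k)).card + 1 := by
  by_cases hk : k < N
  · rw [card_filter_succ T k hk]
    split_ifs <;> omega
  · refine le_trans (Finset.card_le_card fun i hi => ?_) (Nat.le_succ _)
    rw [Finset.mem_filter] at hi ⊢
    exact ⟨hi.1, by omega⟩

theorem Shuffle.left_total {m n : ℕ} (S : Shuffle m n) : S.left (m + n) = m := by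
  rw [Shuffle.left, Finset.filter_true_of_mem fun i _ => i.2, S.2]

theorem Shuffle.right_total {m n : ℕ} (S : Shuffle m n) : S.right (m + n) = n := by
  have := S.left_add_right (m + n) le_rfl
  rw [S.left_total] at this
  omega

theorem Shuffle.ext_left {m n : ℕ} {S T : Shuffle m n} (h : ∀ k ≤ m + n, S.left k = T.left k) :
    S = T := by
  apply Subtype.ext
  ext i
  have h1 := S.left_succ i.1 i.2
  have h2 := T.left_succ i.1 i.2
  rw [h i.1 i.2.le, h (i.1 + 1) i.2, h2] at h1
  by_cases hS : i ∈ S.1 <;> by_cases hT : i ∈ T.1 <;> simp_all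

theorem prod_inj {P P' : Submodule F V} {Q Q' : Submodule F W} (h : P.prod Q = P'.prod Q') :
    P = P' ∧ Q = Q' := by
  constructor
  · rw [← Submodule.prod_map_fst P Q, h, Submodule.prod_map_fst]
  · rw [← Submodule.prod_map_snd P Q, h, Submodule.prod_map_snd]

/-- The two projections of the k-th term recover its factors, and the dimension of the first is the
number of elements of the shuffle below k, so the shuffle is determined. These numbers grow by steps
of at most one, so every member of either flag occurs. -/
theorem mulSimplex_inj [FiniteDimensional F V] [FiniteDimensional F W] {a b : ℕ}
    (ha : Module.finrank F V = a + 1)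
    (hV : (⊥ : Submodule F V) ≠ ⊤) (hW : (⊥ : Submodule F W) ≠ ⊤)
    {S S' : Shuffle (a + 1) (b + 1)} {s s' : Simplices F V a} {t t' : Simplices F W b}
    (h : mulSimplex hV hW S s t = mulSimplex hV hW S' s' t') : S = S' ∧ s = s' ∧ t = t' := by
  have hprod : ∀ k, 0 < k → k < a + 1 + (b + 1) →
      flag s (S.left k) = flag s' (S'.left k) ∧ flag t (S.right k) = flag t' (S'.right k) := by
    intro k h0 hk
    obtain ⟨j, rfl⟩ : ∃ j, k = j + 1 := ⟨k - 1, by omega⟩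
    have := congrArg Subtype.val (DFunLike.congr_fun h ⟨j, by omega⟩)
    rw [mulSimplex_apply, mulSimplex_apply] at this
    exact prod_inj this
  obtain rfl : S = S' := by
    refine Shuffle.ext_left fun k hk => ?_
    rcases Nat.eq_zero_or_pos k with rfl | h0
    · simp [Shuffle.left]
    rcases hk.eq_or_lt with rfl | hk
    · rw [S.left_total, S'.left_total]
    · rw [← finrank_flag ha s (S.left_le k), (hprod k h0 hk).1, finrank_flag ha s' (S'.left_le k)]
  refine ⟨rfl, eq_of_flag_eq fun c hc => ?_, eq_of_flag_eq fun c hc => ?_⟩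
  · obtain ⟨k, hk, rfl⟩ := exists_eq_of_step (f := S.left) (N := a + 1 + (b + 1)) (i := c)
      (by simp [Shuffle.left]) (fun k => card_filter_succ_le _ k) (by rw [S.left_total]; omega)
    rcases Nat.eq_zero_or_pos k with rfl | h0
    · simp [Shuffle.left, flag]
    rcases hk.eq_or_lt with rfl | hk
    · rw [S.left_total] at hc
      omega
    · exact (hprod k h0 hk).1
  · obtain ⟨k, hk, rfl⟩ := exists_eq_of_step (f := S.right) (N := a + 1 + (b + 1)) (i := c)
      (by simp [Shuffle.right]) (fun k => card_filter_succ_le _ k) (by rw [S.right_total]; omega)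
    rcases Nat.eq_zero_or_pos k with rfl | h0
    · simp [Shuffle.right, flag]
    rcases hk.eq_or_lt with rfl | hk
    · rw [S.right_total] at hc
      omega
    · exact (hprod k h0 hk).2

theorem Shuffle.sign_mul_self {m n : ℕ} (S : Shuffle m n) : S.sign * S.sign = 1 := by
  rw [Shuffle.sign, mul_mul_mul_comm, ← mul_pow, ← mul_pow]
  norm_num

theorem card_shuffle (m n : ℕ) : Fintype.card (Shuffle m n) = (m + n).choose m := by
  rw [Fintype.card_finset_len, Fintype.card_fin]

/-- By `mulSimplex_inj` two products of flags share simplices only if the factors agree, and then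
only for equal shuffles. The signs square to one, so each of the shuffles contributes 1. -/
theorem chainPairing_mulChains [FiniteDimensional F V] [FiniteDimensional F W] {a b : ℕ}
    (ha : Module.finrank F V = a + 1)
    (hV : (⊥ : Submodule F V) ≠ ⊤) (hW : (⊥ : Submodule F W) ≠ ⊤)
    (x x' : Chains F V a) (y y' : Chains F W b) :
    chainPairing F (V × W) (a + 1 + b) (mulChains hV hW x y) (mulChains hV hW x' y') =
      (a + 1 + (b + 1)).choose (a + 1) * (chainPairing F V a x x' * chainPairing F W b y y') := by
  induction x using Finsupp.induction_linear with
  | zero => simp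
  | add f g hf hg => simp only [map_add, LinearMap.add_apply, hf, hg]; ring
  | single s p =>
  induction y using Finsupp.induction_linear with
  | zero => simp
  | add f g hf hg => simp only [map_add, LinearMap.add_apply, hf, hg]; ring
  | single t r =>
  induction x' using Finsupp.induction_linear with
  | zero => simp
  | add f g hf hg => simp only [map_add, LinearMap.add_apply, hf, hg]; ring
  | single s' p' =>
  induction y' using Finsupp.induction_linear with
  | zero => simp
  | add f g hf hg => simp only [map_add, hf, hg]; ring
  | single t' r' =>
  classical
  have key : ∀ S S' : Shuffle (a + 1) (b + 1),
      chainPairing F (V × W) (a + 1 + b) (Finsupp.single (mulSimplex hV hW S s t) S.sign)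
        (Finsupp.single (mulSimplex hV hW S' s' t') S'.sign) =
      if S = S' then (if s = s' ∧ t = t' then 1 else 0) else 0 := by
    intro S S'
    rw [chainPairing_single, Finsupp.single_apply]
    by_cases h : mulSimplex hV hW S' s' t' = mulSimplex hV hW S s t
    · obtain ⟨rfl, rfl, rfl⟩ := mulSimplex_inj ha hV hW h
      simp [Shuffle.sign_mul_self]
    · rw [if_neg h, mul_zero]
      split_ifs with h1 h2
      · obtain ⟨rfl, rfl⟩ := h2
        subst h1
        exact absurd rfl h
      · rfl
      · rfl
  simp only [mulChains_single, map_smul, map_sum, LinearMap.smul_apply, LinearMap.sum_apply, key]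
  simp only [Finset.sum_ite_eq', Finset.mem_univ, if_true, Finset.sum_const,
    Finset.card_univ, card_shuffle, chainPairing_single, Finsupp.single_apply]
  by_cases hs : s = s' <;> by_cases ht : t = t' <;> simp [hs, ht, eq_comm]
  ring

end PairingOfProducts

/-! ### Structure constants of the coinvariant ring. -/

section Structure

variable (F : Type*) [Field F]

theorem stPairing_stMul (m n : ℕ) (a b : St F m) (c d : St F n) :
    stPairing F (m + 1 + n) (stMul F m n a c) (stMul F m n b d) =
      (m + 1 + (n + 1)).choose (m + 1) * (stPairing F m a b * stPairing F n c d) := by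
  refine (chainPairing_mapChains (sumEquiv F m n) (m + 1 + n) _ _).trans ?_
  exact chainPairing_mulChains (by simp) (bot_ne_top' F m) (bot_ne_top' F n) a.1 b.1 c.1 d.1

theorem coinvPairing_coinvSqMul (m n : ℕ) (x : Coinv F m) (y : Coinv F n) :
    coinvPairing F (m + 1 + n) (coinvSqMul F m n x y) = (-1) ^ ((m + 1) * (n + 1)) *
      ((m + 1 + (n + 1)).choose (m + 1) * (coinvPairing F m x * coinvPairing F n y)) := by
  obtain ⟨x, rfl⟩ := Representation.Coinvariants.mk_surjective (stSqRep F m) x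
  obtain ⟨y, rfl⟩ := Representation.Coinvariants.mk_surjective (stSqRep F n) y
  change coinvPairing F (m + 1 + n) (coinvSqMul F m n (Coinv.mk F m x) (Coinv.mk F n y)) =
    (-1) ^ ((m + 1) * (n + 1)) * ((m + 1 + (n + 1)).choose (m + 1) *
      (coinvPairing F m (Coinv.mk F m x) * coinvPairing F n (Coinv.mk F n y)))
  rw [coinvSqMul_mk]
  induction x using stSq_induction with
  | h0 => simp
  | ha x x' hx hx' => simp only [map_add, LinearMap.add_apply, hx, hx']; ring
  | ht a b =>
    induction y using stSq_induction with
    | h0 => simp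
    | ha x x' hx hx' => simp only [map_add, hx, hx']; ring
    | ht c d =>
      rw [stSqMul_tmul, map_smul, map_smul, coinvPairing_mk_tmul, coinvPairing_mk_tmul,
        coinvPairing_mk_tmul, stPairing_stMul, smul_eq_mul]

/-- With d = m + 1 and e = n + 1, the number of pairs in a set of d + e elements is that for d plus
that for e plus d e. This turns the Koszul sign into a coboundary, removed by the normalization of
γ. -/
theorem neg_one_pow_triangle (m n : ℕ) :
    (-1 : ℤ) ^ ((m + 1) * (n + 1)) * ((-1) ^ ((m + 1) * m / 2) * (-1) ^ ((n + 1) * n / 2)) =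
      (-1) ^ ((m + 1 + n + 1) * (m + 1 + n) / 2) := by
  rw [← pow_add, ← pow_add]
  congr 1
  have h : ∀ k, (k + 1) * k / 2 * 2 = (k + 1) * k := fun k =>
    Nat.div_mul_cancel (by rw [mul_comm]; exact (Nat.even_mul_succ_self k).two_dvd)
  have h1 := h m
  have h2 := h n
  have h3 := h (m + 1 + n)
  have h4 : (m + 1 + n + 1) * (m + 1 + n) =
      (m + 1) * m + (n + 1) * n + 2 * ((m + 1) * (n + 1)) := by ring
  omega

variable [Infinite F]

/-- The divided powers in the coinvariants. -/
theorem isDividedPowerSystem_coinv {γ : ∀ n : ℕ, Coinv F n}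
    (hγ : ∀ n : ℕ, coinvPairing F n (γ n) = (-1) ^ ((n + 1) * n / 2)) :
    IsDividedPowerSystem (coinvSqMul F) γ := by
  -- The form takes the value ±1 on γ, so the coefficient of a is its value corrected by that sign.
  refine ⟨fun n a => ⟨coinvPairing F n a * (-1) ^ ((n + 1) * n / 2), ?_⟩, fun m n => ?_⟩
  · apply (coinvPairing_bijective F n).1
    rw [map_smul, hγ, smul_eq_mul, mul_assoc, ← mul_pow]
    norm_num
  · apply (coinvPairing_bijective F (m + 1 + n)).1
    rw [coinvPairing_coinvSqMul, map_nsmul, hγ, hγ, hγ, ← neg_one_pow_triangle, nsmul_eq_mul]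
    simp only [add_assoc]
    ring

end Structure

/-! ### Coefficients in a commutative ring. -/

section BaseChangeOfCoinvariants

variable (k : Type*) [CommRing k] (F : Type*) [Field F]

/-- The bilinear form on `St²`, as a linear map. -/
def stSqPairing (n : ℕ) : StSq F n →ₗ[ℤ] ℤ :=
  (coinvPairing F n).comp (Coinv.mk F n)

/-- The `k`-linear map `St²_k(F^(n+1))_{GL} → k` induced by the bilinear form. -/
def coinvOverPairing (n : ℕ) : CoinvOver k F n →ₗ[k] k :=
  Representation.Coinvariants.lift (stSqOverRep k F n)
    ((TensorProduct.AlgebraTensorModule.rid ℤ k k).toLinearMap.comp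
      (LinearMap.baseChange k (stSqPairing F n))) fun g => by
    refine LinearMap.ext fun z => ?_
    induction z using TensorProduct.induction_on with
    | zero => simp
    | add x y hx hy => rw [map_add, map_add, hx, hy]
    | tmul c z =>
      have e : Coinv.mk F n (stSqRep F n g z) = Coinv.mk F n z :=
        Representation.Coinvariants.mk_self_apply (stSqRep F n) g z
      rw [LinearMap.comp_apply, stSqOverRep_tmul]
      simp [stSqPairing, e]

theorem coinvOverPairing_coinvBaseChange (n : ℕ) (x : Coinv F n) :
    coinvOverPairing k F n (coinvBaseChange k F n x) = (coinvPairing F n x : k) := by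
  obtain ⟨x, rfl⟩ := Representation.Coinvariants.mk_surjective (stSqRep F n) x
  change TensorProduct.AlgebraTensorModule.rid ℤ k k
    (LinearMap.baseChange k (stSqPairing F n) (1 ⊗ₜ x)) = _
  rw [LinearMap.baseChange_tmul, TensorProduct.AlgebraTensorModule.rid_tmul, zsmul_one]
  rfl

theorem coinvOverMul_coinvBaseChange (m n : ℕ) (x : Coinv F m) (y : Coinv F n) :
    coinvOverMul k F m n (coinvBaseChange k F m x) (coinvBaseChange k F n y) =
      coinvBaseChange k F (m + 1 + n) (coinvSqMul F m n x y) := by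
  obtain ⟨x, rfl⟩ := Representation.Coinvariants.mk_surjective (stSqRep F m) x
  obtain ⟨y, rfl⟩ := Representation.Coinvariants.mk_surjective (stSqRep F n) y
  change CoinvOver.mk k F (m + 1 + n) (stSqOverMul k F m n (1 ⊗ₜ x) (1 ⊗ₜ y)) =
    CoinvOver.mk k F (m + 1 + n) (1 ⊗ₜ stSqMul F m n x y)
  rw [stSqOverMul_tmul, mul_one]

variable {F} in
-- A pure tensor a ⊗ z is a times the image of the integral class of z, so an integral generator
-- generates over k. Freeness comes separately from `coinvOverPairing`.
theorem exists_eq_smul_coinvBaseChange {n : ℕ} {c : Coinv F n}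
    (hc : ∀ x : Coinv F n, ∃ t : ℤ, x = t • c) (x : CoinvOver k F n) :
    ∃ t : k, x = t • coinvBaseChange k F n c := by
  obtain ⟨x, rfl⟩ := Representation.Coinvariants.mk_surjective (stSqOverRep k F n) x
  change ∃ t : k, CoinvOver.mk k F n x = t • coinvBaseChange k F n c
  induction x using TensorProduct.induction_on with
  | zero => exact ⟨0, by simp⟩
  | add x y hx hy =>
    obtain ⟨s, hs⟩ := hx
    obtain ⟨t, ht⟩ := hy
    exact ⟨s + t, by rw [map_add, hs, ht, add_smul]⟩
  | tmul a z =>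
    obtain ⟨t, ht⟩ := hc (Coinv.mk F n z)
    refine ⟨a * t, ?_⟩
    have e : (a ⊗ₜ[ℤ] z : StSqOver k F n) = a • ((1 : k) ⊗ₜ[ℤ] z) := by
      rw [TensorProduct.smul_tmul', smul_eq_mul, mul_one]
    rw [e, map_smul, ← coinvBaseChange_mk, ht, map_zsmul, mul_smul, Int.cast_smul_eq_zsmul]

theorem isDividedPowerSystem_coinvOver {γ : ∀ n : ℕ, Coinv F n}
    (hγ : IsDividedPowerSystem (coinvSqMul F) γ) :
    IsDividedPowerSystem (coinvOverMul k F) fun n => coinvBaseChange k F n (γ n) := by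
  refine ⟨fun n a => exists_eq_smul_coinvBaseChange k (hγ.1 n) a, fun m n => ?_⟩
  rw [coinvOverMul_coinvBaseChange, hγ.2, map_nsmul]

end BaseChangeOfCoinvariants

end Steinberg

end

theorem mainTheorem8 (F : Type*) [Field F] [Infinite F] :
    (∀ n : ℕ, Function.Bijective (Steinberg.coinvPairing F n)) ∧
    ∃ γ : ∀ n : ℕ, Steinberg.Coinv F n,
      (∀ n : ℕ, Steinberg.coinvPairing F n (γ n) = (-1) ^ ((n + 1) * n / 2)) ∧
      ((∀ x y z : Steinberg.CoinvAlgebra F, x * y * z = x * (y * z)) ∧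
        (∀ x y : Steinberg.CoinvAlgebra F, x * y = y * x) ∧
        ∃ e : DividedPowerAlgebra ℤ ℤ ≃ₗ[ℤ] Steinberg.CoinvAlgebra F,
          e 1 = 1 ∧ (∀ x y, e (x * y) = e x * e y) ∧
          ∀ n : ℕ, e (DividedPowerAlgebra.dp ℤ (n + 1) (1 : ℤ)) =
            Steinberg.CoinvAlgebra.of F n (γ n)) ∧
      ∀ (k : Type*) [CommRing k],
        (∀ x y z : Steinberg.CoinvAlgebraOver F k, x * y * z = x * (y * z)) ∧
        (∀ x y : Steinberg.CoinvAlgebraOver F k, x * y = y * x) ∧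
        ∃ e : DividedPowerAlgebra k k ≃ₗ[k] Steinberg.CoinvAlgebraOver F k,
          e 1 = 1 ∧ (∀ x y, e (x * y) = e x * e y) ∧
          ∀ n : ℕ, e (DividedPowerAlgebra.dp k (n + 1) (1 : k)) =
            Steinberg.CoinvAlgebraOver.of F k n (Steinberg.coinvBaseChange k F n (γ n)) := by
  have hbij := Steinberg.coinvPairing_bijective F
  choose γ hγ using fun n : ℕ => (hbij n).2 ((-1) ^ ((n + 1) * n / 2))
  have hsys := Steinberg.isDividedPowerSystem_coinv F hγ
  -- The form sends γ to a unit, which remains a unit in every k. This gives freeness over ℤ and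
  -- over k.
  have hunit : ∀ n : ℕ, ((-1 : ℤ) ^ ((n + 1) * n / 2)) * (-1) ^ ((n + 1) * n / 2) = 1 := fun n => by
    rw [← mul_pow]; norm_num
  refine ⟨hbij, γ, hγ, hsys.exists_linearEquiv fun n c hc => ?_, fun k _ =>
    (Steinberg.isDividedPowerSystem_coinvOver k F hsys).exists_linearEquiv fun n c hc => ?_⟩
  · have h := congrArg (Steinberg.coinvPairing F n) hc
    rw [map_smul, map_zero, hγ, smul_eq_mul] at h
    rw [← mul_one c, ← hunit n, ← mul_assoc, h, zero_mul]
  · have h := congrArg (Steinberg.coinvOverPairing k F n) hc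
    rw [map_smul, map_zero, Steinberg.coinvOverPairing_coinvBaseChange, hγ, smul_eq_mul] at h
    have hu := congrArg (Int.cast : ℤ → k) (hunit n)
    rw [Int.cast_mul, Int.cast_one] at hu
    rw [← mul_one c, ← hu, ← mul_assoc, h, zero_mul]
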